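/- All designs are finite incidence structures $\mathcal D=(\mathcal P,\mathcal B,\mathcal I)$ with nonempty point set and nonempty block set. For $t\le k$, $\mathcal D$ is a $t$-$(v,k,\lambda)$ design if $|\mathcal P|=v$, every block is incident with exactly $k$ points, and every $t$ points are together incident with exactly $\lambda$ blocks. It is simple if distinct blocks have distinct point sets. An automorphism is a pair consisting of a permutation of the points and a permutation of the blocks that preserves incidence. Let $M_{11}$ and $M_{12}$ be the Mathieu groups of degree 11 and 12. **Theorem.** Up to isomorphism there are exactly 24 simple $t$-$(v,k,\lambda)$ designs with $t\ge 2$, $v\in\{11,12,22\}$ and $3\le k\le v/2$ on which $M_{11}$ acts as a group of automorphisms transitively on points and transitively on blocks. They are distributed as in the following table, in which $t$ is the largest number for which the design is a $t$-design, and the last two columns give the number of pairwise non-isomorphic designs of the row and the full automorphism group of each of them. | Parameters | Number of blocks | Number of non-isomorphic designs | Full automorphism group | |---|---|---|---| | $3$-$(11,3,1)$ | 165 | 1 | $S_{11}$ | | $4$-$(11,4,1)$ | 330 | 1 | $S_{11}$ | | $4$-$(11,5,1)$ | 66 | 1 | $M_{11}$ | | $4$-$(11,5,6)$ | 396 | 1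 | $M_{11}$ | | $3$-$(12,3,1)$ | 220 | 1 | $S_{12}$ | | $3$-$(12,4,6)$ | 330 | 1 | $M_{11}$ | | $3$-$(12,4,3)$ | 165 | 1 | $M_{11}$ | | $3$-$(12,5,6)$ | 132 | 1 | $M_{11}$ | | $3$-$(12,5,30)$ | 660 | 1 | $M_{11}$ | | $3$-$(12,6,2)$ | 22 | 1 | $M_{11}$ | | $3$-$(12,6,10)$ | 110 | 1 | $M_{11}$ | | $5$-$(12,6,6)$ | 792 | 1 | $M_{12}$ | | $2$-$(22,7,36)$ | 396 | 1 | $M_{11}$ | | $2$-$(22,7,180)$ | 1980 | 1 | $M_{11}$ | | $2$-$(22,7,360)$ | 3960 | 3 | $M_{11}$ | | $2$-$(22,7,720)$ | 7920 | 2 | $M_{11}$ | | $3$-$(22,7,18)$ | 792 | 1 | $M_{11}\times Z_2$ | | $3$-$(22,7,90)$ | 3960 | 3 | $M_{11}\times Z_2$ | | $3$-$(22,7,180)$ | 7920 | 1 | $M_{11}$ | Every simple $t$-$(v,k,\lambda)$ design with $t\ge 2$, $v\in\{11,12,22\}$ and $v/2\le k\le v-3$ on which $M_{11}$ acts as a group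 of automorphisms transitively on points and on blocks has a complement (same points and blocks, incidence negated) isomorphic to one of these 24 designs. -/

import Mathlib

/-- An incidence structure with points `P`, blocks `B` and incidence relation `Inc`. -/
structure IncidenceStructure (P : Type*) (B : Type*) where
  Inc : P → B → Prop
  nonempty_points : Nonempty P
  nonempty_blocks : Nonempty B

namespace IncidenceStructure

/-- The set of points incident with a block. -/
def pointsOf {P B : Type*} (D : IncidenceStructure P B) (b : B) : Set P :=
  {p | D.Inc p b}

/-- `D` is a `t`-`(v, k, lam)` design. As usual, `t ≤ k` is part of the definition, so that
the condition on `t`-sets is never vacuous (and `lam` is automatically positive). -/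
structure IsDesign {P B : Type*} (D : IncidenceStructure P B) (t v k lam : ℕ) : Prop where
  finite_points : Finite P
  finite_blocks : Finite B
  le_block_size : t ≤ k
  card_points : Nat.card P = v
  card_block : ∀ b : B, (D.pointsOf b).ncard = k
  balanced : ∀ T : Finset P, T.card = t → Nat.card {b : B // ∀ p ∈ T, D.Inc p b} = lam

/-- `D` is a `t`-`(v, k, lam)` design, and `t` is as large as possible. -/
def IsDesignOfStrength {P B : Type*} (D : IncidenceStructure P B) (t v k lam : ℕ) : Prop :=
  D.IsDesign t v k lam ∧ ∀ s mu : ℕ, t < s → ¬ D.IsDesign s v k mu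

/-- No repeated blocks: distinct blocks have distinct point sets. -/
def IsSimple {P B : Type*} (D : IncidenceStructure P B) : Prop :=
  Function.Injective D.pointsOf

/-- Isomorphism of incidence structures. -/
def IsIsomorphic {P B P' B' : Type*} (D : IncidenceStructure P B)
    (E : IncidenceStructure P' B') : Prop :=
  ∃ (f : P ≃ P') (g : B ≃ B'), ∀ (p : P) (b : B), E.Inc (f p) (g b) ↔ D.Inc p b

/-- The full automorphism group: all pairs of a permutation of the points and a permutation of
the blocks that preserve incidence. -/
def aut {P B : Type*} (D : IncidenceStructure P B) :
    Subgroup (Equiv.Perm P × Equiv.Perm B) where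
  carrier := {f | ∀ (p : P) (b : B), D.Inc (f.1 p) (f.2 b) ↔ D.Inc p b}
  one_mem' := fun _ _ => Iff.rfl
  mul_mem' := fun {f g} hf hg p b => (hf (g.1 p) (g.2 b)).trans (hg p b)
  inv_mem' := fun {f} hf p b => by
    have h := hf (f.1⁻¹ p) (f.2⁻¹ b)
    simpa using h.symm

/-- `G` acts on `D` by automorphisms, transitively on points and transitively on blocks. -/
def AdmitsTransitiveAction {P B : Type*} (D : IncidenceStructure P B)
    (G : Type*) [Group G] : Prop :=
  ∃ φ : G →* D.aut,
    (∀ p q : P, ∃ g : G, (φ g : Equiv.Perm P × Equiv.Perm B).1 p = q) ∧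
    (∀ b c : B, ∃ g : G, (φ g : Equiv.Perm P × Equiv.Perm B).2 b = c)

/-- The complementary structure: the same points and blocks, incidence negated. -/
def compl {P B : Type*} (D : IncidenceStructure P B) : IncidenceStructure P B where
  Inc p b := ¬ D.Inc p b
  nonempty_points := D.nonempty_points
  nonempty_blocks := D.nonempty_blocks

end IncidenceStructure

/-- The Mathieu group `M₁₁` of degree 11 and order 7920, on the points `0, …, 10`, generated by
`(1,2,…,11)` and `(3,7,11,8)(4,10,5,6)`, with every label lowered by 1. -/
def MathieuM11 : Subgroup (Equiv.Perm (Fin 11)) :=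
  Subgroup.closure
    {c[0, 1, 2, 3, 4, 5, 6, 7, 8, 9, 10],
     c[2, 6, 10, 7] * c[3, 9, 4, 5]}

/-- The Mathieu group `M₁₂` of degree 12 and order 95040, on the points `0, …, 11`, generated by
the generators of `M₁₁` (fixing the point `11`) and
`(1,12)(2,11)(3,6)(4,8)(5,9)(7,10)`, with every label lowered by 1. -/
def MathieuM12 : Subgroup (Equiv.Perm (Fin 12)) :=
  Subgroup.closure
    {c[0, 1, 2, 3, 4, 5, 6, 7, 8, 9, 10],
     c[2, 6, 10, 7] * c[3, 9, 4, 5],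
     c[0, 11] * c[1, 10] * c[2, 5] * c[3, 7] * c[4, 8] * c[6, 9]}

/-- A row of the classification table: parameters `t`-`(v, k, lam)`, number of blocks, number of
isomorphism classes, and the full automorphism group of each of the designs. -/
structure DesignRow where
  t : ℕ
  v : ℕ
  k : ℕ
  lam : ℕ
  blocks : ℕ
  num : ℕ
  autGroup : GrpCat.{0}

/-- The classification table. -/
def designTable : Fin 19 → DesignRow :=
  let S11 := GrpCat.of (Equiv.Perm (Fin 11))
  let S12 := GrpCat.of (Equiv.Perm (Fin 12))
  let M11 := GrpCat.of MathieuM11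
  let M12 := GrpCat.of MathieuM12
  let M11Z2 := GrpCat.of (MathieuM11 × Multiplicative (ZMod 2))
  ![⟨3, 11, 3, 1, 165, 1, S11⟩,
    ⟨4, 11, 4, 1, 330, 1, S11⟩,
    ⟨4, 11, 5, 1, 66, 1, M11⟩,
    ⟨4, 11, 5, 6, 396, 1, M11⟩,
    ⟨3, 12, 3, 1, 220, 1, S12⟩,
    ⟨3, 12, 4, 6, 330, 1, M11⟩,
    ⟨3, 12, 4, 3, 165, 1, M11⟩,
    ⟨3, 12, 5, 6, 132, 1, M11⟩,
    ⟨3, 12, 5, 30, 660, 1, M11⟩,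
    ⟨3, 12, 6, 2, 22, 1, M11⟩,
    ⟨3, 12, 6, 10, 110, 1, M11⟩,
    ⟨5, 12, 6, 6, 792, 1, M12⟩,
    ⟨2, 22, 7, 36, 396, 1, M11⟩,
    ⟨2, 22, 7, 180, 1980, 1, M11⟩,
    ⟨2, 22, 7, 360, 3960, 3, M11⟩,
    ⟨2, 22, 7, 720, 7920, 2, M11⟩,
    ⟨3, 22, 7, 18, 792, 1, M11Z2⟩,
    ⟨3, 22, 7, 90, 3960, 3, M11Z2⟩,
    ⟨3, 22, 7, 180, 7920, 1, M11⟩]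

/-- One index for each design of the table: a row, and a number below the number of pairwise
non-isomorphic designs of that row. -/
abbrev DesignIndex : Type := Σ r : Fin 19, Fin (designTable r).num

/-!
The blocks of a simple design with a point- and block-transitive group form one orbit of the group
on the subsets of the point set. So the classification consists of three tasks: finding the
transitive actions of the Mathieu group of degree 11, 12 and 22, finding the orbits on subsets that
are 2-designs, and computing the isomorphisms between these designs.

*Actions.* The group is generated by elements `gA` of order 11 and `gD` of order 4, with `(gA * gD)
^ 3 = 1`; an element `gC` of order 5 normalizes the group of `gA` and is normalized by `gD`. In a
transitive action of degree 11 or 22 the element `gA` acts without fixed points, in one of degree 12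
it has one fixed point, and since `gC` has fixed points, the points can be labelled such that `gA`
and `gC` act by fixed formulas. The relations for `gD` then leave few possibilities, which are found
by a search, and all but one are intransitive (`eq_rho11`, `eq_rho12`, `eq_rho22`). So there is one
transitive action of each degree (`exists_equiv11`, `exists_equiv12`, `exists_equiv22`). The actions
of degree 12 and 22 are constructed from the blocks of the Steiner system `S(4, 5, 11)`: each of the
66 blocks is matched with a pair of the 12 points, or with a set of 5 of the 22 points
(`exists_rep`).

*Degree 11 and 12.* The actions are 4-transitive and 3-transitive, so every orbit is a 4-design or
3-design (if its sets are large enough). The orbits (`orbits11`, `orbits12`) and the automorphism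
groups of the designs are computed with sets coded as bit masks; an orbit that is complementary to
another family of `k`-sets has the same automorphisms as that family. The blocks of `S(5, 6, 12)`
are the union of two orbits, which gives the Mathieu group of degree 12 as the automorphism group of
the orbit of all other 6-sets (`stabilizer_hexads`).

*Degree 22.* The points form 11 fibres of two points, permuted by the group as in degree 11. Since
both the pairs within fibres and the other pairs are each one orbit, an orbit on `k`-sets is a
2-design if and only if the numbers of pairs of both kinds in a block are in the right proportion;
for `3 ≤ k ≤ 11` this holds exactly for the blocks that contain one full fibre and one point of five
others (`mem_setsOfType_of_blockCount_two`). Up to the permutation `swap`, which exchanges the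
points of every fibre and commutes with the group, twelve orbits on these sets remain
(`exists_mem_blocks22`). An orbit is a 3-design if half of the triples in different fibres in a
block are of each of two kinds (`blockCount_three`). An isomorphism between two of these designs
preserves the fibres, because they are determined by the numbers of blocks through 4-sets
(`proj_eq_iff`), and induces an automorphism of `S(4, 5, 11)` on the base, hence an element of the
Mathieu group. What remains is a permutation that exchanges the points of some of the fibres;
counting the blocks through the five kinds of 4-sets in different fibres shows that it exchanges the
points of all of them or of none (`eq_of_mapsFamily`).

A design with `v ≤ 2 * k` is the complement of a 2-design with `2 * k ≤ v` and the same action.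
-/

open scoped Pointwise

namespace M11Designs

/-! ### Finite sets as bit masks -/

/-- The subset of `Fin n` whose characteristic function is the binary expansion of `m`. -/
def maskSet (n m : ℕ) : Finset (Fin n) := Finset.univ.filter fun p => m.testBit p = true

@[simp] lemma mem_maskSet {n m : ℕ} {p : Fin n} : p ∈ maskSet n m ↔ m.testBit p = true := by
  simp [maskSet]

/-- The bit mask of a subset of `Fin n`. -/
def toMask {n : ℕ} (S : Finset (Fin n)) : ℕ :=
  Nat.ofBits (fun i : Fin n => decide (i ∈ S))

lemma testBit_toMask {n : ℕ} (S : Finset (Fin n)) (p : Fin n) :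
    (toMask S).testBit p = decide (p ∈ S) := by
  simp [toMask, Nat.testBit_ofBits_lt]

lemma testBit_toMask_of_le {n : ℕ} (S : Finset (Fin n)) {i : ℕ} (h : n ≤ i) :
    (toMask S).testBit i = false := by
  simp [toMask, Nat.testBit_ofBits_ge _ _ h]

lemma toMask_lt {n : ℕ} (S : Finset (Fin n)) : toMask S < 2 ^ n := Nat.ofBits_lt_two_pow _

@[simp] lemma maskSet_toMask {n : ℕ} (S : Finset (Fin n)) : maskSet n (toMask S) = S := by
  ext p; simp [testBit_toMask]

lemma toMask_maskSet {n m : ℕ} (h : m < 2 ^ n) : toMask (maskSet n m) = m := by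
  apply Nat.eq_of_testBit_eq
  intro i
  by_cases hi : i < n
  · rw [testBit_toMask _ ⟨i, hi⟩]; simp
  · rw [testBit_toMask_of_le _ (by omega)]
    exact (Nat.testBit_eq_false_of_lt (h.trans_le (Nat.pow_le_pow_right (by norm_num)
      (by omega)))).symm

lemma toMask_injective {n : ℕ} : Function.Injective (toMask (n := n)) := fun S T h => by
  rw [← maskSet_toMask S, h, maskSet_toMask]

/-- `k` applied to `n`. The case distinction makes the kernel evaluate `n` to a literal first, so
that loops carry numbers and not unevaluated expressions. -/
def force {α : Type*} (n : ℕ) (k : ℕ → α) : α :=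
  match n + 1 with
  | 0 => k 0
  | m + 1 => k m

@[simp] lemma force_eq {α : Type*} (n : ℕ) (k : ℕ → α) : force n k = k n := rfl

/-- The mask of the image under `f` of the subset of `{0, …, n - 1}` with mask `m`. -/
def imgMask (f : ℕ → ℕ) (m : ℕ) : ℕ → ℕ
  | 0 => 0
  | n + 1 => (bif m.testBit n then 1 <<< f n else 0) ||| imgMask f m n

lemma testBit_one_shiftLeft (i j : ℕ) : (1 <<< i : ℕ).testBit j = decide (i = j) := by
  rw [Nat.one_shiftLeft, Nat.testBit_two_pow]

lemma testBit_imgMask (f : ℕ → ℕ) (m n j : ℕ) :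
    (imgMask f m n).testBit j = true ↔ ∃ p < n, m.testBit p = true ∧ f p = j := by
  induction n with
  | zero => simp [imgMask]
  | succ n ih =>
    rw [imgMask, Nat.testBit_or, Bool.or_eq_true, ih]
    constructor
    · rintro (h | ⟨p, hp, h⟩)
      · cases hb : m.testBit n
        · simp [hb] at h
        · rw [hb, cond_true, testBit_one_shiftLeft] at h
          exact ⟨n, by omega, hb, by simpa using h⟩
      · exact ⟨p, by omega, h⟩
    · rintro ⟨p, hp, h1, h2⟩
      rcases Nat.lt_succ_iff_lt_or_eq.1 hp with h | rfl
      · exact Or.inr ⟨p, h, h1, h2⟩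
      · left; rw [h1, cond_true, testBit_one_shiftLeft]; simpa using h2

lemma maskSet_imgMask {n : ℕ} (f : ℕ → ℕ) (σ : Equiv.Perm (Fin n))
    (h : ∀ p, (σ p : ℕ) = f p) (m : ℕ) : maskSet n (imgMask f m n) = σ • maskSet n m := by
  ext q
  rw [mem_maskSet, testBit_imgMask, Finset.mem_smul_finset]
  constructor
  · rintro ⟨p, hp, h1, h2⟩
    exact ⟨⟨p, hp⟩, by simpa using h1, Fin.ext (by rw [Equiv.Perm.smul_def, h]; exact h2)⟩
  · rintro ⟨p, hp, rfl⟩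
    exact ⟨p, p.2, by simpa using hp, (h p).symm⟩

lemma imgMask_lt {f : ℕ → ℕ} {n : ℕ} (hf : ∀ p < n, f p < n) (m : ℕ) : imgMask f m n < 2 ^ n := by
  apply Nat.lt_pow_two_of_testBit
  intro i hi
  by_contra hc
  obtain ⟨p, hp, -, rfl⟩ := (testBit_imgMask f m n i).1 (by simpa using hc)
  exact absurd (hf p hp) (by omega)

/-- The number of elements of the subset of `{0, …, n - 1}` with mask `m`. -/
def popcount (m : ℕ) : ℕ → ℕ
  | 0 => 0
  | n + 1 => (bif m.testBit n then 1 else 0) + popcount m n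

lemma card_maskSet (n m : ℕ) : (maskSet n m).card = popcount m n := by
  induction n with
  | zero => rfl
  | succ n ih =>
    have : maskSet (n + 1) m = (maskSet n m).map Fin.castSuccEmb ∪
        (if m.testBit n then {Fin.last n} else ∅) := by
      ext p
      refine Fin.lastCases ?_ (fun i => ?_) p
      · by_cases hb : m.testBit n = true <;> simp [hb]
      · by_cases hb : m.testBit n = true <;> simp [hb]
    rw [this, Finset.card_union_of_disjoint, Finset.card_map, ih, popcount, add_comm]
    · congr 1
      by_cases hb : m.testBit n = true <;> simp [hb]
    · rw [Finset.disjoint_left]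
      intro p hp
      obtain ⟨q, -, rfl⟩ := Finset.mem_map.1 hp
      by_cases hb : m.testBit n = true <;> simp [hb]

/-! ### Orbits by breadth-first search -/

/-- Breadth-first search: `vis` is the bit map of the numbers visited so far, and the list holds
those visited numbers whose images under `f` and `g` have not been looked at yet. -/
def bfs (f g : ℕ → ℕ) : ℕ → ℕ → List ℕ → ℕ
  | 0, vis, _ => vis
  | _ + 1, vis, [] => vis
  | k + 1, vis, x :: q =>
    force (f x) fun y => force (g x) fun z =>
      bif vis.testBit y then
        bif vis.testBit z then bfs f g k vis q
        else force (vis ||| 1 <<< z) fun vis' => bfs f g k vis' (z :: q)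
      else
        force (vis ||| 1 <<< y) fun vis' =>
          bif vis'.testBit z then bfs f g k vis' (y :: q)
          else force (vis' ||| 1 <<< z) fun vis'' => bfs f g k vis'' (z :: y :: q)

lemma bfs_sound (f g : ℕ → ℕ) (P : ℕ → Prop) (hf : ∀ x, P x → P (f x)) (hg : ∀ x, P x → P (g x)) :
    ∀ (k vis : ℕ) (q : List ℕ), (∀ x, vis.testBit x = true → P x) → (∀ x ∈ q, P x) →
      ∀ x, (bfs f g k vis q).testBit x = true → P x := by
  have key : ∀ (vis z : ℕ), (∀ x, vis.testBit x = true → P x) → P z →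
      ∀ x, (vis ||| 1 <<< z).testBit x = true → P x := by
    intro vis z hv hz x hx
    rw [Nat.testBit_or, Bool.or_eq_true, testBit_one_shiftLeft, decide_eq_true_eq] at hx
    rcases hx with hx | rfl
    exacts [hv x hx, hz]
  intro k
  induction k with
  | zero => intro vis q hv _; simpa [bfs] using hv
  | succ k ih =>
    intro vis q hv hq
    cases q with
    | nil => simpa [bfs] using hv
    | cons x q =>
      have hx := hq x (by simp)
      have hq' : ∀ y ∈ q, P y := fun y hy => hq y (by simp [hy])
      have h2 : ∀ z, P z → ∀ y ∈ z :: q, P y := by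
        intro z hz y hy
        rcases List.mem_cons.1 hy with rfl | hy
        exacts [hz, hq' y hy]
      have h3 : ∀ z z', P z → P z' → ∀ y ∈ z :: z' :: q, P y := by
        intro z z' hz hz' y hy
        rcases List.mem_cons.1 hy with rfl | hy
        exacts [hz, h2 z' hz' y hy]
      simp only [bfs, force_eq]
      cases vis.testBit (f x) <;>
        [cases (vis ||| 1 <<< f x).testBit (g x); cases vis.testBit (g x)] <;>
        simp only [cond_true, cond_false]
      · exact ih _ _ (key _ _ (key _ _ hv (hf x hx)) (hg x hx)) (h3 _ _ (hg x hx) (hf x hx))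
      · exact ih _ _ (key _ _ hv (hf x hx)) (h2 _ (hf x hx))
      · exact ih _ _ (key _ _ hv (hg x hx)) (h2 _ (hg x hx))
      · exact ih _ _ hv hq'

/-- Whether the set of numbers below `N` with bit map `vis` is closed under `f`. -/
def closedUnder (f : ℕ → ℕ) (vis N : ℕ) : Bool :=
  (List.range N).all fun x => !vis.testBit x || vis.testBit (f x)

/-! ### Backtracking search -/

/-- All extensions of `l` by `n` further entries below `v` such that every step satisfies `C`. Lists
are kept in reverse, the newest entry first. -/
def extend (C : List ℕ → Bool) (v : ℕ) : ℕ → List ℕ → List (List ℕ)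
  | 0, l => [l]
  | n + 1, l => (List.range v).flatMap fun y =>
      bif C (y :: l) then extend C v n (y :: l) else []

/-- The reversed list of the first `j` values of `s`. -/
def valuesRev (s : ℕ → ℕ) : ℕ → List ℕ
  | 0 => []
  | j + 1 => s j :: valuesRev s j

@[simp] lemma length_valuesRev (s : ℕ → ℕ) (j : ℕ) : (valuesRev s j).length = j := by
  induction j with
  | zero => rfl
  | succ j ih => simp [valuesRev, ih]

lemma valuesRev_mem_extend (C : List ℕ → Bool) (v : ℕ) (s : ℕ → ℕ) :
    ∀ n j : ℕ, (∀ i, j ≤ i → i < j + n → s i < v) →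
      (∀ i, j ≤ i → i < j + n → C (valuesRev s (i + 1)) = true) →
      valuesRev s (j + n) ∈ extend C v n (valuesRev s j) := by
  intro n
  induction n with
  | zero => intro j _ _; simp [extend]
  | succ n ih =>
    intro j hv hC
    rw [extend, List.mem_flatMap]
    refine ⟨s j, List.mem_range.2 (hv j le_rfl (by omega)), ?_⟩
    have := hC j le_rfl (by omega)
    rw [valuesRev] at this
    rw [this, cond_true]
    have h := ih (j + 1) (fun i h1 h2 => hv i (by omega) (by omega))
      (fun i h1 h2 => hC i (by omega) (by omega))
    rw [valuesRev] at h
    rwa [show j + (n + 1) = j + 1 + n by omega]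

lemma eq_of_valuesRev_eq {s t : ℕ → ℕ} : ∀ {n : ℕ}, valuesRev s n = valuesRev t n →
    ∀ i < n, s i = t i := by
  intro n
  induction n with
  | zero => intro _ i hi; omega
  | succ n ih =>
    intro h i hi
    rw [valuesRev, valuesRev, List.cons.injEq] at h
    rcases Nat.lt_succ_iff_lt_or_eq.1 hi with hi | rfl
    exacts [ih h.2 i hi, h.1]

/-- Whether all `k`-element sets of positions in the partial map `l` extend the mask `m₁` to a set
which lies in the family with bit map `bm` exactly if its image, extending `m₂`, does. -/
def subsetsMatch (bm : ℕ) : ℕ → List ℕ → ℕ → ℕ → Bool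
  | 0, _, m₁, m₂ => bm.testBit m₁ == bm.testBit m₂
  | _ + 1, [], _, _ => true
  | k + 1, y :: l, m₁, m₂ =>
    subsetsMatch bm k l (m₁ ||| 1 <<< l.length) (m₂ ||| 1 <<< y) && subsetsMatch bm (k + 1) l m₁ m₂

/-- The pruning condition of the search for permutations that preserve the family of `k`-sets with
bit map `bm`: it looks at those `k`-sets that contain the newest point. -/
def preservesNewest (bm k : ℕ) : List ℕ → Bool
  | [] => true
  | y :: l => !l.elem y && subsetsMatch bm (k - 1) l (1 <<< l.length) (1 <<< y)

lemma toMask_empty {n : ℕ} : toMask (∅ : Finset (Fin n)) = 0 := by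
  apply Nat.eq_of_testBit_eq
  intro i
  by_cases hi : i < n
  · simpa using testBit_toMask ∅ (⟨i, hi⟩ : Fin n)
  · rw [testBit_toMask_of_le _ (by omega), Nat.zero_testBit]

lemma toMask_insert {n : ℕ} (S : Finset (Fin n)) (p : Fin n) :
    toMask (insert p S) = toMask S ||| 1 <<< (p : ℕ) := by
  apply Nat.eq_of_testBit_eq
  intro i
  rw [Nat.testBit_or, testBit_one_shiftLeft]
  by_cases hi : i < n
  · have h1 := testBit_toMask (insert p S) ⟨i, hi⟩
    have h2 := testBit_toMask S ⟨i, hi⟩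
    simp only at h1 h2
    rw [h1, h2]
    simp only [Finset.mem_insert, Bool.decide_or, Bool.or_comm, Fin.ext_iff, eq_comm (a := i)]
  · rw [testBit_toMask_of_le _ (by omega), testBit_toMask_of_le _ (by omega)]
    have := p.2
    simp; omega

/-- The values of a permutation of `Fin n`, as a function on the natural numbers. -/
def permNat {n : ℕ} (τ : Equiv.Perm (Fin n)) (i : ℕ) : ℕ := if h : i < n then τ ⟨i, h⟩ else 0

lemma permNat_val {n : ℕ} (τ : Equiv.Perm (Fin n)) (p : Fin n) : permNat τ p = τ p := by
  simp [permNat]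

lemma subsetsMatch_of_preserves {n : ℕ} (τ : Equiv.Perm (Fin n)) (bm K : ℕ)
    (h : ∀ S : Finset (Fin n), S.card = K →
      bm.testBit (toMask S) = bm.testBit (toMask (τ • S))) :
    ∀ (j : ℕ), j ≤ n → ∀ (k : ℕ) (S : Finset (Fin n)), (∀ p ∈ S, j ≤ p.1) → S.card + k = K →
      subsetsMatch bm k (valuesRev (permNat τ) j) (toMask S) (toMask (τ • S)) = true := by
  intro j
  induction j with
  | zero =>
    intro _ k S _ hc
    cases k with
    | zero => simp [subsetsMatch, h S (by omega)]
    | succ k => simp [valuesRev, subsetsMatch]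
  | succ j ih =>
    intro hj k S hS hc
    cases k with
    | zero => simp [subsetsMatch, h S (by omega)]
    | succ k =>
      rw [valuesRev, subsetsMatch, Bool.and_eq_true]
      refine ⟨?_, ih (by omega) _ _ (fun p hp => (Nat.le_succ j).trans (hS p hp)) hc⟩
      have hp : (⟨j, hj⟩ : Fin n) ∉ S := fun hc => by have := hS _ hc; simp at this
      have := ih (by omega) k (insert ⟨j, hj⟩ S) (fun p hp => by
        rcases Finset.mem_insert.1 hp with rfl | hp
        exacts [le_rfl, (Nat.le_succ j).trans (hS p hp)])
        (by rw [Finset.card_insert_of_notMem hp]; omega)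
      rw [length_valuesRev]
      have e : τ • insert (⟨j, hj⟩ : Fin n) S = insert (τ ⟨j, hj⟩) (τ • S) := by
        simp [Finset.smul_finset_def, Finset.image_insert]
      rwa [e, toMask_insert, toMask_insert, ← permNat_val τ ⟨j, hj⟩] at this

lemma mem_valuesRev {s : ℕ → ℕ} {y j : ℕ} : y ∈ valuesRev s j ↔ ∃ i < j, s i = y := by
  induction j with
  | zero => simp [valuesRev]
  | succ j ih =>
    rw [valuesRev, List.mem_cons, ih]
    constructor
    · rintro (rfl | ⟨i, hi, rfl⟩)
      exacts [⟨j, by omega, rfl⟩, ⟨i, by omega, rfl⟩]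
    · rintro ⟨i, hi, rfl⟩
      rcases Nat.lt_succ_iff_lt_or_eq.1 hi with hi | rfl
      exacts [Or.inr ⟨i, hi, rfl⟩, Or.inl rfl]

/-- The search finds every permutation that preserves a family of `k`-sets. -/
lemma valuesRev_mem_extend_of_preserves {n : ℕ} (τ : Equiv.Perm (Fin n)) (bm k : ℕ) (hk : 0 < k)
    (h : ∀ S : Finset (Fin n), S.card = k →
      bm.testBit (toMask S) = bm.testBit (toMask (τ • S))) (j : ℕ) (hj : j ≤ n) :
    valuesRev (permNat τ) n ∈
      extend (preservesNewest bm k) n (n - j) (valuesRev (permNat τ) j) := by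
  have := valuesRev_mem_extend (preservesNewest bm k) n (permNat τ) (n - j) j ?_ ?_
  · rwa [show j + (n - j) = n by omega] at this
  · intro i _ hi
    have hi' : i < n := by omega
    simp [permNat, hi']
  · intro i _ hi
    have hi' : i < n := by omega
    rw [valuesRev, preservesNewest, Bool.and_eq_true]
    constructor
    · rw [Bool.not_eq_true', List.elem_eq_contains, List.contains_eq_mem, decide_eq_false_iff_not,
        mem_valuesRev]
      rintro ⟨l, hl, hc⟩
      have hl' : l < n := by omega
      have := τ.injective (Fin.ext ((permNat_val τ ⟨l, hl'⟩).symm.trans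
        (hc.trans (permNat_val τ ⟨i, hi'⟩))))
      simp at this; omega
    · have h1 := subsetsMatch_of_preserves τ bm k h i hi'.le (k - 1) {⟨i, hi'⟩} (by simp)
        (by simp; omega)
      have e : toMask ({⟨i, hi'⟩} : Finset (Fin n)) = 1 <<< i := by
        rw [← insert_empty_eq, toMask_insert]
        rw [toMask_empty, Nat.zero_or]
      have e2 : toMask (τ • ({⟨i, hi'⟩} : Finset (Fin n))) = 1 <<< permNat τ i := by
        rw [Finset.smul_finset_singleton, ← insert_empty_eq, toMask_insert]
        rw [toMask_empty, Nat.zero_or, Equiv.Perm.smul_def, ← permNat_val τ ⟨i, hi'⟩]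
      rw [length_valuesRev]
      rwa [e, e2] at h1

/-! ### Generators of the Mathieu group of degree 11 -/

/-- The generator `x ↦ x + 1` of order 11. -/
def gA : MathieuM11 :=
  ⟨c[0, 1, 2, 3, 4, 5, 6, 7, 8, 9, 10], Subgroup.subset_closure (by simp)⟩

/-- The second generator in the definition of the Mathieu group. -/
def gB : MathieuM11 :=
  ⟨c[2, 6, 10, 7] * c[3, 9, 4, 5], Subgroup.subset_closure (by simp)⟩

/-- An element of order 4 that normalizes the group of order 5 generated by `gC` and generates the
Mathieu group together with `gA`. -/
def gD : MathieuM11 := gB * gA * gB * gA * gB * gA ^ 3 * gB * gA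

/-- The multiplication `x ↦ 3 x`, of order 5, which normalizes the group generated by `gA`. -/
def gC : MathieuM11 := gB ^ 2 * gA * gB * gA * gB * gA ^ 3 * gB * gA

lemma gB_eq : gB = gD * gA ^ 2 * gD ^ 3 * gA * gD * gA * gD ^ 3 * gA ^ 2 := by decide +kernel

lemma gA_pow : gA ^ 11 = 1 := by decide +kernel
lemma gA_ne_one : gA ≠ 1 := by decide +kernel
lemma gC_pow : gC ^ 5 = 1 := by decide +kernel
lemma gD_pow : gD ^ 4 = 1 := by decide +kernel
lemma gA_mul_gD_pow : (gA * gD) ^ 3 = 1 := by decide +kernel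
lemma gD_mul_gC : gD * gC = gC ^ 3 * gD := by decide +kernel
lemma gC_mul_gA : gC * gA = gA ^ 3 * gC := by decide +kernel

/-- `gA` and `gD` generate the Mathieu group. -/
lemma eq_top_of_mem (K : Subgroup MathieuM11) (hA : gA ∈ K) (hD : gD ∈ K) : K = ⊤ := by
  have hB : gB ∈ K := by
    rw [gB_eq]
    exact K.mul_mem (K.mul_mem (K.mul_mem (K.mul_mem (K.mul_mem (K.mul_mem (K.mul_mem hD
      (K.pow_mem hA 2)) (K.pow_mem hD 3)) hA) hD) hA) (K.pow_mem hD 3)) (K.pow_mem hA 2)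
  have h : MathieuM11 ≤ K.map MathieuM11.subtype := by
    refine (Subgroup.closure_le _).2 ?_
    rintro x (rfl | rfl)
    · exact ⟨gA, hA, rfl⟩
    · exact ⟨gB, hB, rfl⟩
  rw [eq_top_iff]
  rintro ⟨x, hx⟩ -
  obtain ⟨y, hy, rfl⟩ := h hx
  exact hy

/-! ### Permutation representations given by tables -/

/-- The function on the natural numbers with the given list of values. -/
def tableFun (l : List ℕ) (p : ℕ) : ℕ := l.getD p 0

/-- A permutation representation of the Mathieu group on `Fin v` together with functions on the
natural numbers that compute the powers of `gA` and the element `gD`. -/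
structure Rep (v : ℕ) where
  ρ : MathieuM11 →* Equiv.Perm (Fin v)
  fA : ℕ → ℕ → ℕ
  fD : ℕ → ℕ
  ρ_gA : ∀ k p, (ρ (gA ^ k) p : ℕ) = fA k p
  ρ_gD : ∀ p, (ρ gD p : ℕ) = fD p

/-- The group element `gA ^ k₁ * gD * gA ^ k₂ * gD * ⋯` spelled by the word `[k₁, k₂, …]`. -/
def ev : List ℕ → MathieuM11
  | [] => 1
  | k :: w => gA ^ k * gD * ev w

namespace Rep

variable {v : ℕ} (R : Rep v)

/-- The action of the element spelled by a word on the numbers below `v`. -/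
def act : List ℕ → ℕ → ℕ
  | [], p => p
  | k :: w, p => R.fA k (R.fD (act w p))

lemma ρ_ev (w : List ℕ) (p : Fin v) : (R.ρ (ev w) p : ℕ) = R.act w p := by
  induction w with
  | nil => simp [ev, act]
  | cons k w ih =>
    rw [ev, act, map_mul, map_mul, Equiv.Perm.mul_apply, Equiv.Perm.mul_apply, R.ρ_gA, R.ρ_gD, ih]

lemma fA_one (p : Fin v) : (R.ρ gA p : ℕ) = R.fA 1 p := by rw [← R.ρ_gA, pow_one]

/-- Whether the element spelled by `w` maps the set with mask `m` onto the set with mask `m'`. -/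
def mapsMask (w : List ℕ) (m m' : ℕ) : Bool :=
  (List.range v).all fun p => m.testBit p == m'.testBit (R.act w p)

lemma smul_maskSet_of_mapsMask {w : List ℕ} {m m' : ℕ} (h : R.mapsMask w m m' = true) :
    R.ρ (ev w) • maskSet v m = maskSet v m' := by
  ext q
  rw [mem_maskSet, Finset.mem_smul_finset]
  rw [mapsMask, List.all_eq_true] at h
  have h' : ∀ p : Fin v, m.testBit p = m'.testBit (R.ρ (ev w) p) := fun p => by
    have := h p (List.mem_range.2 p.2)
    rw [beq_iff_eq, ← R.ρ_ev] at this
    exact this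
  constructor
  · rintro ⟨p, hp, rfl⟩
    rw [Equiv.Perm.smul_def, ← h']
    exact mem_maskSet.1 hp
  · intro hq
    refine ⟨(R.ρ (ev w))⁻¹ q, ?_, by simp⟩
    rw [mem_maskSet, h']
    simpa using hq

/-- The image of the representation, a group of permutations. -/
def range : Subgroup (Equiv.Perm (Fin v)) := R.ρ.range

lemma mem_range (g : MathieuM11) : R.ρ g ∈ R.range := ⟨g, rfl⟩

/-- A property of the generators `gA` and `gD` that defines a subgroup holds in the whole image. -/
lemma range_le (K : Subgroup (Equiv.Perm (Fin v))) (hA : R.ρ gA ∈ K) (hD : R.ρ gD ∈ K) :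
    R.range ≤ K := by
  have h := eq_top_of_mem (K.comap R.ρ) hA hD
  rintro _ ⟨g, rfl⟩
  exact (show g ∈ K.comap R.ρ from h ▸ Subgroup.mem_top g)

/-- The elements of the image that are spelled by words. -/
lemma exists_mem_range (w : List ℕ) : ∃ σ ∈ R.range, ∀ p, (σ p : ℕ) = R.act w p :=
  ⟨_, R.mem_range (ev w), R.ρ_ev w⟩

end Rep

/-! ### Multiple transitivity -/

/-- Whether the functions spelled by the words in the `i`-th of the given lists fix the first `i`
numbers and move every other number below `v` to `i`. -/
def isChain (v : ℕ) (act : List ℕ → ℕ → ℕ) : ℕ → List (List (List ℕ)) → Bool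
  | _, [] => true
  | i, ws :: l => ((List.range v).all fun y => decide (y < i) || ws.any fun w =>
      ((List.range i).all fun j => act w j == j) && act w y == i) && isChain v act (i + 1) l

lemma exists_map_of_isChain {v : ℕ} (K : Subgroup (Equiv.Perm (Fin v))) (act : List ℕ → ℕ → ℕ)
    (hact : ∀ w, ∃ σ ∈ K, ∀ p, (σ p : ℕ) = act w p) (n i : ℕ) (l : List (List (List ℕ)))
    (hl : l.length = n) (h : isChain v act i l = true) (t : ℕ → Fin v)
    (ht : ∀ a < i + n, ∀ b < i + n, t a = t b → a = b) (hi : ∀ j < i, (t j : ℕ) = j) :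
    ∃ g ∈ K, ∀ j < i + n, (g (t j) : ℕ) = j := by
  induction l generalizing i n t with
  | nil =>
    subst hl
    exact ⟨1, K.one_mem, fun j hj => by simpa using hi j (by simpa using hj)⟩
  | cons ws l ih =>
    rw [List.length_cons] at hl
    rw [isChain, Bool.and_eq_true, List.all_eq_true] at h
    obtain ⟨h1, h2⟩ := h
    have hti : ¬ (t i : ℕ) < i := fun hlt => by
      have := ht _ (by omega) i (by omega) (Fin.ext (hi _ hlt))
      omega
    have h3 := h1 (t i) (List.mem_range.2 (t i).2)
    rw [Bool.or_eq_true, decide_eq_true_eq, List.any_eq_true] at h3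
    obtain ⟨w, -, hw⟩ := h3.resolve_left hti
    rw [Bool.and_eq_true, List.all_eq_true, beq_iff_eq] at hw
    obtain ⟨hw1, hw2⟩ := hw
    obtain ⟨σ, hσK, hσ⟩ := hact w
    obtain ⟨g, hgK, hg⟩ := ih l.length (i + 1) rfl h2 (fun j => σ (t j))
      (fun a ha b hb hab => ht a (by omega) b (by omega) (σ.injective hab))
      (fun j hj => by
        rw [hσ]
        rcases Nat.lt_succ_iff_lt_or_eq.1 hj with hj | rfl
        · rw [hi j hj]
          simpa using hw1 j (List.mem_range.2 hj)
        · exact hw2)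
    refine ⟨g * σ, K.mul_mem hgK hσK, fun j hj => ?_⟩
    rw [Equiv.Perm.mul_apply]
    exact hg j (by omega)

/-- Any two lists of `n` distinct points are equivalent if there is a chain of length `n`. -/
lemma exists_map_eq_of_isChain {v : ℕ} (K : Subgroup (Equiv.Perm (Fin v))) (act : List ℕ → ℕ → ℕ)
    (hact : ∀ w, ∃ σ ∈ K, ∀ p, (σ p : ℕ) = act w p) {n : ℕ} (l : List (List (List ℕ)))
    (hl : l.length = n) (h : isChain v act 0 l = true) (t : Fin n → Fin v)
    (ht : Function.Injective t) : ∃ g ∈ K, ∀ j, (g (t j) : ℕ) = j := by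
  by_cases hn : n = 0
  · subst hn; exact ⟨1, K.one_mem, fun j => j.elim0⟩
  obtain ⟨g, hgK, hg⟩ := exists_map_of_isChain K act hact n 0 l hl h
    (fun j => if hj : j < n then t ⟨j, hj⟩ else t ⟨0, by omega⟩)
    (fun a ha b hb hab => by
      rw [Nat.zero_add] at ha hb
      simp only [ha, hb, dif_pos] at hab
      simpa using ht hab) (by simp)
  refine ⟨g, hgK, fun j => ?_⟩
  have := hg j (by omega)
  simpa using this

/-! ### The representations of degree 11, 12 and 22 -/

/-- The permutation of `Fin n` with values `f` and inverse values `g`. -/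
def mkPerm (n : ℕ) (f g : ℕ → ℕ) (h : ∀ p < n, f p < n ∧ g p < n ∧ g (f p) = p ∧ f (g p) = p) :
    Equiv.Perm (Fin n) where
  toFun p := ⟨f p, (h p p.2).1⟩
  invFun p := ⟨g p, (h p p.2).2.1⟩
  left_inv p := Fin.ext (h p p.2).2.2.1
  right_inv p := Fin.ext (h p p.2).2.2.2

/-- The values of `gD` on the 11 points. -/
def fD11 : ℕ → ℕ := tableFun [0, 5, 2, 3, 1, 9, 10, 6, 7, 4, 8]

/-- The action of `gA ^ k` on the 11 points. -/
def fA11 (k p : ℕ) : ℕ := (p + k) % 11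

/-- The action of `gA ^ k` on 12 points: a shift by `-k` that fixes the last point. -/
def fA12 (k p : ℕ) : ℕ := bif p == 11 then 11 else (p + 10 * k) % 11

/-- The values of `gD` on the 12 points. -/
def fD12 : ℕ → ℕ := tableFun [11, 7, 3, 2, 8, 6, 4, 9, 5, 10, 1, 0]

/-- The action of `gA ^ k` on 22 points: a shift by `k` on each of two copies of the 11 points. -/
def fA22 (k p : ℕ) : ℕ := bif Nat.blt p 11 then (p + k) % 11 else 11 + (p + k) % 11

/-- The values of `gD` on the 22 points. -/
def fD22 : ℕ → ℕ :=
  tableFun [11, 16, 2, 14, 12, 20, 10, 6, 7, 15, 8, 0, 5, 13, 3, 1, 9, 21, 17, 18, 4, 19]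

/-- The 66 blocks of the Steiner system `S(4, 5, 11)`, each paired with a pair of points among 12:
under the Mathieu group the 66 blocks correspond to the pairs of points of its action of degree 12.
All sets are given by masks. -/
def pairs12 : List (ℕ × ℕ) :=
  [(514, 527), (2112, 151), (17, 103), (1028, 1287), (24, 283), (260, 171), (2176, 1099), (34,
   1075), (1280, 595), (192, 803), (544, 451), (9, 1667), (1152, 61), (320, 333), (48, 1165),
   (520, 1109), (33, 789), (10, 421), (2304, 1573), (132, 709), (3, 217), (68, 1561), (40, 617),
   (513, 1321), (3072, 905), (2052, 369), (528, 689), (384, 1425), (1088, 1249), (18, 1857),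
   (257, 1054), (2080, 302), (1032, 206), (12, 566), (130, 342), (640, 1190), (96, 1606), (272,
   902), (576, 122), (160, 666), (1040, 1578), (5, 842), (66, 1418), (1025, 434), (20, 1234),
   (2560, 1810), (2050, 738), (264, 1378), (2064, 604), (516, 412), (6, 1132), (65, 684), (136,
   1804), (288, 244), (80, 1332), (1026, 1684), (1536, 868), (2049, 1476), (2056, 1208), (258,
   824), (1056, 1368), (144, 488), (768, 1736), (129, 1648), (72, 976), (36, 1952)]

/-- The 66 blocks of the Steiner system `S(4, 5, 11)`, each paired with a lift to the 22 points,
which lie over the 11 points by reduction modulo 11. The stabilizer of a point has a subgroup of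
index 2, with two orbits on the blocks through that point, and the lift of a block records for each
of its points in which of the two orbits the block lies. -/
def pairs22 : List (ℕ × ℕ) :=
  [(1052685, 527), (309248, 151), (139299, 103), (527366, 1287), (49411, 283), (67722, 171),
   (2250752, 1099), (70673, 1075), (1050706, 595), (6944, 803), (528577, 451), (2359811, 1667),
   (18484, 61), (10568, 333), (25729, 1165), (2129989, 1109), (533009, 789), (327941, 421),
   (3221504, 1573), (133764, 709), (393241, 217), (36360, 1561), (82497, 617), (2621481, 1321),
   (1853440, 905), (755712, 369), (1081505, 689), (2099600, 1425), (265312, 1249), (1180929,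
   1857), (2105370, 1054), (618496, 302), (278598, 206), (98822, 566), (135444, 342), (2101412,
   1190), (13888, 1606), (1057154, 902), (36968, 122), (21136, 666), (1066018, 1578), (655882,
   842), (267528, 1418), (786482, 434), (164994, 1234), (3706880, 1810), (1511424, 738),
   (2163010, 1378), (1236992, 604), (557196, 412), (197644, 1132), (270888, 684), (2114308,
   1804), (73936, 244), (42272, 1332), (1311764, 1684), (1572964, 868), (3022848, 1476),
   (2473984, 1208), (1114392, 824), (541776, 1368), (147872, 488), (3145928, 1736), (2228784,
   1648), (295744, 976), (591488, 1952)]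

/-- `σ` and `g` together preserve the family `𝓡` of pairs of sets. -/
def PreservesPairs {n : ℕ} (𝓡 : Finset (Finset (Fin n) × Finset (Fin 11)))
    (σ : Equiv.Perm (Fin n)) (g : MathieuM11) : Prop :=
  ∀ L Q, (σ • L, g • Q) ∈ 𝓡 ↔ (L, Q) ∈ 𝓡

/-- The family of pairs of sets with the given masks. -/
def pairFamily (n : ℕ) (l : List (ℕ × ℕ)) : Finset (Finset (Fin n) × Finset (Fin 11)) :=
  (l.map fun e => (maskSet n e.1, maskSet 11 e.2)).toFinset

lemma mem_pairFamily {n : ℕ} {l : List (ℕ × ℕ)} {x : Finset (Fin n) × Finset (Fin 11)} :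
    x ∈ pairFamily n l ↔ ∃ e ∈ l, (maskSet n e.1, maskSet 11 e.2) = x := by
  simp [pairFamily]

lemma preservesPairs_of_closed {n : ℕ} (l : List (ℕ × ℕ)) (σ : Equiv.Perm (Fin n)) (g : MathieuM11)
    (f' f : ℕ → ℕ) (hf' : ∀ p, (σ p : ℕ) = f' p)
    (hf : ∀ p : Fin 11, ((g : Equiv.Perm (Fin 11)) p : ℕ) = f p)
    (h : (l.all fun e => l.elem (imgMask f' e.1 n, imgMask f e.2 11)) = true) :
    PreservesPairs (pairFamily n l) σ g := by
  let φ : Finset (Fin n) × Finset (Fin 11) ↪ Finset (Fin n) × Finset (Fin 11) :=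
    ⟨fun x => (σ • x.1, g • x.2), fun x y hxy => by
      rw [Prod.mk.injEq] at hxy
      exact Prod.ext (smul_left_cancel σ hxy.1) (smul_left_cancel g hxy.2)⟩
  have hsub : (pairFamily n l).map φ ⊆ pairFamily n l := by
    intro x hx
    obtain ⟨y, hy, rfl⟩ := Finset.mem_map.1 hx
    obtain ⟨e, he, rfl⟩ := mem_pairFamily.1 hy
    rw [List.all_eq_true] at h
    have := h e he
    rw [List.elem_eq_contains, List.contains_iff_mem] at this
    refine mem_pairFamily.2 ⟨_, this, ?_⟩
    rw [maskSet_imgMask f' σ hf', maskSet_imgMask f (g : Equiv.Perm (Fin 11)) hf]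
    rfl
  have heq := Finset.eq_of_subset_of_card_le hsub (by rw [Finset.card_map])
  intro L Q
  have h1 := Finset.mem_map' φ (a := (L, Q)) (s := pairFamily n l)
  rw [heq] at h1
  exact h1

/-- Whether every two distinct numbers below `n` are separated by one of the sets in the list. -/
def separates (n : ℕ) (l : List ℕ) : Bool :=
  (List.range n).all fun p => (List.range n).all fun q => p == q || l.any fun m =>
    m.testBit p && !m.testBit q

/-- A permutation fixing every member of a family of sets that separates the points is trivial. -/
lemma eq_one_of_separates {n : ℕ} {l : List ℕ} (h : separates n l = true)
    (σ : Equiv.Perm (Fin n)) (hσ : ∀ m ∈ l, σ • maskSet n m = maskSet n m) : σ = 1 := by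
  ext p
  by_contra hne
  rw [separates, List.all_eq_true] at h
  have h1 := h p (List.mem_range.2 p.2)
  rw [List.all_eq_true] at h1
  have h2 := h1 (σ p) (List.mem_range.2 (σ p).2)
  rw [Bool.or_eq_true, beq_iff_eq, List.any_eq_true] at h2
  obtain ⟨m, hm, hb⟩ := h2.resolve_left (fun h => hne (by simpa using h.symm))
  rw [Bool.and_eq_true, Bool.not_eq_true'] at hb
  have h3 : σ p ∈ σ • maskSet n m := Finset.smul_mem_smul_finset (a := σ) (mem_maskSet.2 hb.1)
  rw [hσ m hm, mem_maskSet, hb.2] at h3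
  exact absurd h3 (by simp)

/-- Whether the second entries of the list determine the first ones and vice versa. -/
def isMatching (l : List (ℕ × ℕ)) : Bool :=
  l.all fun e => l.all fun e' => (e.1 == e'.1) == (e.2 == e'.2)

/-- If a family of pairs `(L, Q)` is preserved by `gA` and `gD` with suitable permutations of the
first components, then it defines a faithful representation: `L` and `Q` determine each other, and
both the first and the second components separate points. -/
lemma exists_rep {n : ℕ} (l : List (ℕ × ℕ)) (σA σD : Equiv.Perm (Fin n))
    (hA : PreservesPairs (pairFamily n l) σA gA) (hD : PreservesPairs (pairFamily n l) σD gD)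
    (hlt : (l.all fun e => decide (e.1 < 2 ^ n) && decide (e.2 < 2 ^ 11)) = true)
    (hm : isMatching l = true)
    (h1 : separates n (l.map Prod.fst) = true) (h2 : separates 11 (l.map Prod.snd) = true) :
    ∃ ρ : MathieuM11 →* Equiv.Perm (Fin n), Function.Injective ρ ∧ ρ gA = σA ∧ ρ gD = σD ∧
      ∀ g, PreservesPairs (pairFamily n l) (ρ g) g := by
  set 𝓡 := pairFamily n l with h𝓡
  have hlt' : ∀ e ∈ l, e.1 < 2 ^ n ∧ e.2 < 2 ^ 11 := fun e he => by
    simpa using List.all_eq_true.1 hlt e he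
  have hmatch : ∀ e ∈ l, ∀ e' ∈ l, e.1 = e'.1 ↔ e.2 = e'.2 := fun e he e' he' => by
    have := List.all_eq_true.1 (List.all_eq_true.1 hm e he) e' he'
    rw [beq_iff_eq, Bool.eq_iff_iff, beq_iff_eq, beq_iff_eq] at this
    exact this
  have hfst : ∀ L L' Q, (L, Q) ∈ 𝓡 → (L', Q) ∈ 𝓡 → L = L' := by
    intro L L' Q hL hL'
    obtain ⟨e, he, hee⟩ := mem_pairFamily.1 hL
    obtain ⟨e', he', hee'⟩ := mem_pairFamily.1 hL'
    rw [Prod.mk.injEq] at hee hee'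
    rw [← hee.1, ← hee'.1]
    congr 1
    rw [hmatch e he e' he', ← toMask_maskSet (hlt' e he).2, ← toMask_maskSet (hlt' e' he').2,
      hee.2, hee'.2]
  have hsnd : ∀ L Q Q', (L, Q) ∈ 𝓡 → (L, Q') ∈ 𝓡 → Q = Q' := by
    intro L Q Q' hL hL'
    obtain ⟨e, he, hee⟩ := mem_pairFamily.1 hL
    obtain ⟨e', he', hee'⟩ := mem_pairFamily.1 hL'
    rw [Prod.mk.injEq] at hee hee'
    rw [← hee.2, ← hee'.2]
    congr 1
    rw [← hmatch e he e' he', ← toMask_maskSet (hlt' e he).1, ← toMask_maskSet (hlt' e' he').1,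
      hee.1, hee'.1]
  have hone : ∀ σ, PreservesPairs 𝓡 σ 1 → σ = 1 := by
    intro σ hσ
    refine eq_one_of_separates h1 σ fun m hmem => ?_
    obtain ⟨e, he, rfl⟩ := List.mem_map.1 hmem
    have he' : (maskSet n e.1, maskSet 11 e.2) ∈ 𝓡 := mem_pairFamily.2 ⟨e, he, rfl⟩
    have := (hσ _ _).2 he'
    rw [one_smul] at this
    exact hfst _ _ _ this he'
  have hmul : ∀ σ τ g h, PreservesPairs 𝓡 σ g → PreservesPairs 𝓡 τ h →
      PreservesPairs 𝓡 (σ * τ) (g * h) := fun σ τ g h hσ hτ L Q => by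
    rw [mul_smul, mul_smul, hσ, hτ]
  have hinv : ∀ σ g, PreservesPairs 𝓡 σ g → PreservesPairs 𝓡 σ⁻¹ g⁻¹ := fun σ g hσ L Q => by
    rw [← hσ, smul_inv_smul, smul_inv_smul]
  have huniq : ∀ σ τ g, PreservesPairs 𝓡 σ g → PreservesPairs 𝓡 τ g → σ = τ := by
    intro σ τ g hσ hτ
    have := hone _ (by simpa using hmul _ _ _ _ hσ (hinv _ _ hτ))
    exact mul_inv_eq_one.1 this
  let K : Subgroup MathieuM11 :=
    { carrier := {g | ∃ σ, PreservesPairs 𝓡 σ g}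
      one_mem' := ⟨1, fun L Q => by rw [one_smul, one_smul]⟩
      mul_mem' := fun ⟨σ, hσ⟩ ⟨τ, hτ⟩ => ⟨σ * τ, hmul _ _ _ _ hσ hτ⟩
      inv_mem' := fun ⟨σ, hσ⟩ => ⟨σ⁻¹, hinv _ _ hσ⟩ }
  have hK : K = ⊤ := eq_top_of_mem K ⟨σA, hA⟩ ⟨σD, hD⟩
  have hex : ∀ g, ∃ σ, PreservesPairs 𝓡 σ g := fun g => by
    have : g ∈ K := hK ▸ Subgroup.mem_top g
    exact this
  choose ρ hρ using hex
  refine ⟨MonoidHom.mk' ρ fun g h => huniq _ _ _ (hρ _) (hmul _ _ _ _ (hρ g) (hρ h)), ?_,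
    huniq _ _ _ (hρ _) hA, huniq _ _ _ (hρ _) hD, hρ⟩
  rw [injective_iff_map_eq_one]
  intro g hg
  have hpg : PreservesPairs 𝓡 1 g := by
    have := hρ g
    rwa [show ρ g = 1 from hg] at this
  refine Subtype.ext (eq_one_of_separates h2 _ fun m hmem => ?_)
  obtain ⟨e, he, rfl⟩ := List.mem_map.1 hmem
  have he' : (maskSet n e.1, maskSet 11 e.2) ∈ 𝓡 := mem_pairFamily.2 ⟨e, he, rfl⟩
  have := (hpg _ _).2 he'
  rw [one_smul] at this
  exact hsnd _ _ _ this he'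

lemma gA_apply : ∀ p : Fin 11, ((gA : Equiv.Perm (Fin 11)) p : ℕ) = fA11 1 p := by
  decide +kernel

lemma gD_apply : ∀ p : Fin 11, ((gD : Equiv.Perm (Fin 11)) p : ℕ) = fD11 p := by
  decide +kernel

/-- The action of `gA` on 12 points. -/
def permA12 : Equiv.Perm (Fin 12) := mkPerm 12 (fA12 1) (fA12 10) (by decide +kernel)

/-- The action of `gD` on 12 points. -/
def permD12 : Equiv.Perm (Fin 12) :=
  mkPerm 12 fD12 (fun p => fD12 (fD12 (fD12 p))) (by decide +kernel)

/-- The action of `gA` on 22 points. -/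
def permA22 : Equiv.Perm (Fin 22) := mkPerm 22 (fA22 1) (fA22 10) (by decide +kernel)

/-- The action of `gD` on 22 points. -/
def permD22 : Equiv.Perm (Fin 22) :=
  mkPerm 22 fD22 (fun p => fD22 (fD22 (fD22 p))) (by decide +kernel)

lemma exists_rep12 : ∃ ρ : MathieuM11 →* Equiv.Perm (Fin 12), Function.Injective ρ ∧
    ρ gA = permA12 ∧ ρ gD = permD12 ∧ ∀ g, PreservesPairs (pairFamily 12 pairs12) (ρ g) g :=
  exists_rep pairs12 permA12 permD12
    (preservesPairs_of_closed _ _ _ (fA12 1) (fA11 1) (fun _ => rfl) gA_apply (by decide +kernel))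
    (preservesPairs_of_closed _ _ _ fD12 fD11 (fun _ => rfl) gD_apply (by decide +kernel))
    (by decide +kernel) (by decide +kernel) (by decide +kernel) (by decide +kernel)

lemma exists_rep22 : ∃ ρ : MathieuM11 →* Equiv.Perm (Fin 22), Function.Injective ρ ∧
    ρ gA = permA22 ∧ ρ gD = permD22 ∧ ∀ g, PreservesPairs (pairFamily 22 pairs22) (ρ g) g :=
  exists_rep pairs22 permA22 permD22
    (preservesPairs_of_closed _ _ _ (fA22 1) (fA11 1) (fun _ => rfl) gA_apply (by decide +kernel))
    (preservesPairs_of_closed _ _ _ fD22 fD11 (fun _ => rfl) gD_apply (by decide +kernel))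
    (by decide +kernel) (by decide +kernel) (by decide +kernel) (by decide +kernel)

lemma val_pow_apply {v : ℕ} (ρ : MathieuM11 →* Equiv.Perm (Fin v)) (f : ℕ → ℕ → ℕ)
    (h1 : ∀ p, (ρ gA p : ℕ) = f 1 p) (h0 : ∀ p < v, f 0 p = p)
    (hs : ∀ k, ∀ p < v, f (k + 1) p = f 1 (f k p)) (k : ℕ) (p : Fin v) :
    (ρ (gA ^ k) p : ℕ) = f k p := by
  induction k with
  | zero => simp [h0]
  | succ k ih => rw [pow_succ', map_mul, Equiv.Perm.mul_apply, h1, ih, hs k p p.2]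

/-- The natural representation on 11 points. -/
def R11 : Rep 11 where
  ρ := MathieuM11.subtype
  fA := fA11
  fD := fD11
  ρ_gA := val_pow_apply _ _ gA_apply (by decide) (fun k p _ => by simp only [fA11]; omega)
  ρ_gD := gD_apply

/-- The transitive representation on 12 points. -/
noncomputable def R12 : Rep 12 where
  ρ := exists_rep12.choose
  fA := fA12
  fD := fD12
  ρ_gA := val_pow_apply _ _ (fun p => by rw [exists_rep12.choose_spec.2.1]; rfl) (by decide)
    (fun k p _ => by
      by_cases hp : p = 11
      · simp [fA12, hp]
      · have : (p + 10 * k) % 11 ≠ 11 := by omega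
        simp only [fA12, beq_eq_false_iff_ne.2 hp, beq_eq_false_iff_ne.2 this, cond_false]
        omega)
  ρ_gD := fun p => by rw [exists_rep12.choose_spec.2.2.1]; rfl

/-- The transitive representation on 22 points. -/
noncomputable def R22 : Rep 22 where
  ρ := exists_rep22.choose
  fA := fA22
  fD := fD22
  ρ_gA := val_pow_apply _ _ (fun p => by rw [exists_rep22.choose_spec.2.1]; rfl) (by decide)
    (fun k p _ => by
      by_cases hp : p < 11
      · have h1 : Nat.blt p 11 = true := by simpa using hp
        have h2 : Nat.blt ((p + k) % 11) 11 = true := by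
          rw [Nat.blt_eq]; exact Nat.mod_lt _ (by norm_num)
        simp only [fA22, h1, h2, cond_true]
        omega
      · have h1 : Nat.blt p 11 = false := by
          rw [← Bool.not_eq_true, Nat.blt_eq]; exact hp
        have h2 : Nat.blt (11 + (p + k) % 11) 11 = false := by
          rw [← Bool.not_eq_true, Nat.blt_eq]; omega
        simp only [fA22, h1, h2, cond_false]
        omega)
  ρ_gD := fun p => by rw [exists_rep22.choose_spec.2.2.1]; rfl

lemma R11_injective : Function.Injective R11.ρ := Subtype.val_injective
lemma R12_injective : Function.Injective R12.ρ := exists_rep12.choose_spec.1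
lemma R22_injective : Function.Injective R22.ρ := exists_rep22.choose_spec.1

lemma R22_preservesPairs (g : MathieuM11) :
    PreservesPairs (pairFamily 22 pairs22) (R22.ρ g) g := exists_rep22.choose_spec.2.2.2 g

/-- Words for the 4-fold transitivity of the Mathieu group on 11 points. -/
def chain11 : List (List (List ℕ)) :=
  [[[], [1], [2], [3], [4], [5], [6], [7], [8], [9], [10]], [[], [0], [0, 0], [3, 10], [4, 8],
   [7, 9], [10, 4], [0, 1, 6], [0, 5, 7], [1, 2, 9]], [[], [1, 6], [0, 3, 10], [2, 6, 6], [8, 7,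
   8], [9, 3, 6], [0, 3, 5, 1], [2, 2, 7, 8], [2, 6, 1, 1]], [[], [7, 8, 4], [0, 8, 9, 1], [3,
   2, 8, 2], [4, 9, 6, 0], [7, 3, 7, 0], [7, 4, 1, 0], [8, 2, 4, 0, 0]]]

/-- Words for the 3-fold transitivity of the Mathieu group on 12 points. -/
def chain12 : List (List (List ℕ)) :=
  [[[], [0], [1], [2], [3], [4], [5], [6], [7], [8], [9], [10]], [[], [0, 0], [0, 1], [0, 2],
   [0, 3], [0, 4], [0, 5], [0, 6], [0, 7], [0, 9], [0, 10]], [[], [0, 8], [3, 9, 1], [4, 5, 4],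
   [5, 3, 3], [6, 6, 6], [7, 10, 5], [1, 2, 1, 0], [1, 5, 5, 0], [2, 7, 2, 0]]]

/-- The Mathieu group of degree 11 is 4-transitive. -/
lemma exists_map_eq11 (t : Fin 4 → Fin 11) (ht : Function.Injective t) :
    ∃ g, ∀ j, (R11.ρ g (t j) : ℕ) = j := by
  obtain ⟨_, ⟨g, rfl⟩, hg⟩ := exists_map_eq_of_isChain R11.range R11.act R11.exists_mem_range
    chain11 rfl (by decide +kernel) t ht
  exact ⟨g, hg⟩

/-- The action of degree 12 is 3-transitive. -/
lemma exists_map_eq12 (t : Fin 3 → Fin 12) (ht : Function.Injective t) :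
    ∃ g, ∀ j, (R12.ρ g (t j) : ℕ) = j := by
  obtain ⟨_, ⟨g, rfl⟩, hg⟩ := exists_map_eq_of_isChain R12.range R12.act R12.exists_mem_range
    chain12 rfl (by decide +kernel) t ht
  exact ⟨g, hg⟩

open IncidenceStructure

/-! ### Designs given by families of sets -/

section Family

variable {v : ℕ} {P B : Type*}

/-- The incidence structure whose points correspond to the elements of `Fin v` and whose blocks
correspond to the members of the family `𝓑`. -/
def ofFamily [Nonempty P] [Nonempty B] (𝓑 : Set (Finset (Fin v))) (e : P ≃ Fin v) (f : B ≃ 𝓑) :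
    IncidenceStructure P B where
  Inc p b := e p ∈ (f b : Finset (Fin v))
  nonempty_points := ‹_›
  nonempty_blocks := ‹_›

/-- The number of members of `𝓑` that contain `T`. -/
noncomputable def blockCount (𝓑 : Set (Finset (Fin v))) (T : Finset (Fin v)) : ℕ :=
  {S | S ∈ 𝓑 ∧ T ⊆ S}.ncard

variable [Nonempty P] [Nonempty B] {𝓑 : Set (Finset (Fin v))} (e : P ≃ Fin v) (f : B ≃ 𝓑)

lemma isSimple_ofFamily : (ofFamily 𝓑 e f).IsSimple := by
  intro b c h
  apply f.injective
  apply Subtype.ext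
  ext x
  have := Set.ext_iff.1 h (e.symm x)
  simpa [pointsOf, ofFamily] using this

lemma pointsOf_ofFamily_ncard (b : B) :
    ((ofFamily 𝓑 e f).pointsOf b).ncard = (f b : Finset (Fin v)).card := by
  have : (ofFamily 𝓑 e f).pointsOf b = e ⁻¹' ((f b : Finset (Fin v)) : Set (Fin v)) := rfl
  rw [this, ← Set.ncard_coe_finset, Set.ncard_preimage_of_injective_subset_range e.injective]
  simp

lemma card_blocks_ofFamily (T : Finset P) :
    Nat.card {b : B // ∀ p ∈ T, (ofFamily 𝓑 e f).Inc p b} =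
      blockCount 𝓑 (T.map e.toEmbedding) := by
  rw [blockCount, ← Nat.card_coe_set_eq]
  refine Nat.card_congr ⟨fun b => ⟨f b.1, (f b.1).2, ?_⟩, fun S => ⟨f.symm ⟨S.1, S.2.1⟩, ?_⟩, ?_,
    ?_⟩
  · intro x hx
    obtain ⟨p, hp, rfl⟩ := Finset.mem_map.1 hx
    exact b.2 p hp
  · intro p hp
    have := S.2.2 (Finset.mem_map_of_mem e.toEmbedding hp)
    simpa [ofFamily] using this
  · intro b; simp
  · intro S; simp

lemma isDesign_ofFamily {t k lam : ℕ} (htk : t ≤ k)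
    (hk : ∀ S ∈ 𝓑, S.card = k) (h : ∀ T : Finset (Fin v), T.card = t → blockCount 𝓑 T = lam) :
    (ofFamily 𝓑 e f).IsDesign t v k lam where
  finite_points := Finite.of_equiv _ e.symm
  finite_blocks := Finite.of_equiv _ f.symm
  le_block_size := htk
  card_points := by rw [Nat.card_congr e]; simp
  card_block b := by rw [pointsOf_ofFamily_ncard, hk _ (f b).2]
  balanced T hT := by rw [card_blocks_ofFamily, h _ (by simpa using hT)]

lemma blockCount_of_isDesign {t k lam : ℕ} (h : (ofFamily 𝓑 e f).IsDesign t v k lam)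
    (T : Finset (Fin v)) (hT : T.card = t) : blockCount 𝓑 T = lam := by
  have := h.balanced (T.map e.symm.toEmbedding) (by simpa using hT)
  rw [card_blocks_ofFamily] at this
  rw [← this]
  congr 1
  ext x; simp

/-- The automorphisms of the design of a family of sets are the permutations of the points that
preserve the family. -/
noncomputable def autOfFamily :
    (ofFamily 𝓑 e f).aut ≃* MulAction.stabilizer (Equiv.Perm (Fin v)) 𝓑 := by
  have key : ∀ x : (ofFamily 𝓑 e f).aut, ∀ b : B, (f (x.1.2 b) : Finset (Fin v)) =
      (e.permCongr x.1.1) • (f b : Finset (Fin v)) := by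
    intro x b
    ext y
    rw [← Finset.inv_smul_mem_iff]
    obtain ⟨p, rfl⟩ : ∃ p, y = e p := ⟨e.symm y, by simp⟩
    have := x.2 (x.1.1⁻¹ p) b
    simp only [ofFamily, Equiv.Perm.coe_inv, Equiv.apply_symm_apply] at this
    have e1 : (e.permCongr x.1.1)⁻¹ • e p = e (x.1.1.symm p) := by
      rw [inv_smul_eq_iff, Equiv.Perm.smul_def]
      simp
    rw [this, e1]
  refine MulEquiv.ofBijective
    ({ toFun := fun x => ⟨e.permCongr x.1.1, ?_⟩
       map_one' := ?_
       map_mul' := ?_ } :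
      (ofFamily 𝓑 e f).aut →* MulAction.stabilizer (Equiv.Perm (Fin v)) 𝓑) ⟨?_, ?_⟩
  · rw [MulAction.mem_stabilizer_set]
    intro S
    constructor
    · intro hS
      have h2 := key x (x.1.2⁻¹ (f.symm ⟨_, hS⟩))
      simp only [Equiv.Perm.coe_inv, Equiv.apply_symm_apply] at h2
      rw [smul_left_cancel _ h2]
      exact (f _).2
    · intro hS
      have h2 := key x (f.symm ⟨S, hS⟩)
      simp only [Equiv.apply_symm_apply] at h2
      rw [← h2]
      exact (f _).2
  · ext; simp
  · intro x y
    ext; simp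
  · intro x y hxy
    have h1 : e.permCongr x.1.1 = e.permCongr y.1.1 := congrArg Subtype.val hxy
    refine Subtype.ext (Prod.ext (e.permCongr.injective h1) (Equiv.ext fun b => ?_))
    apply f.injective
    apply Subtype.ext
    rw [key x b, key y b, h1]
  · rintro ⟨σ, hσ⟩
    rw [MulAction.mem_stabilizer_set] at hσ
    let τ : Equiv.Perm 𝓑 := (MulAction.toPerm σ : Equiv.Perm (Finset (Fin v))).subtypeEquiv
      fun S => (hσ S).symm
    refine ⟨⟨(e.symm.permCongr σ, f.symm.permCongr τ), ?_⟩, ?_⟩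
    · intro p b
      change e (e.symm (σ (e p))) ∈ (f (f.symm (τ (f b))) : Finset (Fin v)) ↔ _
      rw [Equiv.apply_symm_apply, Equiv.apply_symm_apply]
      change σ • e p ∈ σ • (f b : Finset (Fin v)) ↔ _
      rw [Finset.smul_mem_smul_finset_iff]
      rfl
    · apply Subtype.ext
      ext x
      simp

lemma exists_perm_of_isIsomorphic {P' B' : Type*} [Nonempty P'] [Nonempty B']
    {𝓑' : Set (Finset (Fin v))} (e' : P' ≃ Fin v) (f' : B' ≃ 𝓑')
    (h : (ofFamily 𝓑 e f).IsIsomorphic (ofFamily 𝓑' e' f')) :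
    ∃ σ : Equiv.Perm (Fin v), ∀ S, σ • S ∈ 𝓑' ↔ S ∈ 𝓑 := by
  obtain ⟨φ, g, h⟩ := h
  have key : ∀ b : B, (f' (g b) : Finset (Fin v)) =
      ((e.symm.trans φ).trans e' : Equiv.Perm (Fin v)) • (f b : Finset (Fin v)) := by
    intro b
    ext y
    rw [← Finset.inv_smul_mem_iff]
    have := h (φ.symm (e'.symm y)) b
    simp only [ofFamily, Equiv.apply_symm_apply] at this
    rw [this]
    rfl
  refine ⟨(e.symm.trans φ).trans e', fun S => ⟨fun hS => ?_, fun hS => ?_⟩⟩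
  · have h2 := key (g.symm (f'.symm ⟨_, hS⟩))
    simp only [Equiv.apply_symm_apply] at h2
    rw [smul_left_cancel _ h2]
    exact (f _).2
  · have h2 := key (f.symm ⟨S, hS⟩)
    simp only [Equiv.apply_symm_apply] at h2
    rw [← h2]
    exact (f' _).2

/-- A simple incidence structure is the design of the family of its blocks. -/
lemma exists_eq_ofFamily (D : IncidenceStructure P B) (hD : D.IsSimple)
    (h : ∀ S, S ∈ 𝓑 ↔ ∃ b, ∀ p, e p ∈ S ↔ D.Inc p b) : ∃ f : B ≃ 𝓑, ofFamily 𝓑 e f = D := by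
  classical
  have hS : ∀ b, ∃ S ∈ 𝓑, ∀ p, e p ∈ S ↔ D.Inc p b := by
    intro b
    have : ∀ p, e p ∈ (Finset.univ.filter fun x => D.Inc (e.symm x) b) ↔ D.Inc p b := by simp
    exact ⟨_, (h _).2 ⟨b, this⟩, this⟩
  choose S hS1 hS2 using hS
  let g : B → 𝓑 := fun b => ⟨S b, hS1 b⟩
  have hg : Function.Bijective g := by
    constructor
    · intro b c hbc
      apply hD
      ext p
      have : S b = S c := congrArg Subtype.val hbc
      change D.Inc p b ↔ D.Inc p c
      rw [← hS2, ← hS2, this]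
    · rintro ⟨T, hT⟩
      obtain ⟨b, hb⟩ := (h T).1 hT
      refine ⟨b, Subtype.ext ?_⟩
      ext x
      obtain ⟨p, rfl⟩ := e.surjective x
      rw [hb]
      exact hS2 b p
  refine ⟨Equiv.ofBijective g hg, ?_⟩
  obtain ⟨Inc, h1, h2⟩ := D
  have : (fun p b => e p ∈ (Equiv.ofBijective g hg b : Finset (Fin v))) = Inc :=
    funext fun p => funext fun b => propext (hS2 b p)
  simp only [ofFamily, this]

lemma isIsomorphic_ofFamily {P' B' : Type*} [Nonempty P'] [Nonempty B'] (e' : P' ≃ Fin v)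
    (f' : B' ≃ 𝓑) : (ofFamily 𝓑 e' f').IsIsomorphic (ofFamily 𝓑 e f) := by
  refine ⟨e'.trans e.symm, f'.trans f.symm, fun p b => ?_⟩
  simp [ofFamily]

end Family

/-! ### Families that are orbits -/

namespace Rep

variable {v : ℕ} (R : Rep v)

/-- The images of the set `S` under the Mathieu group. -/
def orbit (S : Finset (Fin v)) : Set (Finset (Fin v)) := {T | ∃ g, R.ρ g • S = T}

lemma self_mem_orbit (S : Finset (Fin v)) : S ∈ R.orbit S := ⟨1, by simp⟩

lemma smul_mem_orbit_iff (g : MathieuM11) (S T : Finset (Fin v)) :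
    R.ρ g • T ∈ R.orbit S ↔ T ∈ R.orbit S := by
  constructor
  · rintro ⟨h, hh⟩
    exact ⟨g⁻¹ * h, by rw [map_mul, mul_smul, hh, map_inv, inv_smul_smul]⟩
  · rintro ⟨h, rfl⟩
    exact ⟨g * h, by rw [map_mul, mul_smul]⟩

lemma orbit_eq_of_mem {S T : Finset (Fin v)} (h : T ∈ R.orbit S) : R.orbit T = R.orbit S := by
  obtain ⟨g, rfl⟩ := h
  ext U
  constructor
  · rintro ⟨k, rfl⟩
    exact ⟨k * g, by rw [map_mul, mul_smul]⟩
  · rintro ⟨k, rfl⟩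
    exact ⟨k * g⁻¹, by rw [map_mul, mul_smul, map_inv, inv_smul_smul]⟩

lemma mem_orbit_comm {S T : Finset (Fin v)} : T ∈ R.orbit S ↔ S ∈ R.orbit T := by
  constructor <;> intro h <;> rw [R.orbit_eq_of_mem h] <;> exact R.self_mem_orbit _

lemma card_of_mem_orbit {S T : Finset (Fin v)} (h : T ∈ R.orbit S) : T.card = S.card := by
  obtain ⟨g, rfl⟩ := h
  exact Finset.card_smul_finset _ _

lemma range_le_stabilizer (S : Finset (Fin v)) :
    R.range ≤ MulAction.stabilizer (Equiv.Perm (Fin v)) (R.orbit S) := by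
  rintro _ ⟨g, rfl⟩
  rw [MulAction.mem_stabilizer_set]
  exact fun T => R.smul_mem_orbit_iff g S T

lemma orbit_finite (S : Finset (Fin v)) : (R.orbit S).Finite := Set.toFinite _

lemma blockCount_smul (g : MathieuM11) (S T : Finset (Fin v)) :
    blockCount (R.orbit S) (R.ρ g • T) = blockCount (R.orbit S) T := by
  rw [blockCount, blockCount, ← Nat.card_coe_set_eq, ← Nat.card_coe_set_eq]
  refine (Nat.card_congr
    ((MulAction.toPerm (R.ρ g) : Equiv.Perm (Finset (Fin v))).subtypeEquiv fun U => ?_)).symm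
  change U ∈ R.orbit S ∧ T ⊆ U ↔ R.ρ g • U ∈ R.orbit S ∧ R.ρ g • T ⊆ R.ρ g • U
  rw [R.smul_mem_orbit_iff, Finset.smul_finset_subset_smul_finset_iff]

lemma ncard_subsets_smul (𝓣 : Set (Finset (Fin v))) (g : MathieuM11)
    (h𝓣 : ∀ T, R.ρ g • T ∈ 𝓣 ↔ T ∈ 𝓣) (S : Finset (Fin v)) :
    {T | T ∈ 𝓣 ∧ T ⊆ R.ρ g • S}.ncard = {T | T ∈ 𝓣 ∧ T ⊆ S}.ncard := by
  rw [← Nat.card_coe_set_eq, ← Nat.card_coe_set_eq]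
  refine (Nat.card_congr
    ((MulAction.toPerm (R.ρ g) : Equiv.Perm (Finset (Fin v))).subtypeEquiv fun U => ?_)).symm
  change U ∈ 𝓣 ∧ U ⊆ S ↔ R.ρ g • U ∈ 𝓣 ∧ R.ρ g • U ⊆ R.ρ g • S
  rw [h𝓣, Finset.smul_finset_subset_smul_finset_iff]

end Rep

/-- Counting the incident pairs `(T, S)` with `T ⊆ S` in two ways. -/
lemma ncard_mul_eq_ncard_mul {v : ℕ} (𝓣 𝓑 : Set (Finset (Fin v))) (l n : ℕ)
    (h1 : ∀ T ∈ 𝓣, blockCount 𝓑 T = l) (h2 : ∀ S ∈ 𝓑, {T | T ∈ 𝓣 ∧ T ⊆ S}.ncard = n) :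
    𝓣.ncard * l = 𝓑.ncard * n := by
  classical
  have h := Finset.sum_card_bipartiteAbove_eq_sum_card_bipartiteBelow (s := 𝓣.toFinset)
    (t := 𝓑.toFinset) (fun T S => T ⊆ S)
  rw [Finset.sum_const_nat (m := l), Finset.sum_const_nat (m := n)] at h
  · rwa [Set.ncard_eq_toFinset_card', Set.ncard_eq_toFinset_card']
  · intro S hS
    rw [← h2 S (by simpa using hS), ← Set.ncard_coe_finset]
    congr 1
    ext T
    simp [Finset.bipartiteBelow]
  · intro T hT
    rw [← h1 T (by simpa using hT), blockCount, ← Set.ncard_coe_finset]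
    congr 1
    ext T
    simp [Finset.bipartiteAbove]

/-- The double count for two orbits of the Mathieu group. -/
lemma Rep.ncard_orbit_mul_blockCount {v : ℕ} (R : Rep v) (S T : Finset (Fin v)) :
    (R.orbit T).ncard * blockCount (R.orbit S) T =
      (R.orbit S).ncard * {U | U ∈ R.orbit T ∧ U ⊆ S}.ncard := by
  refine ncard_mul_eq_ncard_mul _ _ _ _ ?_ ?_
  · rintro _ ⟨g, rfl⟩
    exact R.blockCount_smul g S T
  · rintro _ ⟨g, rfl⟩
    exact R.ncard_subsets_smul _ g (fun U => R.smul_mem_orbit_iff g T U) S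

lemma ncard_subsets_card {v t : ℕ} (S : Finset (Fin v)) :
    {T : Finset (Fin v) | T ∈ {T : Finset (Fin v) | T.card = t} ∧ T ⊆ S}.ncard =
      S.card.choose t := by
  rw [← Finset.card_powersetCard, ← Set.ncard_coe_finset]
  congr 1
  ext T
  simp [Finset.mem_powersetCard, and_comm]

lemma ncard_setOf_card {v t : ℕ} : {T : Finset (Fin v) | T.card = t}.ncard = v.choose t := by
  have := ncard_subsets_card (t := t) (Finset.univ : Finset (Fin v))
  simpa using this

/-- If every `t`-set lies in `l` members of a family of `k`-sets, then `l` is determined by the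
number of members. -/
lemma choose_mul_eq {v t k l : ℕ} (𝓑 : Set (Finset (Fin v))) (hk : ∀ S ∈ 𝓑, S.card = k)
    (h : ∀ T : Finset (Fin v), T.card = t → blockCount 𝓑 T = l) :
    v.choose t * l = 𝓑.ncard * k.choose t := by
  have := ncard_mul_eq_ncard_mul {T : Finset (Fin v) | T.card = t} 𝓑 l (k.choose t)
    (fun T hT => h T hT)
    (fun S hS => by rw [ncard_subsets_card, hk S hS])
  rwa [ncard_setOf_card] at this

/-- An orbit of `k`-sets is a `t`-design if the group is transitive on `t`-sets. -/
lemma Rep.blockCount_eq_of_transitive {v : ℕ} (R : Rep v) {t k l : ℕ} (S T₀ : Finset (Fin v))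
    (hS : S.card = k) (hT : ∀ T : Finset (Fin v), T.card = t → T ∈ R.orbit T₀)
    (hl : v.choose t * l = (R.orbit S).ncard * k.choose t) (htv : t ≤ v)
    (T : Finset (Fin v)) (h : T.card = t) : blockCount (R.orbit S) T = l := by
  have h0 : ∀ T : Finset (Fin v), T.card = t →
      blockCount (R.orbit S) T = blockCount (R.orbit S) T₀ := by
    intro T h
    obtain ⟨g, rfl⟩ := hT T h
    exact R.blockCount_smul g S T₀
  have h1 := choose_mul_eq (R.orbit S) (fun U hU => (R.card_of_mem_orbit hU).trans hS) h0
  rw [← hl] at h1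
  rw [h0 T h]
  exact Nat.eq_of_mul_eq_mul_left (Nat.choose_pos htv) h1

/-! ### Parameters of designs -/

section Params

variable {P B : Type*} {D : IncidenceStructure P B}

lemma isDesign_pred {t v k lam : ℕ} (h : D.IsDesign (t + 1) v k lam) :
    ∃ mu, D.IsDesign t v k mu := by
  classical
  have := h.finite_points
  have := h.finite_blocks
  have : Fintype P := Fintype.ofFinite P
  have : Fintype B := Fintype.ofFinite B
  have htk := h.le_block_size
  have key : ∀ T : Finset P, T.card = t →
      Nat.card {b : B // ∀ p ∈ T, D.Inc p b} * (k - t) = (v - t) * lam := by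
    intro T hT
    have hd := Finset.sum_card_bipartiteAbove_eq_sum_card_bipartiteBelow (s := Tᶜ)
      (t := Finset.univ.filter fun b : B => ∀ p ∈ T, D.Inc p b) (fun p b => D.Inc p b)
    rw [Finset.sum_const_nat (m := lam), Finset.sum_const_nat (m := k - t)] at hd
    · rw [Finset.card_compl, hT, ← Nat.card_eq_fintype_card, h.card_points] at hd
      rw [hd, Nat.card_eq_fintype_card, Fintype.card_subtype]
    · intro b hb
      have hb' := (Finset.mem_filter.1 hb).2
      have hc := h.card_block b
      have e1 : D.pointsOf b = (Finset.univ.filter fun p => D.Inc p b : Finset P) := by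
        ext p; simp [pointsOf]
      have e2 : Tᶜ.bipartiteBelow (fun p b => D.Inc p b) b =
          (Finset.univ.filter fun p => D.Inc p b) \ T := by
        ext p; simp [Finset.bipartiteBelow, and_comm]
      rw [e1, Set.ncard_coe_finset] at hc
      rw [e2, Finset.card_sdiff_of_subset (fun p hp => by simpa using hb' p hp), hc, hT]
    · intro p hp
      have hp' : p ∉ T := by simpa using hp
      rw [← h.balanced (insert p T) (by rw [Finset.card_insert_of_notMem hp', hT]),
        Nat.card_eq_fintype_card, Fintype.card_subtype]
      congr 1
      ext b
      simp [Finset.bipartiteAbove, and_comm]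
  refine ⟨(v - t) * lam / (k - t), ‹_›, ‹_›, by omega, h.card_points, h.card_block, ?_⟩
  intro T hT
  rw [← key T hT, Nat.mul_div_cancel _ (by omega)]

lemma isDesign_of_le {s t v k lam : ℕ} (h : D.IsDesign s v k lam) (hts : t ≤ s) :
    ∃ mu, D.IsDesign t v k mu := by
  obtain ⟨j, rfl⟩ := Nat.exists_eq_add_of_le hts
  clear hts
  induction j generalizing lam with
  | zero => exact ⟨lam, h⟩
  | succ j ih =>
    obtain ⟨mu, hmu⟩ := isDesign_pred h
    exact ih hmu

/-- The complement of a 2-design is a 2-design. -/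
lemma isDesign_compl {v k lam : ℕ} (h : D.IsDesign 2 v k lam) (hk : k + 2 ≤ v) :
    ∃ mu, D.compl.IsDesign 2 v (v - k) mu := by
  classical
  have := h.finite_points
  have := h.finite_blocks
  have : Fintype P := Fintype.ofFinite P
  have : Fintype B := Fintype.ofFinite B
  obtain ⟨r, hr⟩ := isDesign_of_le h (t := 1) (by norm_num)
  have hr' : ∀ p, (Finset.univ.filter fun b : B => D.Inc p b).card = r := by
    intro p
    have := hr.balanced {p} (by simp)
    rw [Nat.card_eq_fintype_card, Fintype.card_subtype] at this
    simpa using this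
  refine ⟨Fintype.card B + lam - 2 * r, ‹_›, ‹_›, by omega, h.card_points, ?_, ?_⟩
  · intro b
    have : D.compl.pointsOf b = (D.pointsOf b)ᶜ := rfl
    rw [this, Set.ncard_compl, h.card_points, h.card_block]
  · intro T hT
    obtain ⟨p, q, hpq, rfl⟩ := Finset.card_eq_two.1 hT
    have h2 := h.balanced {p, q} hT
    rw [Nat.card_eq_fintype_card, Fintype.card_subtype] at h2 ⊢
    have e1 := Finset.card_union_add_card_inter (Finset.univ.filter fun b : B => D.Inc p b)
      (Finset.univ.filter fun b : B => D.Inc q b)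
    rw [hr', hr', ← Finset.filter_and, ← Finset.filter_or] at e1
    have e2 := Finset.card_filter_add_card_filter_not (s := (Finset.univ : Finset B))
      (fun b => D.Inc p b ∨ D.Inc q b)
    have e3 : (Finset.univ.filter fun b : B => ∀ p_1 ∈ ({p, q} : Finset P), D.Inc p_1 b) =
      Finset.univ.filter fun b : B => D.Inc p b ∧ D.Inc q b := by ext; simp
    have e4 : (Finset.univ.filter fun b : B => ∀ p_1 ∈ ({p, q} : Finset P), D.compl.Inc p_1 b) =
      Finset.univ.filter fun b : B => ¬ (D.Inc p b ∨ D.Inc q b) :=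
        by ext; simp [IncidenceStructure.compl]
    rw [e3] at h2
    rw [e4]
    rw [Finset.card_univ] at e2
    omega

lemma isSimple_compl (h : D.IsSimple) : D.compl.IsSimple := by
  intro b c hbc
  apply h
  have : (D.pointsOf b)ᶜ = (D.pointsOf c)ᶜ := hbc
  exact compl_injective this

lemma admitsTransitiveAction_compl {G : Type*} [Group G] (h : D.AdmitsTransitiveAction G) :
    D.compl.AdmitsTransitiveAction G := by
  obtain ⟨φ, h1, h2⟩ := h
  refine ⟨(D.aut.subtype.comp φ).codRestrict D.compl.aut fun g p b => ?_, h1, h2⟩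
  exact not_congr ((φ g).2 p b)

end Params

/-! ### Orbits on subsets of the 11 and 12 points -/

/-- Counts the bits of `m` below the first number, starting from the second one. -/
def countBits (m : ℕ) : ℕ → ℕ → ℕ
  | 0, acc => acc
  | n + 1, acc => force (bif m.testBit n then acc + 1 else acc) fun acc' => countBits m n acc'

lemma countBits_eq (m n acc : ℕ) : countBits m n acc = popcount m n + acc := by
  induction n generalizing acc with
  | zero => simp [countBits, popcount]
  | succ n ih =>
    rw [countBits, force_eq, ih, popcount]
    cases m.testBit n <;> simp; ring

namespace Rep

variable {v : ℕ} (R : Rep v)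

/-- The bit map of the set of masks of all images of the set with mask `m`. -/
def orbitMap (m : ℕ) : ℕ :=
  bfs (fun x => imgMask (R.fA 1) x v) (fun x => imgMask R.fD x v) (2 ^ v) (1 <<< m) [m]

lemma orbitMap_sound {m : ℕ} (hm : m < 2 ^ v) {x : ℕ} (hx : (R.orbitMap m).testBit x = true) :
    x < 2 ^ v ∧ maskSet v x ∈ R.orbit (maskSet v m) := by
  refine bfs_sound _ _ (fun x => x < 2 ^ v ∧ maskSet v x ∈ R.orbit (maskSet v m)) ?_ ?_ _ _ _ ?_ ?_
    x hx
  · rintro x ⟨-, h⟩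
    refine ⟨imgMask_lt (fun p hp => ?_) x, ?_⟩
    · have := R.fA_one ⟨p, hp⟩
      simp only at this
      rw [← this]
      exact Fin.is_lt _
    · rwa [maskSet_imgMask _ (R.ρ gA) R.fA_one, R.smul_mem_orbit_iff]
  · rintro x ⟨-, h⟩
    refine ⟨imgMask_lt (fun p hp => ?_) x, ?_⟩
    · have := R.ρ_gD ⟨p, hp⟩
      simp only at this
      rw [← this]
      exact Fin.is_lt _
    · rwa [maskSet_imgMask _ (R.ρ gD) R.ρ_gD, R.smul_mem_orbit_iff]
  · intro y hy
    rw [testBit_one_shiftLeft, decide_eq_true_eq] at hy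
    subst hy
    exact ⟨hm, R.self_mem_orbit _⟩
  · intro y hy
    rw [List.mem_singleton] at hy
    subst hy
    exact ⟨hm, R.self_mem_orbit _⟩

/-- Whether the bit map `bm` of a set of masks is closed under the generators and contains `m`. -/
def isClosed (bm m : ℕ) : Bool :=
  bm.testBit m && (closedUnder (fun x => imgMask (R.fA 1) x v) bm (2 ^ v) &&
    closedUnder (fun x => imgMask R.fD x v) bm (2 ^ v))

lemma smul_mem_of_closedUnder {f : ℕ → ℕ} {σ : Equiv.Perm (Fin v)} (hσ : ∀ p, (σ p : ℕ) = f p)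
    {bm : ℕ} (h : closedUnder (fun x => imgMask f x v) bm (2 ^ v) = true) :
    σ ∈ MulAction.stabilizer (Equiv.Perm (Fin v))
      {S : Finset (Fin v) | bm.testBit (toMask S) = true} := by
  rw [MulAction.mem_stabilizer_set' (Set.toFinite _)]
  intro S hS
  have h1 := List.all_eq_true.1 h (toMask S) (List.mem_range.2 (toMask_lt S))
  rw [Set.mem_ofPred_eq] at hS
  rw [hS, Bool.not_true, Bool.false_or] at h1
  have h2 : imgMask f (toMask S) v = toMask (σ • S) := by
    rw [← toMask_maskSet (imgMask_lt (f := f) (fun p hp => ?_) (toMask S)),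
      maskSet_imgMask f σ hσ, maskSet_toMask]
    have := hσ ⟨p, hp⟩
    simp only at this
    rw [← this]
    exact Fin.is_lt _
  rw [Set.mem_ofPred_eq, ← h2]
  exact h1

lemma mem_orbit_iff_testBit {m : ℕ} (hm : m < 2 ^ v)
    (h : force (R.orbitMap m) (fun bm => R.isClosed bm m) = true) (S : Finset (Fin v)) :
    S ∈ R.orbit (maskSet v m) ↔ (R.orbitMap m).testBit (toMask S) = true := by
  rw [force_eq, isClosed, Bool.and_eq_true, Bool.and_eq_true] at h
  obtain ⟨h0, hA, hD⟩ := h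
  constructor
  · rintro ⟨g, rfl⟩
    have := R.range_le _ (smul_mem_of_closedUnder R.fA_one hA) (smul_mem_of_closedUnder R.ρ_gD hD)
      (R.mem_range g)
    rw [MulAction.mem_stabilizer_set] at this
    refine (this (maskSet v m)).2 ?_
    rw [Set.mem_ofPred_eq, toMask_maskSet hm]
    exact h0
  · intro hS
    simpa using (R.orbitMap_sound hm hS).2

end Rep

lemma ncard_testBit_toMask (v bm : ℕ) :
    {S : Finset (Fin v) | bm.testBit (toMask S) = true}.ncard = countBits bm (2 ^ v) 0 := by
  rw [countBits_eq, add_zero, ← card_maskSet, ← Set.ncard_coe_finset]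
  refine Set.ncard_congr (fun S _ => ⟨toMask S, toMask_lt S⟩) ?_ ?_ ?_
  · intro S hS
    simpa using hS
  · intro S T _ _ h
    exact toMask_injective (by simpa using h)
  · intro i hi
    refine ⟨maskSet v i, ?_, Fin.ext (toMask_maskSet i.2)⟩
    rw [Set.mem_ofPred_eq, toMask_maskSet i.2]
    simpa using hi

lemma Rep.ncard_orbit {v : ℕ} (R : Rep v) {m n : ℕ} (hm : m < 2 ^ v)
    (h : force (R.orbitMap m) (fun bm => R.isClosed bm m) = true)
    (hn : (force (R.orbitMap m) fun bm => countBits bm (2 ^ v) 0) = n) :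
    (R.orbit (maskSet v m)).ncard = n := by
  rw [← hn, force_eq, ← ncard_testBit_toMask]
  congr 1
  ext S
  exact R.mem_orbit_iff_testBit hm h S

/-- Whether all extensions of the set with mask `acc` by `k` elements below `n` have their masks in
`bm`. -/
def coversCard (bm : ℕ) : ℕ → ℕ → ℕ → Bool
  | _, 0, acc => bm.testBit acc
  | 0, _ + 1, _ => true
  | n + 1, k + 1, acc =>
    force (acc ||| 1 <<< n) fun acc' => coversCard bm n k acc' && coversCard bm n (k + 1) acc

lemma testBit_of_coversCard {v bm : ℕ} : ∀ (n k : ℕ) (T S : Finset (Fin v)), n ≤ v →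
    coversCard bm n k (toMask T) = true → S.card = k → (∀ p ∈ S, p.1 < n) →
      bm.testBit (toMask (S ∪ T)) = true := by
  intro n
  induction n with
  | zero =>
    intro k T S _ h hk hS
    obtain rfl : S = ∅ := Finset.eq_empty_of_forall_notMem fun p hp => by have := hS p hp; omega
    obtain rfl : k = 0 := hk.symm
    simpa [coversCard] using h
  | succ n ih =>
    intro k T S hn h hk hS
    cases k with
    | zero =>
      rw [Finset.card_eq_zero] at hk
      subst hk
      simpa [coversCard] using h
    | succ k =>
      rw [coversCard, force_eq, Bool.and_eq_true] at h
      obtain ⟨hl, hr⟩ := h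
      rw [← toMask_insert T ⟨n, hn⟩] at hl
      by_cases hmem : (⟨n, hn⟩ : Fin v) ∈ S
      · have h1 := ih k (insert (⟨n, hn⟩ : Fin v) T) (S.erase (⟨n, hn⟩ : Fin v))
          (Nat.le_of_succ_le hn) hl
          (by rw [Finset.card_erase_of_mem hmem, hk]; exact Nat.add_sub_cancel k 1) (fun p hp => by
            obtain ⟨h3, h4⟩ := Finset.mem_erase.1 hp
            have h5 := hS p h4
            have h6 : p.1 ≠ n := fun hc => h3 (Fin.ext hc)
            exact Nat.lt_of_le_of_ne (Nat.le_of_lt_succ h5) h6)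
        rwa [Finset.union_insert, ← Finset.insert_union, Finset.insert_erase hmem] at h1
      · refine ih (k + 1) T S (Nat.le_of_succ_le hn) hr hk fun p hp => ?_
        have h5 := hS p hp
        have h6 : p.1 ≠ n := fun hc => hmem (by rwa [show (⟨n, hn⟩ : Fin v) =
          p from Fin.ext hc.symm])
        exact Nat.lt_of_le_of_ne (Nat.le_of_lt_succ h5) h6

namespace Rep

variable {v : ℕ} (R : Rep v)

/-- The union of the bit maps of the orbits of the sets with the given masks. -/
def orbitsMap : List ℕ → ℕ
  | [] => 0
  | m :: l => force (R.orbitMap m) fun b => force (orbitsMap l) fun b' => b ||| b'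

lemma exists_mem_orbit_of_coversCard {k : ℕ} {l : List ℕ} (hl : ∀ m ∈ l, m < 2 ^ v)
    (h : (force (R.orbitsMap l) fun bm => coversCard bm v k 0) = true) (S : Finset (Fin v))
      (hS : S.card = k) :
    ∃ m ∈ l, S ∈ R.orbit (maskSet v m) := by
  have h1 := testBit_of_coversCard v k ∅ S le_rfl (by rw [toMask_empty]; exact h) hS fun p _ => p.2
  rw [Finset.union_empty] at h1
  clear h
  induction l with
  | nil => simp [orbitsMap] at h1
  | cons m l ih =>
    simp only [orbitsMap, force_eq, Nat.testBit_or, Bool.or_eq_true] at h1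
    rcases h1 with h1 | h1
    · exact ⟨m, by simp, by simpa using (R.orbitMap_sound (hl m (by simp)) h1).2⟩
    · obtain ⟨m', hm', h⟩ := ih (fun m hm => hl m (by simp [hm])) h1
      exact ⟨m', by simp [hm'], h⟩

end Rep

/-- The masks of representatives of the orbits on the 3-, 4- and 5-subsets of the 11 points. -/
lemma orbits11 (k : ℕ) (l : List ℕ) (h : (k, l) ∈ [(3, [7]), (4, [15]), (5, [61, 31])])
    (S : Finset (Fin 11)) (hS : S.card = k) : ∃ m ∈ l, S ∈ R11.orbit (maskSet 11 m) := by
  refine R11.exists_mem_orbit_of_coversCard (k := k) ?_ ?_ S hS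
  · clear hS S
    simp only [List.mem_cons, List.not_mem_nil, or_false, Prod.mk.injEq] at h
    rcases h with ⟨rfl, rfl⟩ | ⟨rfl, rfl⟩ | ⟨rfl, rfl⟩ <;> decide +kernel
  · clear hS S
    simp only [List.mem_cons, List.not_mem_nil, or_false, Prod.mk.injEq] at h
    rcases h with ⟨rfl, rfl⟩ | ⟨rfl, rfl⟩ | ⟨rfl, rfl⟩ <;> decide +kernel

/-- The masks of representatives of the orbits on the subsets with 3 to 6 elements of the 12
points. -/
lemma orbits12 (k : ℕ) (l : List ℕ)
    (h : (k, l) ∈ [(3, [7]), (4, [15, 23]), (5, [59, 31]), (6, [237, 95, 63])])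
    (S : Finset (Fin 12)) (hS : S.card = k) : ∃ m ∈ l, S ∈ R12.orbit (maskSet 12 m) := by
  refine R12.exists_mem_orbit_of_coversCard (k := k) ?_ ?_ S hS
  · clear hS S
    simp only [List.mem_cons, List.not_mem_nil, or_false, Prod.mk.injEq] at h
    rcases h with ⟨rfl, rfl⟩ | ⟨rfl, rfl⟩ | ⟨rfl, rfl⟩ | ⟨rfl, rfl⟩ <;> decide +kernel
  · clear hS S
    simp only [List.mem_cons, List.not_mem_nil, or_false, Prod.mk.injEq] at h
    rcases h with ⟨rfl, rfl⟩ | ⟨rfl, rfl⟩ | ⟨rfl, rfl⟩ | ⟨rfl, rfl⟩ <;> decide +kernel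

lemma isClosed11 : force (R11.orbitMap 61) (fun bm => R11.isClosed bm 61) = true := by
  decide +kernel

lemma isClosed12 (m : ℕ) (hm : m ∈ [15, 59, 237, 95]) :
    force (R12.orbitMap m) (fun bm => R12.isClosed bm m) = true := by
  simp only [List.mem_cons, List.not_mem_nil, or_false] at hm
  rcases hm with rfl | rfl | rfl | rfl <;> decide +kernel

lemma ncard_orbit11 : (R11.orbit (maskSet 11 61)).ncard = 66 :=
  R11.ncard_orbit (by norm_num) isClosed11 (by decide +kernel)

lemma ncard_orbit12 (m n : ℕ) (h : (m, n) ∈ [(15, 165), (59, 132), (237, 22), (95, 110)]) :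
    (R12.orbit (maskSet 12 m)).ncard = n := by
  refine R12.ncard_orbit ?_ (isClosed12 m ?_) ?_
  all_goals
    simp only [List.mem_cons, List.not_mem_nil, or_false, Prod.mk.injEq] at h
    rcases h with ⟨rfl, rfl⟩ | ⟨rfl, rfl⟩ | ⟨rfl, rfl⟩ | ⟨rfl, rfl⟩ <;> decide +kernel

/-! ### Automorphism groups on 11 and 12 points -/

/-- Whether every permutation found by the search that fixes the numbers below `j` and preserves the
`k`-sets with masks in `bm` is spelled by one of the words. -/
def rigid (v : ℕ) (act : List ℕ → ℕ → ℕ) (j k : ℕ) (words : List (List ℕ)) (bm : ℕ) : Bool :=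
  (extend (preservesNewest bm k) v (v - j) (valuesRev id j)).all fun l =>
    words.any fun w => valuesRev (act w) v == l

/-- If `K` moves any `j` distinct points to the first `j` points and all permutations that fix those
and preserve a family of `k`-sets lie in `K`, then `K` contains all permutations that preserve the
family. -/
lemma mem_of_rigid {v : ℕ} (K : Subgroup (Equiv.Perm (Fin v))) (act : List ℕ → ℕ → ℕ)
    (hact : ∀ w, ∃ σ ∈ K, ∀ p, (σ p : ℕ) = act w p) {j k : ℕ} (hj : j ≤ v) (hk : 0 < k)
    (ht : ∀ t : Fin j → Fin v, Function.Injective t → ∃ g ∈ K, ∀ i, (g (t i) : ℕ) = i)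
    (words : List (List ℕ)) (bm : ℕ) (h : rigid v act j k words bm = true)
    (hK : ∀ σ ∈ K, ∀ S : Finset (Fin v), S.card = k →
      bm.testBit (toMask S) = bm.testBit (toMask (σ • S)))
    (τ : Equiv.Perm (Fin v)) (hτ : ∀ S : Finset (Fin v), S.card = k →
      bm.testBit (toMask S) = bm.testBit (toMask (τ • S))) : τ ∈ K := by
  obtain ⟨g, hgK, hg⟩ := ht (fun i => τ (Fin.castLE hj i))
    (fun a b hab => Fin.castLE_injective hj (τ.injective hab))
  have h1 := valuesRev_mem_extend_of_preserves (g * τ) bm k hk (fun S hS => by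
    rw [hτ S hS, mul_smul, ← hK g hgK]
    rw [Finset.card_smul_finset, hS]) j hj
  have h2 : valuesRev (permNat (g * τ)) j = valuesRev id j := by
    have : ∀ i ≤ j, valuesRev (permNat (g * τ)) i = valuesRev id i := by
      intro i
      induction i with
      | zero => intro _; rfl
      | succ i ih =>
        intro hi
        rw [valuesRev, valuesRev, ih (by omega)]
        congr 1
        have := permNat_val (g * τ) ⟨i, by omega⟩
        simp only at this
        rw [this]
        exact hg ⟨i, by omega⟩
    exact this j le_rfl
  rw [h2] at h1
  obtain ⟨w, -, hw⟩ := List.any_eq_true.1 (List.all_eq_true.1 h _ h1)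
  rw [beq_iff_eq] at hw
  obtain ⟨σ, hσK, hσ⟩ := hact w
  have h3 : g * τ = σ := by
    ext p
    rw [hσ, eq_of_valuesRev_eq hw p p.2, permNat_val]
  have : τ = g⁻¹ * σ := by rw [← h3, inv_mul_cancel_left]
  rw [this]
  exact K.mul_mem (K.inv_mem hgK) hσK

lemma testBit_smul_eq {v bm : ℕ} {σ : Equiv.Perm (Fin v)}
    (h : σ ∈ MulAction.stabilizer (Equiv.Perm (Fin v))
      {S : Finset (Fin v) | bm.testBit (toMask S) = true}) (S : Finset (Fin v)) :
    bm.testBit (toMask S) = bm.testBit (toMask (σ • S)) := by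
  rw [Bool.eq_iff_iff]
  exact ((MulAction.mem_stabilizer_set.1 h) S).symm

lemma Rep.stabilizer_orbit_eq_range {v : ℕ} (R : Rep v) {j k m : ℕ} (hj : j ≤ v) (hk : 0 < k)
    (ht : ∀ t : Fin j → Fin v, Function.Injective t → ∃ g, ∀ i, (R.ρ g (t i) : ℕ) = i)
    (words : List (List ℕ)) (hm : m < 2 ^ v)
    (hc : force (R.orbitMap m) (fun bm => R.isClosed bm m) = true)
    (h : force (R.orbitMap m) (rigid v R.act j k words) = true) :
    MulAction.stabilizer (Equiv.Perm (Fin v)) (R.orbit (maskSet v m)) = R.range := by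
  have heq : R.orbit (maskSet v m) =
      {S : Finset (Fin v) | (R.orbitMap m).testBit (toMask S) = true} :=
    Set.ext fun S => R.mem_orbit_iff_testBit hm hc S
  refine le_antisymm (fun τ hτ => ?_) (R.range_le_stabilizer _)
  refine mem_of_rigid R.range R.act R.exists_mem_range hj hk
    (fun t h => ?_) words _ h (fun σ hσ S _ => ?_) τ fun S _ => ?_
  · obtain ⟨g, hg⟩ := ht t h
    exact ⟨_, R.mem_range g, hg⟩
  · have := R.range_le_stabilizer (maskSet v m) hσ
    rw [heq] at this
    exact testBit_smul_eq this S
  · rw [heq] at hτ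
    exact testBit_smul_eq hτ S

/-- The automorphism group of the Steiner system `S(4, 5, 11)` is the Mathieu group. -/
lemma stabilizer_orbit11 :
    MulAction.stabilizer (Equiv.Perm (Fin 11)) (R11.orbit (maskSet 11 61)) = R11.range :=
  R11.stabilizer_orbit_eq_range (k := 5) (by norm_num) (by norm_num) exists_map_eq11 [[]]
    (by norm_num) isClosed11 (by decide +kernel)

/-- The words that spell the stabilizer of the first three of the 12 points. -/
def stabilizerWords12 : List (List ℕ) :=
  [[], [3, 0, 8, 4], [3, 10, 1, 0], [4, 2, 7, 10], [9, 9, 3, 1], [1, 6, 8, 3, 0]]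

lemma disjoint_orbit_of_testBit {v : ℕ} (R : Rep v) {m m' : ℕ} (hm : m < 2 ^ v) (hm' : m' < 2 ^ v)
    (hc : force (R.orbitMap m) (fun bm => R.isClosed bm m && !bm.testBit m') = true) :
    maskSet v m' ∉ R.orbit (maskSet v m) := by
  rw [force_eq, Bool.and_eq_true, Bool.not_eq_true'] at hc
  rw [R.mem_orbit_iff_testBit hm hc.1, toMask_maskSet hm', hc.2]
  simp

/-- The complement in the set of all `k`-sets of an invariant family is an orbit if the group has
only one further orbit. -/
lemma Rep.orbit_eq_sdiff {v : ℕ} (R : Rep v) {k : ℕ} (S₀ : Finset (Fin v)) (hS₀ : S₀.card = k)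
    (𝓑 : Set (Finset (Fin v))) (h𝓑 : R.range ≤ MulAction.stabilizer (Equiv.Perm (Fin v)) 𝓑)
    (h0 : S₀ ∉ 𝓑) (hcov : ∀ S : Finset (Fin v), S.card = k → S ∈ 𝓑 ∨ S ∈ R.orbit S₀) :
    R.orbit S₀ = {S | S.card = k} \ 𝓑 := by
  ext S
  rw [Set.mem_sdiff, Set.mem_ofPred_eq]
  refine ⟨fun h => ⟨(R.card_of_mem_orbit h).trans hS₀, ?_⟩,
    fun h => (hcov S h.1).resolve_left h.2⟩
  obtain ⟨g, rfl⟩ := h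
  rwa [MulAction.mem_stabilizer_set.1 (h𝓑 (R.mem_range g))]

lemma orbit12_31 :
    R12.orbit (maskSet 12 31) = {S | S.card = 5} \ R12.orbit (maskSet 12 59) :=
  R12.orbit_eq_sdiff _ (by rw [card_maskSet]; decide) _ (R12.range_le_stabilizer _)
    (disjoint_orbit_of_testBit R12 (by norm_num) (by norm_num) (by decide +kernel))
    (fun S hS => by simpa using orbits12 5 [59, 31] (by simp) S hS)

lemma mem_orbit12_iff_of_card_eq_five (S : Finset (Fin 12)) (hS : S.card = 5) :
    S ∈ R12.orbit (maskSet 12 31) ↔ S ∉ R12.orbit (maskSet 12 59) := by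
  rw [orbit12_31, Set.mem_sdiff, Set.mem_ofPred_eq, and_iff_right hS]

/-- The blocks of size 5 of the design with 132 blocks determine the Mathieu group. -/
lemma stabilizer_orbit12_59 :
    MulAction.stabilizer (Equiv.Perm (Fin 12)) (R12.orbit (maskSet 12 59)) = R12.range :=
  R12.stabilizer_orbit_eq_range (k := 5) (by norm_num) (by norm_num) exists_map_eq12
    stabilizerWords12 (by norm_num) (isClosed12 59 (by simp)) (by decide +kernel)

lemma stabilizer_orbit12_15 :
    MulAction.stabilizer (Equiv.Perm (Fin 12)) (R12.orbit (maskSet 12 15)) = R12.range :=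
  R12.stabilizer_orbit_eq_range (k := 4) (by norm_num) (by norm_num) exists_map_eq12
    stabilizerWords12 (by norm_num) (isClosed12 15 (by simp)) (by decide +kernel)

/-- The 5-sets contained in members of an orbit of 6-sets. -/
def covered (m : ℕ) : Set (Finset (Fin 12)) :=
  {T | T.card = 5 ∧ ∃ S ∈ R12.orbit (maskSet 12 m), T ⊆ S}

lemma smul_mem_covered_iff {m : ℕ} {σ : Equiv.Perm (Fin 12)}
    (hσ : σ ∈ MulAction.stabilizer (Equiv.Perm (Fin 12)) (R12.orbit (maskSet 12 m)))
    (T : Finset (Fin 12)) : σ • T ∈ covered m ↔ T ∈ covered m := by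
  rw [MulAction.mem_stabilizer_set] at hσ
  simp only [covered, Set.mem_ofPred_eq, Finset.card_smul_finset]
  refine and_congr_right fun _ => ⟨?_, ?_⟩
  · rintro ⟨S, hS, hT⟩
    refine ⟨σ⁻¹ • S, ?_, ?_⟩
    · rw [← hσ, smul_inv_smul]
      exact hS
    · rwa [Finset.subset_smul_finset_iff, inv_inv]
  · rintro ⟨S, hS, hT⟩
    exact ⟨σ • S, (hσ S).2 hS, Finset.smul_finset_subset_smul_finset hT⟩

/-- Whether some number below `N` in the bit map contains all bits of `m`. -/
def coversMask (N m bm : ℕ) : Bool :=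
  (List.range N).any fun x => bm.testBit x && (x &&& m == m)

lemma maskSet_subset_iff {v m m' : ℕ} (hm : m < 2 ^ v) :
    maskSet v m ⊆ maskSet v m' ↔ m' &&& m = m := by
  constructor
  · intro h
    apply Nat.eq_of_testBit_eq
    intro i
    rw [Nat.testBit_and]
    by_cases hi : i < v
    · have := @h ⟨i, hi⟩
      simp only [mem_maskSet] at this
      cases h1 : m.testBit i
      · simp
      · simp [this h1]
    · rw [Nat.testBit_eq_false_of_lt (hm.trans_le (Nat.pow_le_pow_right (by norm_num) (by omega)))]
      simp
  · intro h p hp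
    rw [mem_maskSet] at hp ⊢
    rw [← h, Nat.testBit_and, Bool.and_eq_true] at hp
    exact hp.1

lemma maskSet_mem_covered_iff {m m' : ℕ} (hm : m < 2 ^ 12) (hm' : m' < 2 ^ 12)
    (h5 : popcount m' 12 = 5) (hc : force (R12.orbitMap m) (fun bm => R12.isClosed bm m) = true) :
    maskSet 12 m' ∈ covered m ↔ force (R12.orbitMap m) (coversMask (2 ^ 12) m') = true := by
  simp only [covered, Set.mem_ofPred_eq, card_maskSet, h5, true_and, force_eq, coversMask,
    List.any_eq_true, Bool.and_eq_true, beq_iff_eq, List.mem_range]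
  constructor
  · rintro ⟨S, hS, hT⟩
    refine ⟨toMask S, toMask_lt S, (R12.mem_orbit_iff_testBit hm hc S).1 hS, ?_⟩
    rwa [← maskSet_subset_iff hm', maskSet_toMask]
  · rintro ⟨x, -, h1, h2⟩
    exact ⟨maskSet 12 x, (R12.orbitMap_sound hm h1).2, (maskSet_subset_iff hm').2 h2⟩

/-- The blocks of the designs with 22 and with 110 blocks of size 6 contain the 5-sets of just one
of the two orbits, so that their automorphisms also preserve the smaller orbit of 5-sets. -/
lemma stabilizer_orbit12_six {m : ℕ} (hm : m < 2 ^ 12)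
    (hc : force (R12.orbitMap m) (fun bm => R12.isClosed bm m) = true)
    (h : (force (R12.orbitMap m) fun bm =>
      xor (coversMask (2 ^ 12) 59 bm) (coversMask (2 ^ 12) 31 bm)) = true) :
    MulAction.stabilizer (Equiv.Perm (Fin 12)) (R12.orbit (maskSet 12 m)) = R12.range := by
  refine le_antisymm (fun σ hσ => ?_) (R12.range_le_stabilizer _)
  have hg : ∀ g T, R12.ρ g • T ∈ covered m ↔ T ∈ covered m := fun g T =>
    smul_mem_covered_iff (R12.range_le_stabilizer _ (R12.mem_range g)) T
  have h1 := maskSet_mem_covered_iff hm (by norm_num : 59 < 2 ^ 12) (by decide) hc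
  have h2 := maskSet_mem_covered_iff hm (by norm_num : 31 < 2 ^ 12) (by decide) hc
  simp only [force_eq] at h h1 h2
  have hiff : ∃ b : Bool, ∀ S : Finset (Fin 12), S.card = 5 →
      (S ∈ R12.orbit (maskSet 12 59) ↔ (b = true ↔ S ∈ covered m)) := by
    refine ⟨coversMask (2 ^ 12) 59 (R12.orbitMap m), fun S hS => ?_⟩
    by_cases hS' : S ∈ R12.orbit (maskSet 12 59)
    · obtain ⟨g, rfl⟩ := hS'
      rw [hg, h1]
      simp [R12.smul_mem_orbit_iff, R12.self_mem_orbit]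
    · obtain ⟨g, rfl⟩ := (mem_orbit12_iff_of_card_eq_five S hS).2 hS'
      rw [hg, h2]
      simp only [hS', false_iff]
      revert h
      cases coversMask (2 ^ 12) 59 (R12.orbitMap m) <;>
        cases coversMask (2 ^ 12) 31 (R12.orbitMap m) <;> simp
  obtain ⟨b, hb⟩ := hiff
  rw [← stabilizer_orbit12_59, MulAction.mem_stabilizer_set]
  intro S
  by_cases hS : S.card = 5
  · rw [hb S hS, hb _ (by rwa [Finset.card_smul_finset]), smul_mem_covered_iff hσ]
  · have h5 : (maskSet 12 59).card = 5 := by rw [card_maskSet]; decide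
    constructor <;> intro hc'
    · exact absurd (by rw [← h5, ← R12.card_of_mem_orbit hc', Finset.card_smul_finset]) hS
    · exact absurd (by rw [← h5, ← R12.card_of_mem_orbit hc']) hS

lemma stabilizer_orbit12_237 :
    MulAction.stabilizer (Equiv.Perm (Fin 12)) (R12.orbit (maskSet 12 237)) = R12.range :=
  stabilizer_orbit12_six (by norm_num) (isClosed12 237 (by simp)) (by decide +kernel)

lemma stabilizer_orbit12_95 :
    MulAction.stabilizer (Equiv.Perm (Fin 12)) (R12.orbit (maskSet 12 95)) = R12.range :=
  stabilizer_orbit12_six (by norm_num) (isClosed12 95 (by simp)) (by decide +kernel)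

/-- The blocks of the Steiner system `S(5, 6, 12)`. -/
def hexads : Set (Finset (Fin 12)) := R12.orbit (maskSet 12 237) ∪ R12.orbit (maskSet 12 95)

/-- The values of elements that generate the Mathieu group of degree 12: for `i = 11` of the generator
that moves the last point, and for smaller `i` of the second generator followed by the `i`-th power of
the first one. -/
def genM12 (i p : ℕ) : ℕ :=
  bif i == 11 then tableFun [11, 10, 5, 7, 8, 2, 9, 3, 4, 6, 1, 0] p
  else bif p == 11 then 11
  else (tableFun [0, 1, 6, 9, 5, 3, 10, 2, 8, 4, 7, 11] p + i) % 11

/-- The action of words in the elements of `genM12`. -/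
def actM12 : List ℕ → ℕ → ℕ
  | [], p => p
  | i :: w, p => genM12 i (actM12 w p)

lemma exists_mem_M12 (w : List ℕ) :
    ∃ σ ∈ MathieuM12, ∀ p : Fin 12, (σ p : ℕ) = actM12 w p := by
  have h1 : (c[0, 1, 2, 3, 4, 5, 6, 7, 8, 9, 10] : Equiv.Perm (Fin 12)) ∈ MathieuM12 :=
    Subgroup.subset_closure (by simp)
  have h2 : (c[2, 6, 10, 7] * c[3, 9, 4, 5] : Equiv.Perm (Fin 12)) ∈ MathieuM12 :=
    Subgroup.subset_closure (by simp)
  have h3 : (c[0, 11] * c[1, 10] * c[2, 5] * c[3, 7] * c[4, 8] * c[6, 9] :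
      Equiv.Perm (Fin 12)) ∈ MathieuM12 := Subgroup.subset_closure (by simp)
  have hA : ∀ (i : ℕ) (p : Fin 12),
      ((c[0, 1, 2, 3, 4, 5, 6, 7, 8, 9, 10] ^ i : Equiv.Perm (Fin 12)) p : ℕ) =
        bif (p : ℕ) == 11 then 11 else (p + i) % 11 := by
    intro i
    induction i with
    | zero => decide +kernel
    | succ i ih =>
      intro p
      rw [pow_succ, Equiv.Perm.mul_apply, ih]
      have h4 : ((c[0, 1, 2, 3, 4, 5, 6, 7, 8, 9, 10] : Equiv.Perm (Fin 12)) p : ℕ) =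
        bif (p : ℕ) == 11 then 11 else ((p : ℕ) + 1) % 11 := by revert p; decide +kernel
      rw [h4]
      by_cases hp : (p : ℕ) = 11
      · simp [hp]
      · have h7 : ((p : ℕ) + 1) % 11 ≠ 11 := by omega
        simp only [beq_eq_false_iff_ne.2 hp, beq_eq_false_iff_ne.2 h7, cond_false]
        omega
  induction w with
  | nil => exact ⟨1, one_mem _, fun p => rfl⟩
  | cons i w ih =>
    obtain ⟨σ, hσ, h⟩ := ih
    by_cases hi : i = 11
    · refine ⟨_ * σ, mul_mem h3 hσ, fun p => ?_⟩
      rw [Equiv.Perm.mul_apply, actM12, ← h]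
      have : ∀ q : Fin 12, ((c[0, 11] * c[1, 10] * c[2, 5] * c[3, 7] * c[4, 8] * c[6, 9] :
        Equiv.Perm (Fin 12)) q : ℕ) = genM12 11 q := by decide +kernel
      rw [this, hi]
    · refine ⟨c[0, 1, 2, 3, 4, 5, 6, 7, 8, 9, 10] ^ i * (c[2, 6, 10, 7] * c[3, 9, 4, 5]) * σ,
        mul_mem (mul_mem (pow_mem h1 i) h2) hσ, fun p => ?_⟩
      rw [Equiv.Perm.mul_apply, actM12, ← h, Equiv.Perm.mul_apply, hA]
      have h5 : ∀ q : Fin 12, ((c[2, 6, 10, 7] * c[3, 9, 4, 5] : Equiv.Perm (Fin 12)) q : ℕ) =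
        tableFun [0, 1, 6, 9, 5, 3, 10, 2, 8, 4, 7, 11] q := by decide +kernel
      have h6 : ∀ q : Fin 12, ((q : ℕ) == 11) =
        (tableFun [0, 1, 6, 9, 5, 3, 10, 2, 8, 4, 7, 11] q == 11) := by decide +kernel
      rw [h5, genM12, beq_eq_false_iff_ne.2 hi, cond_false, ← h6]

/-- Words for the 5-fold transitivity of the Mathieu group of degree 12. -/
def chainM12 : List (List (List ℕ)) :=
  [[[], [1], [2], [3], [4], [5], [6], [7], [8], [9], [10], [11]],
    [[], [1, 6], [2, 3], [3, 8], [4, 10], [5, 2], [8, 5], [1, 1, 4], [1, 9, 8], [1, 11, 9],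
      [2, 7, 10]],
    [[], [0], [0, 0], [0, 0, 0], [1, 5, 1], [2, 4, 6], [2, 8, 2], [0, 2, 8, 2], [0, 11, 3, 11],
      [2, 6, 2, 2]],
    [[], [9, 2, 4], [10, 10, 7], [4, 2, 11, 4], [4, 5, 4, 0], [6, 4, 5, 2], [6, 6, 5, 3],
      [10, 3, 1, 7], [1, 2, 4, 11, 8]],
    [[], [5, 11, 6, 3, 5], [6, 5, 7, 11, 9], [11, 6, 2, 11, 0], [3, 7, 4, 11, 4, 0],
      [4, 5, 11, 7, 1, 0], [6, 4, 1, 11, 8, 1], [9, 6, 7, 11, 8, 0]]]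

/-- The Mathieu group of degree 12 is 5-transitive. -/
lemma exists_map_eq_M12 (t : Fin 5 → Fin 12) (ht : Function.Injective t) :
    ∃ g ∈ MathieuM12, ∀ j, (g (t j) : ℕ) = j :=
  exists_map_eq_of_isChain MathieuM12 actM12 exists_mem_M12 chainM12 rfl (by decide +kernel) t ht

lemma mem_hexads_iff (S : Finset (Fin 12)) :
    S ∈ hexads ↔ (R12.orbitsMap [237, 95]).testBit (toMask S) = true := by
  rw [hexads, Set.mem_union, R12.mem_orbit_iff_testBit (by norm_num) (isClosed12 237 (by simp)),
    R12.mem_orbit_iff_testBit (by norm_num) (isClosed12 95 (by simp))]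
  simp [Rep.orbitsMap]

/-- The automorphism group of the Steiner system `S(5, 6, 12)` is the Mathieu group. -/
lemma stabilizer_hexads :
    MulAction.stabilizer (Equiv.Perm (Fin 12)) hexads = MathieuM12 := by
  have heq : hexads =
      {S : Finset (Fin 12) | (R12.orbitsMap [237, 95]).testBit (toMask S) = true} :=
    Set.ext mem_hexads_iff
  have hle : MathieuM12 ≤ MulAction.stabilizer (Equiv.Perm (Fin 12)) hexads := by
    rw [heq]
    refine (Subgroup.closure_le _).2 ?_
    have hc : (force (R12.orbitsMap [237, 95]) fun bm =>
        closedUnder (fun x => imgMask (fA12 10) x 12) bm (2 ^ 12) &&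
        (closedUnder (fun x => imgMask (genM12 0) x 12) bm (2 ^ 12) &&
        closedUnder (fun x => imgMask (genM12 11) x 12) bm (2 ^ 12))) = true := by decide +kernel
    rw [force_eq, Bool.and_eq_true, Bool.and_eq_true] at hc
    rintro σ (rfl | rfl | rfl)
    · exact Rep.smul_mem_of_closedUnder (by decide +kernel) hc.1
    · exact Rep.smul_mem_of_closedUnder (by decide +kernel) hc.2.1
    · exact Rep.smul_mem_of_closedUnder (by decide +kernel) hc.2.2
  refine le_antisymm (fun τ hτ => ?_) hle
  refine mem_of_rigid (k := 6) MathieuM12 actM12 exists_mem_M12 (by norm_num) (by norm_num)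
    exists_map_eq_M12 [[]] (R12.orbitsMap [237, 95]) ?_ (fun σ hσ S _ => ?_) τ fun S _ => ?_
  · have : force (R12.orbitsMap [237, 95]) (rigid 12 actM12 5 6 [[]]) = true := by decide +kernel
    exact this
  · have := hle hσ
    rw [heq] at this
    exact testBit_smul_eq this S
  · rw [heq] at hτ
    exact testBit_smul_eq hτ S

/-- Complementing a family within the `k`-sets does not change its automorphism group. -/
lemma stabilizer_card_diff {v k : ℕ} (𝓑 : Set (Finset (Fin v))) (hk : ∀ S ∈ 𝓑, S.card = k) :
    MulAction.stabilizer (Equiv.Perm (Fin v)) ({S : Finset (Fin v) | S.card = k} \ 𝓑) =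
      MulAction.stabilizer (Equiv.Perm (Fin v)) 𝓑 := by
  ext σ
  rw [MulAction.mem_stabilizer_set, MulAction.mem_stabilizer_set]
  refine forall_congr' fun S => ?_
  by_cases hS : S.card = k
  · simp only [Set.mem_sdiff, Set.mem_ofPred_eq, Finset.card_smul_finset, hS, true_and]
    exact not_iff_not
  · have h1 : σ • S ∉ 𝓑 := fun h => hS (by rw [← hk _ h, Finset.card_smul_finset])
    have h2 : S ∉ 𝓑 := fun h => hS (hk _ h)
    simp [hS, h1, h2]

lemma stabilizer_setOf_card (v k : ℕ) :
    MulAction.stabilizer (Equiv.Perm (Fin v)) {S : Finset (Fin v) | S.card = k} = ⊤ := by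
  rw [eq_top_iff]
  intro σ _
  rw [MulAction.mem_stabilizer_set]
  intro S
  simp

/-! ### The fibration of the 22 points over the 11 points -/

/-- The projection of the 22 points onto the 11 points. -/
def proj (p : Fin 22) : Fin 11 := ⟨p % 11, Nat.mod_lt _ (by norm_num)⟩

/-- The first point over `i`. -/
def lo (i : Fin 11) : Fin 22 := ⟨i, by omega⟩

/-- The second point over `i`. -/
def hi (i : Fin 11) : Fin 22 := ⟨i + 11, by omega⟩

lemma proj_lo (i : Fin 11) : proj (lo i) = i := Fin.ext (Nat.mod_eq_of_lt i.2)
lemma proj_hi (i : Fin 11) : proj (hi i) = i :=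
  Fin.ext (by simp only [proj, hi]; omega)

lemma lo_ne_hi (i j : Fin 11) : lo i ≠ hi j := fun h => by
  have := congrArg Fin.val h
  simp only [lo, hi] at this
  omega

lemma eq_lo_or_hi (p : Fin 22) : p = lo (proj p) ∨ p = hi (proj p) := by
  simp only [Fin.ext_iff, lo, hi, proj]
  omega

/-- The points of the base over which `S` has exactly `c` points. -/
def layer (S : Finset (Fin 22)) (c : ℕ) : Finset (Fin 11) :=
  Finset.univ.filter fun i => (S.filter fun p => proj p = i).card = c

lemma card_fibre (S : Finset (Fin 22)) (i : Fin 11) :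
    (S.filter fun p => proj p = i).card =
      (if lo i ∈ S then 1 else 0) + (if hi i ∈ S then 1 else 0) := by
  have : (S.filter fun p => proj p = i) = ({lo i, hi i} : Finset (Fin 22)).filter (· ∈ S) := by
    ext p
    simp only [Finset.mem_filter, Finset.mem_insert, Finset.mem_singleton]
    constructor
    · rintro ⟨h, rfl⟩
      exact ⟨eq_lo_or_hi p, h⟩
    · rintro ⟨rfl | rfl, h⟩
      exacts [⟨h, proj_lo i⟩, ⟨h, proj_hi i⟩]
  rw [this, Finset.filter_insert, Finset.filter_singleton]
  have := lo_ne_hi i i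
  split_ifs <;> simp_all

lemma mem_layer_two {S : Finset (Fin 22)} {i : Fin 11} :
    i ∈ layer S 2 ↔ lo i ∈ S ∧ hi i ∈ S := by
  rw [layer, Finset.mem_filter, card_fibre]
  by_cases h1 : lo i ∈ S <;> by_cases h2 : hi i ∈ S <;> simp [h1, h2]

lemma mem_layer_one {S : Finset (Fin 22)} {i : Fin 11} :
    i ∈ layer S 1 ↔ (lo i ∈ S ↔ hi i ∉ S) := by
  rw [layer, Finset.mem_filter, card_fibre]
  by_cases h1 : lo i ∈ S <;> by_cases h2 : hi i ∈ S <;> simp [h1, h2]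

lemma card_eq_layers (S : Finset (Fin 22)) :
    S.card = (layer S 1).card + 2 * (layer S 2).card := by
  rw [Finset.card_eq_sum_card_fiberwise (f := proj) (t := Finset.univ) (by simp)]
  rw [layer, layer, Finset.card_filter, Finset.card_filter, Finset.mul_sum,
    ← Finset.sum_add_distrib]
  refine Finset.sum_congr rfl fun i _ => ?_
  have : (S.filter fun p => proj p = i).card ≤ 2 := by
    rw [card_fibre]
    split_ifs <;> simp
  generalize (S.filter fun p => proj p = i).card = n at this ⊢
  interval_cases n <;> rfl

/-- `σ` permutes the fibres of the projection as `τ` permutes the points of the base. -/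
def Lifts (σ : Equiv.Perm (Fin 22)) (τ : Equiv.Perm (Fin 11)) : Prop :=
  ∀ p, proj (σ p) = τ (proj p)

lemma Lifts.layer_smul {σ : Equiv.Perm (Fin 22)} {τ : Equiv.Perm (Fin 11)} (h : Lifts σ τ)
    (S : Finset (Fin 22)) (c : ℕ) : layer (σ • S) c = τ • layer S c := by
  ext i
  obtain ⟨j, rfl⟩ := τ.surjective i
  rw [← Equiv.Perm.smul_def, Finset.smul_mem_smul_finset_iff, layer, layer, Finset.mem_filter,
    Finset.mem_filter]
  have : ((σ • S).filter fun p => proj p = τ • j) = σ • (S.filter fun p => proj p = j) := by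
    ext p
    obtain ⟨q, rfl⟩ := σ.surjective p
    rw [← Equiv.Perm.smul_def, Finset.smul_mem_smul_finset_iff, Finset.mem_filter,
      Finset.mem_filter, Finset.smul_mem_smul_finset_iff, Equiv.Perm.smul_def, h,
      Equiv.Perm.smul_def, τ.injective.eq_iff]
  rw [this, Finset.card_smul_finset]
  simp

lemma Lifts.mul {σ σ' : Equiv.Perm (Fin 22)} {τ τ' : Equiv.Perm (Fin 11)} (h : Lifts σ τ)
    (h' : Lifts σ' τ') : Lifts (σ * σ') (τ * τ') := fun p => by
  rw [Equiv.Perm.mul_apply, h, h', Equiv.Perm.mul_apply]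

lemma Lifts.inv {σ : Equiv.Perm (Fin 22)} {τ : Equiv.Perm (Fin 11)} (h : Lifts σ τ) :
    Lifts σ⁻¹ τ⁻¹ := fun p => by
  apply τ.injective
  rw [← h]
  simp

lemma lifts_rho (g : MathieuM11) : Lifts (R22.ρ g) (R11.ρ g) := by
  let K : Subgroup MathieuM11 :=
    { carrier := {g | Lifts (R22.ρ g) (R11.ρ g)}
      one_mem' := fun p => by simp
      mul_mem' := fun hg hh => by
        rw [Set.mem_ofPred_eq, map_mul, map_mul]; exact Lifts.mul hg hh
      inv_mem' := fun hg => by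
        rw [Set.mem_ofPred_eq, map_inv, map_inv]; exact Lifts.inv hg }
  have hK : K = ⊤ := by
    refine eq_top_of_mem K (fun p => Fin.ext ?_) (fun p => Fin.ext ?_)
    · change (R22.ρ gA p : ℕ) % 11 = R11.ρ gA (proj p)
      rw [R22.fA_one, R11.fA_one]
      change fA22 1 p % 11 = fA11 1 (p % 11)
      revert p; decide +kernel
    · change (R22.ρ gD p : ℕ) % 11 = R11.ρ gD (proj p)
      rw [R22.ρ_gD, R11.ρ_gD]
      change fD22 p % 11 = fD11 (p % 11)
      revert p; decide +kernel
  have : g ∈ K := hK ▸ Subgroup.mem_top g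
  exact this

/-- The permutation of the 22 points that exchanges the points of each fibre over `F`. -/
def flip (F : Finset (Fin 11)) : Equiv.Perm (Fin 22) where
  toFun p := if proj p ∈ F then (if p = lo (proj p) then hi (proj p) else lo (proj p)) else p
  invFun p := if proj p ∈ F then (if p = lo (proj p) then hi (proj p) else lo (proj p)) else p
  left_inv p := by
    by_cases h : proj p ∈ F
    · rcases eq_lo_or_hi p with hp | hp
      · generalize proj p = i at hp h
        subst hp
        simp [proj_lo, proj_hi, h, (lo_ne_hi i i).symm]
      · generalize proj p = i at hp h
        subst hp
        simp [proj_lo, proj_hi, h, (lo_ne_hi i i).symm]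
    · simp [h]
  right_inv p := by
    by_cases h : proj p ∈ F
    · rcases eq_lo_or_hi p with hp | hp
      · generalize proj p = i at hp h
        subst hp
        simp [proj_lo, proj_hi, h, (lo_ne_hi i i).symm]
      · generalize proj p = i at hp h
        subst hp
        simp [proj_lo, proj_hi, h, (lo_ne_hi i i).symm]
    · simp [h]

lemma flip_lo (F : Finset (Fin 11)) (i : Fin 11) : flip F (lo i) =
    if i ∈ F then hi i else lo i := by
  simp [flip, proj_lo]

lemma flip_hi (F : Finset (Fin 11)) (i : Fin 11) : flip F (hi i) =
    if i ∈ F then lo i else hi i := by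
  simp [flip, proj_hi, (lo_ne_hi i i).symm]

lemma lifts_flip (F : Finset (Fin 11)) : Lifts (flip F) 1 := fun p => by
  rcases eq_lo_or_hi p with hp | hp
  · generalize proj p = i at hp
    subst hp
    rw [flip_lo]
    split_ifs <;> simp [proj_lo, proj_hi]
  · generalize proj p = i at hp
    subst hp
    rw [flip_hi]
    split_ifs <;> simp [proj_lo, proj_hi]

/-- A permutation that preserves each fibre exchanges the points of some of the fibres. -/
lemma Lifts.eq_flip {σ : Equiv.Perm (Fin 22)} (h : Lifts σ 1) :
    σ = flip (Finset.univ.filter fun i => σ (lo i) = hi i) := by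
  ext p
  congr 1
  have h1 : ∀ i, σ (lo i) = lo i ∨ σ (lo i) = hi i := fun i => by
    have := eq_lo_or_hi (σ (lo i))
    rwa [h, proj_lo, Equiv.Perm.one_apply] at this
  have h2 : ∀ i, σ (hi i) = lo i ∨ σ (hi i) = hi i := fun i => by
    have := eq_lo_or_hi (σ (hi i))
    rwa [h, proj_hi, Equiv.Perm.one_apply] at this
  have h3 : ∀ i, σ (lo i) ≠ σ (hi i) := fun i hc => lo_ne_hi i i (σ.injective hc)
  rcases eq_lo_or_hi p with hp | hp
  · generalize proj p = i at hp
    subst hp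
    rw [flip_lo]
    rcases h1 i with h | h <;> simp [h, lo_ne_hi]
  · generalize proj p = i at hp
    subst hp
    rw [flip_hi]
    rcases h1 i with h | h <;> rcases h2 i with h' | h' <;> have := h3 i <;>
      simp_all [lo_ne_hi]

/-- The permutation that exchanges the points of every fibre. -/
def swap : Equiv.Perm (Fin 22) := flip Finset.univ

lemma swap_apply (p : Fin 22) : (swap p : ℕ) = (p + 11) % 22 := by
  rcases eq_lo_or_hi p with hp | hp
  · rw [hp, swap, flip_lo]
    simp only [Finset.mem_univ, if_true, lo, hi]
    omega
  · rw [hp, swap, flip_hi]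
    simp only [Finset.mem_univ, if_true, lo, hi]
    omega

lemma swap_mul_self : swap * swap = 1 := by
  ext p
  rw [Equiv.Perm.mul_apply, swap_apply, swap_apply, Equiv.Perm.one_apply]
  omega

lemma swap_comm (g : MathieuM11) : Commute (R22.ρ g) swap := by
  have hK : (Subgroup.centralizer {swap}).comap R22.ρ = ⊤ := by
    refine eq_top_of_mem _ ?_ ?_
    · rw [Subgroup.mem_comap, Subgroup.mem_centralizer_singleton_iff]
      ext p
      rw [Equiv.Perm.mul_apply, Equiv.Perm.mul_apply, R22.fA_one, swap_apply, swap_apply,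
        R22.fA_one]
      change fA22 1 ((p + 11) % 22) = (fA22 1 p + 11) % 22
      revert p; decide +kernel
    · rw [Subgroup.mem_comap, Subgroup.mem_centralizer_singleton_iff]
      ext p
      rw [Equiv.Perm.mul_apply, Equiv.Perm.mul_apply, R22.ρ_gD, swap_apply, swap_apply, R22.ρ_gD]
      change fD22 ((p + 11) % 22) = (fD22 p + 11) % 22
      revert p; decide +kernel
  have : g ∈ (Subgroup.centralizer {swap}).comap R22.ρ := hK ▸ Subgroup.mem_top g
  exact Subgroup.mem_centralizer_singleton_iff.1 this

/-! ### Subsets of the 22 points -/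

/-- The set that contains both points over `X`, and of the points over `Q` the second one or the
first one, depending on whether they lie over `H`. -/
def liftSet (X Q H : Finset (Fin 11)) : Finset (Fin 22) :=
  Finset.univ.filter fun p => proj p ∈ X ∨ (proj p ∈ Q ∧ (proj p ∈ H ↔ p = hi (proj p)))

lemma lo_mem_liftSet {X Q H : Finset (Fin 11)} {i : Fin 11} :
    lo i ∈ liftSet X Q H ↔ i ∈ X ∨ (i ∈ Q ∧ i ∉ H) := by
  simp [liftSet, proj_lo, lo_ne_hi]

lemma hi_mem_liftSet {X Q H : Finset (Fin 11)} {i : Fin 11} :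
    hi i ∈ liftSet X Q H ↔ i ∈ X ∨ (i ∈ Q ∧ i ∈ H) := by
  simp [liftSet, proj_hi]

lemma ext_lo_hi {S T : Finset (Fin 22)} (h1 : ∀ i, lo i ∈ S ↔ lo i ∈ T)
    (h2 : ∀ i, hi i ∈ S ↔ hi i ∈ T) : S = T := by
  ext p
  rcases eq_lo_or_hi p with hp | hp <;> rw [hp]
  exacts [h1 _, h2 _]

lemma liftSet_layer (S : Finset (Fin 22)) :
    liftSet (layer S 2) (layer S 1) ((layer S 1).filter fun i => hi i ∈ S) = S := by
  refine ext_lo_hi (fun i => ?_) fun i => ?_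
  · rw [lo_mem_liftSet, Finset.mem_filter, mem_layer_two, mem_layer_one]
    tauto
  · rw [hi_mem_liftSet, Finset.mem_filter, mem_layer_two, mem_layer_one]
    tauto

lemma disjoint_layers (S : Finset (Fin 22)) : Disjoint (layer S 2) (layer S 1) := by
  rw [Finset.disjoint_left]
  intro i
  rw [mem_layer_two, mem_layer_one]
  tauto

lemma layer_two_liftSet {X Q H : Finset (Fin 11)} : layer (liftSet X Q H) 2 = X := by
  ext i
  rw [mem_layer_two, lo_mem_liftSet, hi_mem_liftSet]
  tauto

lemma layer_one_liftSet {X Q H : Finset (Fin 11)} (h : Disjoint X Q) :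
    layer (liftSet X Q H) 1 = Q := by
  ext i
  rw [mem_layer_one, lo_mem_liftSet, hi_mem_liftSet]
  have : i ∈ X → i ∉ Q := fun h1 => Finset.disjoint_left.1 h h1
  tauto

/-- The sets that contain both points of `r` fibres and one point of `j` further fibres. -/
def setsOfType (r j : ℕ) : Set (Finset (Fin 22)) :=
  {S | (layer S 2).card = r ∧ (layer S 1).card = j}

lemma Lifts.smul_mem_setsOfType {σ : Equiv.Perm (Fin 22)} {τ : Equiv.Perm (Fin 11)}
    (h : Lifts σ τ) {r j : ℕ} {S : Finset (Fin 22)} :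
    σ • S ∈ setsOfType r j ↔ S ∈ setsOfType r j := by
  simp [setsOfType, h.layer_smul]

lemma ncard_setsOfType (r j : ℕ) :
    (setsOfType r j).ncard = Nat.choose 11 r * (Nat.choose (11 - r) j * 2 ^ j) := by
  let A : Finset (Σ _ : Finset (Fin 11), Σ _ : Finset (Fin 11), Finset (Fin 11)) :=
    (Finset.univ.powersetCard r).sigma fun X => (Finset.powersetCard j Xᶜ).sigma fun Q => Q.powerset
  have hA : A.card = Nat.choose 11 r * (Nat.choose (11 - r) j * 2 ^ j) := by
    rw [Finset.card_sigma, Finset.sum_const_nat (m := Nat.choose (11 - r) j * 2 ^ j)]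
    · rw [Finset.card_powersetCard, Finset.card_univ, Fintype.card_fin]
    · intro X hX
      rw [Finset.card_sigma, Finset.sum_const_nat (m := 2 ^ j)]
      · rw [Finset.card_powersetCard, Finset.card_compl, Fintype.card_fin,
          (Finset.mem_powersetCard.1 hX).2]
      · intro Q hQ
        rw [Finset.card_powerset, (Finset.mem_powersetCard.1 hQ).2]
  have hmem : ∀ x, x ∈ A ↔ x.1.card = r ∧ Disjoint x.1 x.2.1 ∧ x.2.1.card = j ∧ x.2.2 ⊆ x.2.1 := by
    intro x
    simp only [A, Finset.mem_sigma, Finset.mem_powersetCard, Finset.mem_powerset,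
      Finset.subset_univ, true_and, Finset.subset_compl_iff_disjoint_left, and_assoc]
  rw [← hA, ← Set.ncard_coe_finset]
  symm
  refine Set.ncard_congr (fun x _ => liftSet x.1 x.2.1 x.2.2) ?_ ?_ ?_
  · intro x hx
    obtain ⟨h1, h2, h3, h4⟩ := (hmem x).1 hx
    exact ⟨by rw [layer_two_liftSet, h1], by rw [layer_one_liftSet h2, h3]⟩
  · rintro ⟨X, Q, H⟩ ⟨X', Q', H'⟩ hx hx' h
    obtain ⟨h1, h2, h3, h4⟩ := (hmem _).1 hx
    obtain ⟨h1', h2', h3', h4'⟩ := (hmem _).1 hx'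
    simp only at h h2 h2' h4 h4'
    have e1 : X = X' := by rw [← layer_two_liftSet (X := X), h, layer_two_liftSet]
    have e2 : Q = Q' := by rw [← layer_one_liftSet h2, h, layer_one_liftSet h2']
    subst e1 e2
    have e3 : H = H' := by
      ext i
      have h5 : hi i ∈ liftSet X Q H ↔ hi i ∈ liftSet X Q H' := by rw [h]
      rw [hi_mem_liftSet, hi_mem_liftSet] at h5
      have : i ∈ X → i ∉ Q := fun h1 => Finset.disjoint_left.1 h2 h1
      have := @h4 i
      have := @h4' i
      tauto
    rw [e3]
  · rintro S ⟨h1, h2⟩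
    refine ⟨⟨layer S 2, layer S 1, (layer S 1).filter fun i => hi i ∈ S⟩, ?_, liftSet_layer S⟩
    exact (hmem _).2 ⟨h1, disjoint_layers S, h2, Finset.filter_subset _ _⟩

/-- The mask of the lift of the sets with masks `x`, `q` and `h`. -/
def liftMask (x q h : ℕ) : ℕ := (x ||| (q ^^^ (q &&& h))) ||| ((x ||| (q &&& h)) <<< 11)

lemma maskSet_liftMask {x q : ℕ} (hx : x < 2 ^ 11) (hq : q < 2 ^ 11) (h : ℕ) :
    maskSet 22 (liftMask x q h) = liftSet (maskSet 11 x) (maskSet 11 q) (maskSet 11 h) := by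
  refine ext_lo_hi (fun i => ?_) fun i => ?_
  · have : ¬ 11 ≤ (i : ℕ) := by omega
    rw [mem_maskSet, lo_mem_liftSet]
    simp only [lo, liftMask, Nat.testBit_or, Nat.testBit_xor, Nat.testBit_and,
      Nat.testBit_shiftLeft, mem_maskSet]
    cases x.testBit i <;> cases q.testBit i <;> cases h.testBit i <;> simp [this]
  · have h1 : x.testBit (i + 11) = false :=
      Nat.testBit_eq_false_of_lt (hx.trans_le (Nat.pow_le_pow_right (by norm_num) (by omega)))
    have h2 : q.testBit (i + 11) = false :=
      Nat.testBit_eq_false_of_lt (hq.trans_le (Nat.pow_le_pow_right (by norm_num) (by omega)))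
    rw [mem_maskSet, hi_mem_liftSet]
    simp only [hi, liftMask, Nat.testBit_or, Nat.testBit_xor, Nat.testBit_and,
      Nat.testBit_shiftLeft, mem_maskSet, h1, h2, Nat.add_sub_cancel]
    cases x.testBit i <;> cases q.testBit i <;> cases h.testBit i <;> simp

/-! ### The order of the Mathieu group and sizes of orbits -/

/-- An element of the Mathieu group that fixes four points is trivial. -/
lemma eq_one_of_fixes_four (g : MathieuM11) (hg : ∀ i : Fin 4, (R11.ρ g (Fin.castLE
    (by norm_num) i) : ℕ) = i) :
    g = 1 := by
  apply R11_injective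
  have h0 : force (R11.orbitMap 61) (rigid 11 R11.act 4 5 [[]]) = true := by decide +kernel
  have h1 := valuesRev_mem_extend_of_preserves (R11.ρ g) (R11.orbitMap 61) 5 (by norm_num)
    (fun S _ => ?_) 4 (by norm_num)
  · have h2 : valuesRev (permNat (R11.ρ g)) 4 = valuesRev id 4 := by
      simp only [valuesRev]
      have h3 : ∀ i : Fin 4, permNat (R11.ρ g) i = i := fun i =>
        (permNat_val (R11.ρ g) (Fin.castLE (by norm_num) i)).trans (hg i)
      have e0 := h3 0
      have e1 := h3 1
      have e2 := h3 2
      have e3 := h3 3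
      simp only [Fin.val_zero, Fin.val_one, Fin.val_two] at e0 e1 e2
      rw [e0, e1, e2]
      rw [show permNat (R11.ρ g) 3 = 3 from e3]
      rfl
    rw [h2] at h1
    obtain ⟨w, hw, hw'⟩ := List.any_eq_true.1 (List.all_eq_true.1 h0 _ h1)
    rw [List.mem_singleton] at hw
    subst hw
    rw [beq_iff_eq] at hw'
    ext p
    have := eq_of_valuesRev_eq hw' p p.2
    rw [permNat_val] at this
    rw [← this, map_one]
    rfl
  · have h2 := R11.range_le_stabilizer (maskSet 11 61) (R11.mem_range g)
    rw [MulAction.mem_stabilizer_set] at h2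
    have h3 := h2 S
    rw [R11.mem_orbit_iff_testBit (by norm_num) isClosed11,
      R11.mem_orbit_iff_testBit (by norm_num) isClosed11] at h3
    rw [Bool.eq_iff_iff]
    exact h3.symm

/-- The Mathieu group is sharply 4-transitive on 11 points. -/
lemma card_M11 : Nat.card MathieuM11 = 7920 := by
  have hle : 4 ≤ 11 := by norm_num
  let f : MathieuM11 → (Fin 4 ↪ Fin 11) := fun g =>
    ⟨fun j => R11.ρ g (Fin.castLE hle j), fun a b h => Fin.castLE_injective hle
      ((R11.ρ g).injective h)⟩
  have hf : Function.Bijective f := by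
    constructor
    · intro g h hgh
      have : g⁻¹ * h = 1 := by
        refine eq_one_of_fixes_four _ fun i => ?_
        have : R11.ρ g (Fin.castLE hle i) = R11.ρ h (Fin.castLE hle i) := DFunLike.congr_fun hgh i
        rw [map_mul, Equiv.Perm.mul_apply, ← this, map_inv, Equiv.Perm.coe_inv,
          Equiv.symm_apply_apply]
        rfl
      exact inv_mul_eq_one.1 this
    · intro t
      obtain ⟨g, hg⟩ := exists_map_eq11 t t.injective
      refine ⟨g⁻¹, DFunLike.ext _ _ fun j => ?_⟩
      change R11.ρ g⁻¹ (Fin.castLE hle j) = t j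
      rw [map_inv, Equiv.Perm.inv_eq_iff_eq]
      exact Fin.ext (hg j).symm
  rw [Nat.card_congr (Equiv.ofBijective f hf), Nat.card_eq_fintype_card, Fintype.card_embedding_eq]
  decide

namespace Rep

variable {v : ℕ} (R : Rep v)

/-- Elements of the stabilizer of a set bound the size of its orbit. -/
lemma ncard_orbit_mul_le (m : ℕ) (words : List (List ℕ))
    (h1 : (words.all fun w => R.mapsMask w m m) = true)
    (h2 : (words.map fun w => valuesRev (R11.act w) 11).Nodup) :
    (R.orbit (maskSet v m)).ncard * words.length ≤ 7920 := by
  let act : MulAction MathieuM11 (Finset (Fin v)) := MulAction.compHom _ R.ρ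
  have h : MulAction.orbit MathieuM11 (maskSet v m) = R.orbit (maskSet v m) := rfl
  rw [← card_M11, ← h, ← MulAction.index_stabilizer,
    ← Subgroup.index_mul_card (MulAction.stabilizer MathieuM11 (maskSet v m))]
  refine Nat.mul_le_mul_left _ ?_
  classical
  have hn : (words.map ev).Nodup := by
    refine List.Nodup.of_map (fun g => valuesRev (permNat (R11.ρ g)) 11) ?_
    rw [List.map_map]
    refine (List.map_congr_left fun w _ => ?_) ▸ h2
    have : ∀ i ≤ 11, valuesRev (R11.act w) i = valuesRev (permNat (R11.ρ (ev w))) i := by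
      intro i
      induction i with
      | zero => intro _; rfl
      | succ i ih =>
        intro hi
        rw [valuesRev, valuesRev, ih (by omega)]
        congr 1
        rw [← R11.ρ_ev w ⟨i, hi⟩, ← permNat_val]
    exact this 11 le_rfl
  have hc : words.length = (words.map ev).toFinset.card := by
    rw [List.toFinset_card_of_nodup hn, List.length_map]
  rw [hc, ← Set.ncard_coe_finset]
  have : Finite MathieuM11 := Nat.finite_of_card_ne_zero (by rw [card_M11]; norm_num)
  refine le_of_le_of_eq (b := (MulAction.stabilizer MathieuM11 (maskSet v m) : Set _).ncard)
    (Set.ncard_le_ncard ?_ (Set.toFinite _)) (Nat.card_coe_set_eq _).symm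
  intro g hg
  rw [List.coe_toFinset, Set.mem_ofPred_eq, List.mem_map] at hg
  obtain ⟨w, hw, rfl⟩ := hg
  exact R.smul_maskSet_of_mapsMask (List.all_eq_true.1 h1 w hw)

end Rep

/-- If finitely many sets cover at least as many points as the sum of bounds for their sizes, then
they attain these bounds and are pairwise disjoint. -/
lemma eq_of_cover {α ι : Type*} [Fintype ι] [DecidableEq ι] [DecidableEq α] (A : ι → Finset α)
    (N : ι → ℕ) (hN : ∀ i, (A i).card ≤ N i) (h : ∑ i, N i ≤ (Finset.univ.biUnion A).card) :
    (∀ i, (A i).card = N i) ∧ ∀ i j, i ≠ j → Disjoint (A i) (A j) := by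
  have h1 := Finset.card_biUnion_le (s := Finset.univ) (t := A)
  have h2 : ∑ i, (A i).card ≤ ∑ i, N i := Finset.sum_le_sum fun i _ => hN i
  refine ⟨fun i => ?_, fun i j hij => ?_⟩
  · exact (Finset.sum_eq_sum_iff_of_le fun i _ => hN i).1 (by omega) i (Finset.mem_univ i)
  · have h3 : ∑ i, (A i).card = (Finset.univ.biUnion A).card := by omega
    by_contra hd
    have h4 : Finset.univ.biUnion A = A i ∪ (Finset.univ.erase i).biUnion A := by
      rw [← Finset.biUnion_insert, Finset.insert_erase (Finset.mem_univ i)]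
    have h5 : (A j) ⊆ (Finset.univ.erase i).biUnion A :=
      Finset.subset_biUnion_of_mem A (Finset.mem_erase.2 ⟨hij.symm, Finset.mem_univ j⟩)
    have h6 := Finset.card_union_add_card_inter (A i) ((Finset.univ.erase i).biUnion A)
    have h7 := Finset.card_biUnion_le (s := Finset.univ.erase i) (t := A)
    have h8 := Finset.add_sum_erase Finset.univ (fun i => (A i).card) (Finset.mem_univ i)
    have h9 : 0 < (A i ∩ (Finset.univ.erase i).biUnion A).card := by
      rw [Finset.card_pos]
      obtain ⟨x, hx1, hx2⟩ := Finset.not_disjoint_iff.1 hd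
      exact ⟨x, Finset.mem_inter.2 ⟨hx1, h5 hx2⟩⟩
    rw [h4] at h3
    omega

/-- Orbits that cover a set are disjoint and as large as allowed by given elements of the
stabilizers, if the resulting bounds add up to the size of the set. Every entry of the list consists
of the mask of a representative and of words for elements of its stabilizer. -/
lemma Rep.orbits_of_cover {v : ℕ} (R : Rep v) (Ω : Set (Finset (Fin v)))
    (l : List (ℕ × List (List ℕ))) (hcov : ∀ S ∈ Ω, ∃ e ∈ l, S ∈ R.orbit (maskSet v e.1))
    (h1 : (l.all fun e => e.2.all fun w => R.mapsMask w e.1 e.1) = true)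
    (h2 : ∀ e ∈ l, (e.2.map fun w => valuesRev (R11.act w) 11).Nodup)
    (h3 : ∀ e ∈ l, e.2 ≠ [])
    (hsum : (l.map fun e => 7920 / e.2.length).sum ≤ Ω.ncard) :
    (∀ e ∈ l, (R.orbit (maskSet v e.1)).ncard = 7920 / e.2.length) ∧
      ∀ e ∈ l, ∀ e' ∈ l, e ≠ e' →
        Disjoint (R.orbit (maskSet v e.1)) (R.orbit (maskSet v e'.1)) := by
  classical
  have hbound : ∀ e ∈ l, (R.orbit (maskSet v e.1)).ncard ≤ 7920 / e.2.length := by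
    intro e he
    rw [Nat.le_div_iff_mul_le (List.length_pos_of_ne_nil (h3 e he))]
    exact R.ncard_orbit_mul_le e.1 e.2 (List.all_eq_true.1 h1 e he) (h2 e he)
  have key := eq_of_cover (fun i : Fin l.length => (R.orbit (maskSet v (l.get i).1)).toFinset)
    (fun i => 7920 / (l.get i).2.length)
    (fun i => by rw [← Set.ncard_eq_toFinset_card']; exact hbound _ (List.get_mem l i)) ?_
  · refine ⟨fun e he => ?_, ?_⟩
    · obtain ⟨i, rfl⟩ := List.get_of_mem he
      rw [← key.1 i, ← Set.ncard_eq_toFinset_card']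
    · intro e he e' he' hne
      obtain ⟨i, rfl⟩ := List.get_of_mem he
      obtain ⟨j, rfl⟩ := List.get_of_mem he'
      exact Set.disjoint_toFinset.1 (key.2 i j fun hij => hne (by rw [hij]))
  · have e1 : ∑ i : Fin l.length, 7920 / (l.get i).2.length =
        (l.map fun e => 7920 / e.2.length).sum := by
      rw [← List.sum_ofFn]
      congr 1
      conv_rhs => rw [← List.ofFn_get l, List.map_ofFn]
      rfl
    rw [e1]
    refine hsum.trans ?_
    rw [← Set.ncard_coe_finset]
    refine Set.ncard_le_ncard (fun S hS => ?_) (Set.toFinite _)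
    obtain ⟨e, he, hSe⟩ := hcov S hS
    obtain ⟨i, rfl⟩ := List.get_of_mem he
    simp only [Finset.coe_biUnion, Finset.coe_univ, Set.mem_univ, Set.iUnion_true, Set.mem_iUnion,
      Finset.mem_coe, Set.mem_toFinset]
    exact ⟨i, hSe⟩

/-! ### Orbits on subsets of the 22 points -/

/-- Any at most four distinct points, listed in `l`, can be moved to the first points. -/
lemma exists_map_list (l : List (Fin 11)) (hl : l.Nodup) (h4 : l.length ≤ 4) :
    ∃ g, ∀ i : Fin l.length, (R11.ρ g (l.get i) : ℕ) = i := by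
  have h : isChain 11 R11.act 0 (chain11.take l.length) = true := by
    have : ∀ n ≤ 4, isChain 11 R11.act 0 (chain11.take n) = true := by decide +kernel
    exact this _ h4
  obtain ⟨_, ⟨g, rfl⟩, hg⟩ := exists_map_eq_of_isChain R11.range R11.act R11.exists_mem_range
    (chain11.take l.length) (by rw [List.length_take, Nat.min_eq_left]; exact h4) h l.get
    hl.injective_get
  exact ⟨g, hg⟩

/-- Two disjoint sets with at most four points in total can be moved to given sets. -/
lemma exists_smul_eq_of_card (A B : Finset (Fin 11)) (hd : Disjoint A B) (x q r j : ℕ)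
    (hA : A.card = r) (hB : B.card = j) (h4 : r + j ≤ 4) (hx : popcount x 11 = r)
    (hq : popcount q 11 = j) (hx' : ∀ i < r, x.testBit i = true)
    (hq' : ∀ i < j, q.testBit (r + i) = true) :
    ∃ g, R11.ρ g • A = maskSet 11 x ∧ R11.ρ g • B = maskSet 11 q := by
  have hlA : A.toList.length = r := by rw [Finset.length_toList, hA]
  have hlB : B.toList.length = j := by rw [Finset.length_toList, hB]
  obtain ⟨g, hg⟩ := exists_map_list (A.toList ++ B.toList)
    (List.Nodup.append A.nodup_toList B.nodup_toList fun a h1 h2 =>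
      Finset.disjoint_left.1 hd (Finset.mem_toList.1 h1) (Finset.mem_toList.1 h2))
    (by rw [List.length_append, hlA, hlB]; exact h4)
  refine ⟨g, Finset.eq_of_subset_of_card_le ?_ ?_, Finset.eq_of_subset_of_card_le ?_ ?_⟩
  · intro y hy
    obtain ⟨a, ha, rfl⟩ := Finset.mem_smul_finset.1 hy
    obtain ⟨i, hi, rfl⟩ := List.getElem_of_mem (Finset.mem_toList.2 ha)
    have := hg ⟨i, by rw [List.length_append]; omega⟩
    rw [List.get_eq_getElem, List.getElem_append_left hi] at this
    rw [mem_maskSet, Equiv.Perm.smul_def, this]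
    exact hx' i (by omega)
  · rw [Finset.card_smul_finset, card_maskSet, hx, hA]
  · intro y hy
    obtain ⟨b, hb, rfl⟩ := Finset.mem_smul_finset.1 hy
    obtain ⟨i, hi, rfl⟩ := List.getElem_of_mem (Finset.mem_toList.2 hb)
    have := hg ⟨r + i, by rw [List.length_append]; omega⟩
    rw [List.get_eq_getElem,
      List.getElem_append_right (by simp only [hlA]; exact Nat.le_add_right _ _)] at this
    simp only [hlA, Nat.add_sub_cancel_left] at this
    rw [mem_maskSet, Equiv.Perm.smul_def, this]
    exact hq' i (by omega)
  · rw [Finset.card_smul_finset, card_maskSet, hq, hB]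

/-- Whether every lift of the sets with masks `x` and `q` is moved to one of the sets in `reps` by
an element spelled by one of the words. -/
noncomputable def liftsCovered (x q : ℕ) (words : List (List ℕ)) (reps : List ℕ) : Bool :=
  (List.range 2048).all fun h => h &&& q != h ||
    words.any fun w => reps.elem (imgMask (R22.act w) (liftMask x q h) 22)

lemma exists_mem_orbit_of_liftsCovered {x q : ℕ} {words : List (List ℕ)} {reps : List ℕ}
    (hx : x < 2 ^ 11) (hq : q < 2 ^ 11) (h : liftsCovered x q words reps = true)
    (S : Finset (Fin 22)) (hS2 : layer S 2 = maskSet 11 x) (hS1 : layer S 1 = maskSet 11 q) :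
    ∃ m ∈ reps, S ∈ R22.orbit (maskSet 22 m) := by
  have h1 := liftSet_layer S
  set H := (layer S 1).filter fun i => hi i ∈ S with hH
  rw [hS2, hS1, ← maskSet_toMask H, ← maskSet_liftMask hx hq] at h1
  have h2 := List.all_eq_true.1 h (toMask H) (List.mem_range.2 (toMask_lt H))
  have h3 : toMask H &&& q = toMask H := by
    have := Finset.filter_subset (fun i => hi i ∈ S) (layer S 1)
    rw [← hH, hS1] at this
    apply Nat.eq_of_testBit_eq
    intro i
    rw [Nat.testBit_and]
    by_cases hi : i < 11
    · have h4 := @this ⟨i, hi⟩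
      have h5 := testBit_toMask H ⟨i, hi⟩
      rw [mem_maskSet] at h4
      simp only at h4 h5
      rw [h5]
      by_cases h6 : (⟨i, hi⟩ : Fin 11) ∈ H
      · rw [h4 h6, Bool.and_true]
      · rw [decide_eq_false h6, Bool.false_and]
    · rw [testBit_toMask_of_le _ (by omega), Bool.false_and]
  rw [h3, bne_self_eq_false, Bool.false_or] at h2
  obtain ⟨w, -, hw⟩ := List.any_eq_true.1 h2
  rw [List.elem_eq_contains, List.contains_iff_mem] at hw
  refine ⟨_, hw, ?_⟩
  have h5 : maskSet 22 (imgMask (R22.act w) (liftMask x q (toMask H)) 22) = R22.ρ (ev w) • S := by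
    rw [maskSet_imgMask _ (R22.ρ (ev w)) (R22.ρ_ev w), h1]
  rw [h5]
  exact R22.mem_orbit_comm.1 ((R22.smul_mem_orbit_iff _ _ _).2 (R22.self_mem_orbit S))

/-- The orbits on the sets of a type that fixes at most four points of the base. -/
lemma exists_mem_orbit_of_type {x q r j : ℕ} {words : List (List ℕ)} {reps : List ℕ}
    (hxq : x < 2 ^ 11 ∧ q < 2 ^ 11) (h4 : r + j ≤ 4) (hc : popcount x 11 = r ∧ popcount q 11 = j)
    (hx' : ∀ i < r, x.testBit i = true) (hq' : ∀ i < j, q.testBit (r + i) = true)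
    (h : liftsCovered x q words reps = true) (S : Finset (Fin 22)) (hS : S ∈ setsOfType r j) :
    ∃ m ∈ reps, S ∈ R22.orbit (maskSet 22 m) := by
  obtain ⟨g, hg2, hg1⟩ := exists_smul_eq_of_card (layer S 2) (layer S 1)
    (disjoint_layers S) x q r j hS.1 hS.2 h4 hc.1 hc.2 hx' hq'
  obtain ⟨m, hm, h⟩ := exists_mem_orbit_of_liftsCovered hxq.1 hxq.2 h (R22.ρ g • S)
    (by rw [(lifts_rho g).layer_smul, hg2]) (by rw [(lifts_rho g).layer_smul, hg1])
  exact ⟨m, hm, (R22.smul_mem_orbit_iff g _ _).1 h⟩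

/-! ### Orbits on the lifted 5-sets with one full fibre -/

/-- Representatives, given by masks, of the orbits on the pairs of a point and a 5-set of the base
that does not contain it. -/
def pairReps : List (ℕ × ℕ) := [(16, 527), (32, 31), (64, 31)]

/-- Words that move every pair of a point and a 5-set that contains the first four points to one of
the representatives. -/
def pairWords : List (List ℕ) :=
  [[], [8, 8, 4], [1, 0, 8, 1], [1, 6, 10, 2], [2, 5, 8, 3], [2, 10, 6, 2], [5, 5], [6, 5],
    [0, 0, 0], [1, 9, 7], [4, 8, 0], [5, 10, 5], [6, 9, 3], [7, 4, 7], [9, 8, 4], [10, 6, 5],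
    [0, 8, 5, 3], [0, 9, 9, 0], [1, 7, 0, 5], [1, 8, 2, 1], [1, 8, 5, 0], [2, 8, 9, 1],
    [3, 0, 9, 0], [3, 2, 8, 10], [3, 7, 10, 6], [5, 2, 8, 4], [7, 6, 3, 4], [7, 8, 5, 4],
    [8, 9, 3, 0], [10, 0, 7, 5]]

/-- Words for the stabilizers of the pairs in `pairReps`. -/
def pairStabilizer : Fin 3 → List (List ℕ) :=
  ![[[], [5, 5], [10, 1, 10], [2, 3, 1, 0], [3, 2, 0, 1], [3, 8, 7, 3], [3, 9, 9, 4],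
      [3, 10, 9, 2], [5, 1, 7, 0], [6, 7, 2, 2], [6, 8, 8, 1], [6, 9, 3, 0], [8, 7, 10, 0],
      [9, 9, 0, 0], [10, 9, 9, 0], [1, 7, 0, 5, 0], [3, 1, 4, 1, 0], [4, 3, 0, 1, 0],
      [4, 7, 3, 2, 0], [4, 10, 6, 3, 1]],
    [[], [7, 7], [2, 2, 0, 0], [5, 2, 0, 3]],
    [[], [5, 5], [7, 7], [6, 9, 3], [1, 7, 0, 5], [2, 2, 0, 0], [3, 7, 10, 6], [3, 9, 9, 4],
      [5, 2, 0, 3], [6, 6, 4, 0], [6, 10, 1, 4], [9, 5, 7, 2], [9, 9, 2, 3], [10, 6, 5, 0],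
      [10, 8, 7, 10], [10, 9, 9, 0], [10, 10, 0, 2], [0, 9, 9, 0, 0], [2, 8, 0, 1, 0],
      [5, 2, 8, 4, 0]]]

/-- The masks of base blocks of the twelve designs on 22 points. -/
def mask22 : Fin 12 → ℕ :=
  ![59922, 37405, 84022, 131167, 33311, 71740, 69693, 159825, 94257, 90163, 133214, 67646]

/-- The index in `pairReps` of the pair of the point and the 5-set of the base over which a base
block contains two points and one point. -/
def pairIndex : Fin 12 → Fin 3 := ![0, 0, 1, 2, 0, 1, 1, 2, 1, 1, 2, 1]

/-- The numbers of blocks of the twelve designs. -/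
def size22 : Fin 12 → ℕ :=
  ![396, 1980, 3960, 3960, 3960, 7920, 7920, 792, 3960, 3960, 3960, 7920]

/-- The mask of the image under `swap`. -/
def swapMask (m : ℕ) : ℕ := imgMask (fun p => (p + 11) % 22) m 22

lemma maskSet_swapMask (m : ℕ) : maskSet 22 (swapMask m) = swap • maskSet 22 m :=
  maskSet_imgMask _ _ swap_apply m

/-- The designs that are not invariant under `swap`. -/
def swapped : List (Fin 12) := [0, 1, 2, 3, 4, 5, 6, 11]

/-- Representatives of the orbits on the sets with one full fibre and one point of five others:
the base blocks, and their images under `swap` where these lie in other orbits. Each comes with its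
pair of a point and a 5-set. -/
def reps22 : List (ℕ × Fin 3) :=
  (List.finRange 12).map (fun i => (mask22 i, pairIndex i)) ++
    swapped.map fun i => (swapMask (mask22 i), pairIndex i)

lemma exists_mem_orbit_of_pairRep (k : Fin 3) (S : Finset (Fin 22))
    (h2 : layer S 2 = maskSet 11 (pairReps.get k).1)
    (h1 : layer S 1 = maskSet 11 (pairReps.get k).2) :
    ∃ m ∈ reps22.map Prod.fst, S ∈ R22.orbit (maskSet 22 m) := by
  have h : liftsCovered (pairReps.get k).1 (pairReps.get k).2 (pairStabilizer k)
      (reps22.map Prod.fst) = true := by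
    clear h1 h2; revert k; decide +kernel
  refine exists_mem_orbit_of_liftsCovered ?_ ?_ h S h2 h1
  · clear h h1 h2; revert k; decide +kernel
  · clear h h1 h2; revert k; decide +kernel

lemma exists_mem_orbit_reps22 (S : Finset (Fin 22)) (hS : S ∈ setsOfType 1 5) :
    ∃ m ∈ reps22.map Prod.fst, S ∈ R22.orbit (maskSet 22 m) := by
  obtain ⟨A, hA, hA4⟩ := Finset.exists_subset_card_eq (s := layer S 1) (n := 4)
    (by rw [hS.2]; norm_num)
  obtain ⟨g, hgA, -⟩ := exists_smul_eq_of_card A ∅ (Finset.disjoint_empty_right A) 15 0 4 0 hA4 rfl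
    (by norm_num) (by decide) (by decide) (by decide) (by decide)
  set T := R22.ρ g • S with hT
  have hT2 : layer T 2 = R11.ρ g • layer S 2 := (lifts_rho g).layer_smul S 2
  have hT1 : layer T 1 = R11.ρ g • layer S 1 := (lifts_rho g).layer_smul S 1
  have hsub : maskSet 11 15 ⊆ layer T 1 := by
    rw [hT1, ← hgA]
    exact Finset.smul_finset_subset_smul_finset hA
  obtain ⟨p, hp⟩ : ∃ p, layer T 1 \ maskSet 11 15 = {p} := by
    rw [← Finset.card_eq_one, Finset.card_sdiff_of_subset hsub, hT1, Finset.card_smul_finset, hS.2]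
    decide
  obtain ⟨x, hx⟩ : ∃ x, layer T 2 = {x} := by
    rw [← Finset.card_eq_one, hT2, Finset.card_smul_finset, hS.1]
  have hp' : p ∈ layer T 1 ∧ p ∉ maskSet 11 15 := by
    rw [← Finset.mem_sdiff, hp]; exact Finset.mem_singleton_self p
  have hx1 : x ∉ layer T 1 := by
    exact Finset.disjoint_left.1 (disjoint_layers T) (by rw [hx]; exact Finset.mem_singleton_self x)
  have hxp : x ≠ p := fun h => hx1 (h ▸ hp'.1)
  have hx15 : x ∉ maskSet 11 15 := fun h => hx1 (hsub h)
  have h1 : layer T 1 = maskSet 11 (15 ||| 1 <<< (p : ℕ)) := by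
    rw [← Finset.sdiff_union_of_subset hsub, hp]
    ext i
    simp only [Finset.mem_union, Finset.mem_singleton, mem_maskSet, Nat.testBit_or,
      testBit_one_shiftLeft, Bool.or_eq_true, decide_eq_true_eq, Fin.ext_iff]
    tauto
  have h2 : layer T 2 = maskSet 11 (1 <<< (x : ℕ)) := by
    rw [hx]
    ext i
    simp only [Finset.mem_singleton, mem_maskSet, testBit_one_shiftLeft, decide_eq_true_eq,
      Fin.ext_iff]
    tauto
  have hw : ∀ p x : Fin 11, p ∉ maskSet 11 15 → x ∉ maskSet 11 15 → x ≠ p →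
      ∃ w ∈ pairWords, ∃ k, imgMask (R11.act w) (1 <<< (x : ℕ)) 11 = (pairReps.get k).1 ∧
        imgMask (R11.act w) (15 ||| 1 <<< (p : ℕ)) 11 = (pairReps.get k).2 := by
    decide +kernel
  obtain ⟨w, -, k, hk1, hk2⟩ := hw p x hp'.2 hx15 hxp
  obtain ⟨m, hm, h⟩ := exists_mem_orbit_of_pairRep k (R22.ρ (ev w) • T)
    (by rw [(lifts_rho _).layer_smul, h2, ← hk1, maskSet_imgMask _ _ (R11.ρ_ev w)])
    (by rw [(lifts_rho _).layer_smul, h1, ← hk2, maskSet_imgMask _ _ (R11.ρ_ev w)])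
  rw [R22.smul_mem_orbit_iff, hT, R22.smul_mem_orbit_iff] at h
  exact ⟨m, hm, h⟩

/-- The stabilizers within the stabilizers of the pairs bound the sizes of the orbits. -/
noncomputable def repWords (e : ℕ × Fin 3) : List (List ℕ) :=
  (pairStabilizer e.2).filter fun w => R22.mapsMask w e.1 e.1

lemma orbits22 :
    (∀ e ∈ reps22, (R22.orbit (maskSet 22 e.1)).ncard = 7920 / (repWords e).length) ∧
      ∀ e ∈ reps22, ∀ e' ∈ reps22, e.1 ≠ e'.1 →
        Disjoint (R22.orbit (maskSet 22 e.1)) (R22.orbit (maskSet 22 e'.1)) := by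
  have h := R22.orbits_of_cover (setsOfType 1 5) (reps22.map fun e => (e.1, repWords e))
    (fun S hS => by
      obtain ⟨m, hm, h⟩ := exists_mem_orbit_reps22 S hS
      obtain ⟨e, he, rfl⟩ := List.mem_map.1 hm
      exact ⟨_, List.mem_map.2 ⟨e, he, rfl⟩, h⟩)
    (by decide +kernel) (by decide +kernel) (by decide +kernel)
    (by rw [ncard_setsOfType]; decide +kernel)
  refine ⟨fun e he => h.1 (e.1, repWords e) (List.mem_map.2 ⟨e, he, rfl⟩),
    fun e he e' he' hne => h.2 (e.1, repWords e) (List.mem_map.2 ⟨e, he, rfl⟩) (e'.1, repWords e')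
      (List.mem_map.2 ⟨e', he', rfl⟩) fun hc => hne (Prod.mk.inj hc).1⟩

/-- The family of blocks of the `i`-th design on 22 points. -/
noncomputable def blocks22 (i : Fin 12) : Set (Finset (Fin 22)) :=
  R22.orbit (maskSet 22 (mask22 i))

lemma ncard_blocks22 (i : Fin 12) : (blocks22 i).ncard = size22 i := by
  rw [blocks22, orbits22.1 (mask22 i, pairIndex i) (by
    rw [reps22, List.mem_append]
    exact Or.inl (List.mem_map.2 ⟨i, List.mem_finRange i, rfl⟩))]
  revert i; decide +kernel

lemma mem_reps22 (i : Fin 12) : (mask22 i, pairIndex i) ∈ reps22 :=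
  List.mem_append.2 (Or.inl (List.mem_map.2 ⟨i, List.mem_finRange i, rfl⟩))

lemma eq_of_mem_blocks22 {i j : Fin 12} (h : maskSet 22 (mask22 i) ∈ blocks22 j) : i = j := by
  by_contra hne
  have h1 : ∀ i j : Fin 12, i ≠ j → mask22 i ≠ mask22 j := by decide +kernel
  exact Set.disjoint_left.1 (orbits22.2 _ (mem_reps22 i) _ (mem_reps22 j) (h1 i j hne))
    (R22.self_mem_orbit _) h

lemma swap_mem_blocks22 (i : Fin 12) (h : 7 ≤ (i : ℕ) ∧ (i : ℕ) ≤ 10) :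
    swap • maskSet 22 (mask22 i) ∈ blocks22 i := by
  have : ∀ i : Fin 12, 7 ≤ (i : ℕ) ∧ (i : ℕ) ≤ 10 →
      ∃ w ∈ pairStabilizer (pairIndex i), R22.mapsMask w (mask22 i) (swapMask (mask22 i)) =
      true := by
    decide +kernel
  obtain ⟨w, -, hw⟩ := this i h
  rw [← maskSet_swapMask]
  exact ⟨ev w, R22.smul_maskSet_of_mapsMask hw⟩

/-- Of the twelve designs only four are invariant under `swap`, and the image of a block of one of
the others is not a block of any of the twelve. -/
lemma eq_of_swap_mem_blocks22 {i j : Fin 12} (h : swap • maskSet 22 (mask22 i) ∈ blocks22 j) :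
    i = j ∧ 7 ≤ (i : ℕ) ∧ (i : ℕ) ≤ 10 := by
  by_cases hi : 7 ≤ (i : ℕ) ∧ (i : ℕ) ≤ 10
  · refine ⟨eq_of_mem_blocks22 ?_, hi⟩
    have h1 := R22.orbit_eq_of_mem (swap_mem_blocks22 i hi)
    rw [R22.orbit_eq_of_mem h] at h1
    rw [blocks22, h1]
    exact R22.self_mem_orbit _
  · exfalso
    have h1 : ∀ i : Fin 12, ¬ (7 ≤ (i : ℕ) ∧ (i : ℕ) ≤ 10) → i ∈ swapped := by decide
    have h2 : ∀ i ∈ swapped, ∀ j, swapMask (mask22 i) ≠ mask22 j := by decide +kernel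
    have h3 : (swapMask (mask22 i), pairIndex i) ∈ reps22 :=
      List.mem_append.2 (Or.inr (List.mem_map.2 ⟨i, h1 i hi, rfl⟩))
    rw [← maskSet_swapMask] at h
    exact Set.disjoint_left.1 (orbits22.2 _ h3 _ (mem_reps22 j) (h2 i (h1 i hi) j))
      (R22.self_mem_orbit _) h

/-- Up to `swap`, every set with one full fibre and one point of five others is a block of one of
the twelve designs. -/
lemma exists_mem_blocks22 (S : Finset (Fin 22)) (hS : S ∈ setsOfType 1 5) :
    ∃ i, S ∈ blocks22 i ∨ swap • S ∈ blocks22 i := by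
  obtain ⟨m, hm, h⟩ := exists_mem_orbit_reps22 S hS
  obtain ⟨e, he, rfl⟩ := List.mem_map.1 hm
  rw [reps22, List.mem_append, List.mem_map, List.mem_map] at he
  rcases he with ⟨i, -, rfl⟩ | ⟨i, -, rfl⟩
  · exact ⟨i, Or.inl h⟩
  · refine ⟨i, Or.inr ?_⟩
    obtain ⟨g, rfl⟩ := h
    refine ⟨g, ?_⟩
    rw [maskSet_swapMask, smul_smul, smul_smul, ← (swap_comm g).eq, mul_assoc, swap_mul_self,
      mul_one]

/-! ### Counting the subsets of a block -/

/-- The number of sets with mask in `Q` that consist of the set with mask `acc` and `k` elements of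
the list. -/
def countSub {v : ℕ} (Q : ℕ → Bool) : List (Fin v) → ℕ → ℕ → ℕ
  | _, 0, acc => bif Q acc then 1 else 0
  | [], _ + 1, _ => 0
  | a :: l, k + 1, acc =>
    force (acc ||| 1 <<< (a : ℕ)) fun acc' => countSub Q l k acc' + countSub Q l (k + 1) acc

lemma card_filter_powersetCard {v : ℕ} (Q : ℕ → Bool) : ∀ (l : List (Fin v)), l.Nodup →
    ∀ (k : ℕ) (T : Finset (Fin v)),
      ((l.toFinset.powersetCard k).filter fun U => Q (toMask (U ∪ T)) = true).card =
        countSub Q l k (toMask T) := by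
  intro l
  induction l with
  | nil =>
    intro _ k T
    cases k with
    | zero =>
      rw [Finset.powersetCard_zero, Finset.filter_singleton, Finset.empty_union, countSub]
      cases Q (toMask T) <;> simp
    | succ k => simp [countSub]
  | cons a l ih =>
    intro hl k T
    rw [List.nodup_cons] at hl
    cases k with
    | zero =>
      rw [Finset.powersetCard_zero, Finset.filter_singleton, Finset.empty_union, countSub]
      cases Q (toMask T) <;> simp
    | succ k =>
      have ha : a ∉ l.toFinset := by simpa using hl.1
      rw [List.toFinset_cons, Finset.powersetCard_succ_insert ha, Finset.filter_union,
        Finset.card_union_of_disjoint, ih hl.2, countSub, force_eq, ← toMask_insert,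
        ← ih hl.2 k (insert a T),
        Finset.filter_image, add_comm]
      · congr 1
        rw [Finset.card_image_of_injOn]
        · simp only [Finset.insert_union, Finset.union_insert]
        · intro U hU V hV h
          have h1 : a ∉ U := fun hc => ha ((Finset.mem_powersetCard.1
            (Finset.mem_filter.1 hU).1).1 hc)
          have h2 : a ∉ V := fun hc => ha ((Finset.mem_powersetCard.1
            (Finset.mem_filter.1 hV).1).1 hc)
          rw [← Finset.erase_insert h1, ← Finset.erase_insert h2]
          exact congrArg (fun S => Finset.erase S a) h
      · rw [Finset.disjoint_left]
        intro U hU hU'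
        obtain ⟨V, -, rfl⟩ := Finset.mem_image.1 (Finset.mem_filter.1 hU').1
        exact ha ((Finset.mem_powersetCard.1 (Finset.mem_filter.1 hU).1).1
          (Finset.mem_insert_self a V))

lemma ncard_subsets_eq_countSub {v k m : ℕ} (𝓣 : Set (Finset (Fin v))) (Q : ℕ → Bool)
    (h : ∀ U, U ∈ 𝓣 ↔ U.card = k ∧ Q (toMask U) = true) :
    {U | U ∈ 𝓣 ∧ U ⊆ maskSet v m}.ncard =
      countSub Q ((List.finRange v).filter fun p => m.testBit p) k 0 := by
  rw [← toMask_empty (n := v), ← card_filter_powersetCard Q _ ((List.nodup_finRange v).filter _),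
    ← Set.ncard_coe_finset]
  congr 1
  ext U
  have : ((List.finRange v).filter fun p : Fin v => m.testBit p).toFinset = maskSet v m := by
    ext p; simp
  rw [this]
  simp only [Set.mem_ofPred_eq, h, Finset.coe_filter, Finset.mem_powersetCard, Finset.union_empty]
  tauto

lemma layer_two_maskSet (t : ℕ) : layer (maskSet 22 t) 2 = maskSet 11 (t &&& (t >>> 11)) := by
  ext i
  simp [mem_layer_two, lo, hi, Nat.testBit_shiftRight, add_comm]

lemma layer_one_maskSet (t : ℕ) : layer (maskSet 22 t) 1 = maskSet 11 (t ^^^ (t >>> 11)) := by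
  ext i
  rw [mem_layer_one, mem_maskSet, mem_maskSet, mem_maskSet, Nat.testBit_xor, Nat.testBit_shiftRight]
  simp only [lo, hi, add_comm 11]
  cases t.testBit i <;> cases t.testBit (i + 11) <;> simp

/-- Whether the set with mask `t` contains both points of `r` fibres and one point of `j` further
fibres. -/
def typeMask (r j t : ℕ) : Bool :=
  popcount (t &&& (t >>> 11)) 11 == r && popcount (t ^^^ (t >>> 11)) 11 == j

lemma maskSet_mem_setsOfType {r j t : ℕ} :
    maskSet 22 t ∈ setsOfType r j ↔ typeMask r j t = true := by
  rw [typeMask, Bool.and_eq_true, beq_iff_eq, beq_iff_eq, ← card_maskSet, ← card_maskSet,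
    ← layer_two_maskSet, ← layer_one_maskSet]
  rfl

lemma mem_setsOfType_iff {r j : ℕ} {S : Finset (Fin 22)} :
    S ∈ setsOfType r j ↔ typeMask r j (toMask S) = true := by
  rw [← maskSet_mem_setsOfType, maskSet_toMask]

lemma card_of_mem_setsOfType {r j : ℕ} {S : Finset (Fin 22)} (h : S ∈ setsOfType r j) :
    S.card = j + 2 * r := by
  rw [card_eq_layers, h.1, h.2]

/-- The group is transitive on the sets of four small types. -/
lemma exists_orbit_of_type (r j : ℕ) (h : (r, j) ∈ [(1, 0), (0, 2), (1, 1), (1, 2)]) :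
    ∃ T₀, ∀ T ∈ setsOfType r j, T ∈ R22.orbit T₀ := by
  have key : ∀ x q m words, (x < 2 ^ 11 ∧ q < 2 ^ 11) → r + j ≤ 4 →
      (popcount x 11 = r ∧ popcount q 11 = j) → (∀ i < r, x.testBit i = true) →
      (∀ i < j, q.testBit (r + i) = true) → liftsCovered x q words [m] = true →
      ∃ T₀, ∀ T ∈ setsOfType r j, T ∈ R22.orbit T₀ := by
    intro x q m words h1 h2 h3 h4 h5 h6
    refine ⟨maskSet 22 m, fun T hT => ?_⟩
    obtain ⟨m', hm', h⟩ := exists_mem_orbit_of_type h1 h2 h3 h4 h5 h6 T hT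
    rw [List.mem_singleton] at hm'
    rwa [hm'] at h
  simp only [List.mem_cons, List.not_mem_nil, or_false, Prod.mk.injEq] at h
  rcases h with ⟨rfl, rfl⟩ | ⟨rfl, rfl⟩ | ⟨rfl, rfl⟩ | ⟨rfl, rfl⟩
  · exact key 1 0 (liftMask 1 0 0) [[]] (by decide) (by decide) (by decide) (by decide) (by decide)
      (by decide +kernel)
  · exact key 0 3 3 [[], [1, 6], [3, 5], [2, 0, 7]] (by decide) (by decide) (by decide) (by decide)
      (by decide) (by decide +kernel)
  · exact key 1 2 (liftMask 1 2 0) [[], [0, 3, 10]] (by decide) (by decide) (by decide) (by decide)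
      (by decide) (by decide +kernel)
  · exact key 1 6 (liftMask 1 6 0) [[], [7, 8, 4], [10, 9, 7], [5, 6, 10, 1]] (by decide)
      (by decide)
      (by decide) (by decide) (by decide) (by decide +kernel)

lemma smul_mem_setsOfType (g : MathieuM11) {r j : ℕ} (S : Finset (Fin 22)) :
    R22.ρ g • S ∈ setsOfType r j ↔ S ∈ setsOfType r j := (lifts_rho g).smul_mem_setsOfType

/-- The number of blocks of an orbit that contain a set of one of four small types. -/
lemma ncard_type_mul_blockCount {r j : ℕ} (h : (r, j) ∈ [(1, 0), (0, 2), (1, 1), (1, 2)])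
    (S T : Finset (Fin 22)) (hT : T ∈ setsOfType r j) :
    (setsOfType r j).ncard * blockCount (R22.orbit S) T =
      (R22.orbit S).ncard * {U | U ∈ setsOfType r j ∧ U ⊆ S}.ncard := by
  obtain ⟨T₀, hT₀⟩ := exists_orbit_of_type r j h
  have hc : ∀ T ∈ setsOfType r j, blockCount (R22.orbit S) T = blockCount (R22.orbit S) T₀ := by
    intro T hT
    obtain ⟨g, rfl⟩ := hT₀ T hT
    exact R22.blockCount_smul g S T₀
  rw [hc T hT]
  refine ncard_mul_eq_ncard_mul _ _ _ _ hc ?_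
  rintro _ ⟨g, rfl⟩
  exact R22.ncard_subsets_smul _ g (smul_mem_setsOfType g) S

/-- The numbers of blocks of the twelve designs that contain a set of one of four small types. -/
lemma blockCount_of_type {r j n : ℕ}
    (h : (r, j, n) ∈ [(1, 0, 1), (0, 2, 20), (1, 1, 5), (1, 2, 10)]) (i : Fin 12)
    (T : Finset (Fin 22)) (hT : T ∈ setsOfType r j) :
    (setsOfType r j).ncard * blockCount (blocks22 i) T = size22 i * n := by
  rw [blocks22, ncard_type_mul_blockCount _ _ _ hT]
  · congr 1
    · exact ncard_blocks22 i
    · rw [ncard_subsets_eq_countSub (k := j + 2 * r) _ (typeMask r j) fun U =>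
        ⟨fun hU => ⟨card_of_mem_setsOfType hU, mem_setsOfType_iff.1 hU⟩,
          fun hU => mem_setsOfType_iff.2 hU.2⟩]
      have : ∀ x ∈ [(1, 0, 1), (0, 2, 20), (1, 1, 5), (1, 2, 10)], ∀ i : Fin 12,
          countSub (typeMask x.1 x.2.1)
            ((List.finRange 22).filter fun p => (mask22 i).testBit p) (x.2.1 + 2 * x.1) 0 =
              x.2.2 := by
        decide +kernel
      exact this _ h i
  · have : ∀ x ∈ [(1, 0, 1), (0, 2, 20), (1, 1, 5), (1, 2, 10)],
        (x.1, x.2.1) ∈ [(1, 0), (0, 2), (1, 1), (1, 2)] := by decide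
    exact this _ h

/-! ### Orbits on the lifts of 3-sets and 4-sets -/

/-- `T` is contained in one of the lifted blocks of the Steiner system. -/
def Pos (T : Finset (Fin 22)) : Prop := ∃ x ∈ pairFamily 22 pairs22, T ⊆ x.1

lemma pos_smul (g : MathieuM11) (T : Finset (Fin 22)) : Pos (R22.ρ g • T) ↔ Pos T := by
  constructor
  · rintro ⟨⟨L, Q⟩, h, hT⟩
    refine ⟨(R22.ρ g⁻¹ • L, g⁻¹ • Q), (R22_preservesPairs g⁻¹ L Q).2 h, ?_⟩
    rw [map_inv]
    exact Finset.smul_finset_subset_iff.1 hT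
  · rintro ⟨⟨L, Q⟩, h, hT⟩
    exact ⟨_, (R22_preservesPairs g L Q).2 h, Finset.smul_finset_subset_smul_finset hT⟩

/-- Whether the set with mask `t` is contained in a lifted block. -/
def posMask (t : ℕ) : Bool := pairs22.any fun e => e.1 &&& t == t

lemma pos_maskSet {t : ℕ} (ht : t < 2 ^ 22) : Pos (maskSet 22 t) ↔ posMask t = true := by
  rw [posMask, List.any_eq_true]
  constructor
  · rintro ⟨x, hx, h⟩
    obtain ⟨e, he, rfl⟩ := mem_pairFamily.1 hx
    exact ⟨e, he, by rw [beq_iff_eq]; exact (maskSet_subset_iff ht).1 h⟩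
  · rintro ⟨e, he, h⟩
    exact ⟨_, mem_pairFamily.2 ⟨e, he, rfl⟩, (maskSet_subset_iff ht).2 (beq_iff_eq.1 h)⟩

lemma pos_iff {T : Finset (Fin 22)} : Pos T ↔ posMask (toMask T) = true := by
  rw [← pos_maskSet (toMask_lt T), maskSet_toMask]

open scoped Classical in
/-- The number of subsets of `T` with one point less that lie in lifted blocks. -/
noncomputable def plus (T : Finset (Fin 22)) : ℕ := (T.filter fun p => Pos (T.erase p)).card

lemma plus_smul (g : MathieuM11) (T : Finset (Fin 22)) : plus (R22.ρ g • T) = plus T := by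
  classical
  rw [plus, plus, ← Finset.card_smul_finset (R22.ρ g) (T.filter _)]
  congr 1
  ext p
  obtain ⟨q, rfl⟩ := (R22.ρ g).surjective p
  rw [← Equiv.Perm.smul_def, Finset.smul_mem_smul_finset_iff, Finset.mem_filter, Finset.mem_filter,
    Finset.smul_mem_smul_finset_iff, ← pos_smul g (T.erase q)]
  refine and_congr_right fun _ => ?_
  have : R22.ρ g • T.erase q = (R22.ρ g • T).erase (R22.ρ g • q) := by
    simp [Finset.smul_finset_def, Finset.image_erase (R22.ρ g).injective]
  rw [this]

/-- The value of `plus` on the set with mask `t`. -/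
def plusMask (t : ℕ) : ℕ :=
  ((List.finRange 22).filter fun p : Fin 22 => t.testBit p && posMask (t ^^^ 1 <<< (p : ℕ))).length

lemma plus_eq (T : Finset (Fin 22)) : plus T = plusMask (toMask T) := by
  classical
  have h : ∀ p ∈ T, toMask (T.erase p) = toMask T ^^^ 1 <<< (p : ℕ) := by
    intro p hp
    apply Nat.eq_of_testBit_eq
    intro i
    rw [Nat.testBit_xor, testBit_one_shiftLeft]
    by_cases hi : i < 22
    · have h1 := testBit_toMask (T.erase p) ⟨i, hi⟩
      have h2 := testBit_toMask T ⟨i, hi⟩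
      simp only at h1 h2
      rw [h1, h2]
      by_cases hip : (p : ℕ) = i
      · have : p = ⟨i, hi⟩ := Fin.ext hip
        subst this
        simp [hp]
      · have : (⟨i, hi⟩ : Fin 22) ≠ p := fun hc => hip (by rw [← hc])
        simp [this, hip]
    · rw [testBit_toMask_of_le _ (by omega), testBit_toMask_of_le _ (by omega)]
      have := p.2
      simp; omega
  have h1 : T.filter (fun p => Pos (T.erase p)) = ((List.finRange 22).filter fun p : Fin 22 =>
      (toMask T).testBit p && posMask (toMask T ^^^ 1 <<< (p : ℕ))).toFinset := by
    ext p
    simp only [Finset.mem_filter, List.mem_toFinset, List.mem_filter, List.mem_finRange, true_and,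
      Bool.and_eq_true, testBit_toMask, decide_eq_true_eq]
    refine and_congr_right fun hp => ?_
    rw [pos_iff, h p hp]
  rw [plus, h1, List.toFinset_card_of_nodup ((List.nodup_finRange 22).filter _), plusMask]

/-- Words for the stabilizer of the first four points of the base. -/
def quadWords : List (List ℕ) :=
  [[], [5, 5], [8, 8, 4], [9, 9, 9], [1, 0, 8, 1], [1, 6, 10, 2], [2, 0, 9, 0], [2, 5, 8, 3],
    [2, 10, 6, 2], [3, 9, 9, 4], [4, 2, 0, 3], [4, 4, 3, 4], [5, 0, 7, 1], [6, 0, 5, 1],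
    [6, 6, 3, 4], [7, 8, 5, 4], [8, 3, 6, 1], [8, 5, 7, 2], [9, 0, 7, 5], [10, 9, 9, 0],
    [1, 8, 0, 1, 0], [3, 4, 10, 0, 1], [4, 2, 8, 4, 0], [8, 1, 4, 5, 0]]

/-- Masks of 4-sets in different fibres, one for each value of `plus`. -/
def quadRep : Fin 5 → ℕ := ![26626, 15, 2062, 10250, 4109]

/-- The numbers of 4-sets in different fibres with given value of `plus`. -/
def quadSize : Fin 5 → ℕ := ![330, 1320, 1980, 1320, 330]

/-- Words for the stabilizer of `{1, 2, 11}`, which is also the stabilizer of its image under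
`swap`. -/
def tripleWords : List (List ℕ) :=
  [[], [7, 7], [1, 8, 3], [2, 9, 8], [3, 4, 2], [0, 8, 5, 3], [0, 8, 9, 1], [1, 2, 8, 10],
    [1, 7, 6, 9], [4, 7, 10, 7], [5, 0, 8, 0], [6, 6, 3, 4]]

lemma plus_of_mem_orbit {S T : Finset (Fin 22)} (h : T ∈ R22.orbit S) : plus T = plus S := by
  obtain ⟨g, rfl⟩ := h
  exact plus_smul g S

lemma exists_mem_orbit_quad (T : Finset (Fin 22)) (hT : T ∈ setsOfType 0 4) :
    ∃ c, T ∈ R22.orbit (maskSet 22 (quadRep c)) := by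
  obtain ⟨m, hm, h⟩ := exists_mem_orbit_of_type (x := 0) (q := 15) (words := quadWords)
    (reps := (List.finRange 5).map quadRep) (by decide) (by decide) (by decide) (by decide)
    (by decide) (by decide +kernel) T hT
  obtain ⟨c, -, rfl⟩ := List.mem_map.1 hm
  exact ⟨c, h⟩

lemma plus_quadRep (c : Fin 5) : plus (maskSet 22 (quadRep c)) = c := by
  rw [plus_eq, toMask_maskSet (by revert c; decide +kernel)]
  revert c; decide +kernel

/-- The 4-sets in different fibres form five orbits, separated by `plus`. -/
lemma mem_orbit_quad_iff (c : Fin 5) (T : Finset (Fin 22)) :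
    T ∈ R22.orbit (maskSet 22 (quadRep c)) ↔ T ∈ setsOfType 0 4 ∧ plus T = c := by
  constructor
  · intro h
    refine ⟨?_, by rw [plus_of_mem_orbit h, plus_quadRep]⟩
    obtain ⟨g, rfl⟩ := h
    rw [smul_mem_setsOfType, maskSet_mem_setsOfType]
    revert c; decide +kernel
  · rintro ⟨h, hc⟩
    obtain ⟨c', h'⟩ := exists_mem_orbit_quad T h
    rw [plus_of_mem_orbit h', plus_quadRep] at hc
    rwa [← Fin.ext hc]

lemma ncard_orbit_quad (c : Fin 5) : (R22.orbit (maskSet 22 (quadRep c))).ncard = quadSize c := by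
  have h := R22.orbits_of_cover (setsOfType 0 4) ((List.finRange 5).map fun c => (quadRep c,
      quadWords.filter fun w => R22.mapsMask w (quadRep c) (quadRep c)))
    (fun S hS => by
      obtain ⟨c, h⟩ := exists_mem_orbit_quad S hS
      exact ⟨_, List.mem_map.2 ⟨c, List.mem_finRange c, rfl⟩, h⟩)
    (by decide +kernel) (by decide +kernel) (by decide +kernel)
    (by rw [ncard_setsOfType]; decide +kernel)
  rw [h.1 (quadRep c, _) (List.mem_map.2 ⟨c, List.mem_finRange c, rfl⟩)]
  revert c; decide +kernel

/-- The numbers of 4-sets in different fibres with given value of `plus` in the base blocks. -/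
def quadCount : Fin 12 → Fin 5 → ℕ :=
  ![![5, 10, 10, 0, 0], ![2, 8, 8, 6, 1], ![1, 6, 7, 6, 5], ![3, 8, 9, 4, 1], ![2, 7, 10, 5, 1],
    ![2, 9, 10, 3, 1], ![0, 4, 11, 8, 2], ![0, 5, 15, 5, 0], ![2, 5, 11, 5, 2], ![1, 7, 9, 7, 1],
    ![1, 7, 9, 7, 1], ![1, 8, 8, 6, 2]]

/-- The number of blocks through a 4-set in different fibres. -/
lemma blockCount_quad (i : Fin 12) (c : Fin 5) (T : Finset (Fin 22)) (hT : T ∈ setsOfType 0 4)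
    (hc : plus T = c) : quadSize c * blockCount (blocks22 i) T = size22 i * quadCount i c := by
  have h := R22.ncard_orbit_mul_blockCount (maskSet 22 (mask22 i)) (maskSet 22 (quadRep c))
  obtain ⟨g, rfl⟩ := (mem_orbit_quad_iff c T).2 ⟨hT, hc⟩
  rw [blocks22, R22.blockCount_smul, ← ncard_orbit_quad, h, ← ncard_blocks22 i]
  congr 1
  rw [ncard_subsets_eq_countSub (k := 4) _ (fun t => typeMask 0 4 t && plusMask t == c) fun U => by
    rw [mem_orbit_quad_iff, Bool.and_eq_true, beq_iff_eq, ← mem_setsOfType_iff, ← plus_eq]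
    exact ⟨fun h => ⟨card_of_mem_setsOfType h.1, h⟩, fun h => h.2⟩]
  clear h hc hT g
  revert i c; decide +kernel

lemma exists_mem_orbit_triple (T : Finset (Fin 22)) (hT : T ∈ setsOfType 0 3) :
    ∃ m ∈ [2054, 12289], T ∈ R22.orbit (maskSet 22 m) :=
  exists_mem_orbit_of_type (x := 0) (q := 7) (words := [[], [0, 2, 0], [6, 6, 2], [7, 8, 4]])
    (by decide) (by decide) (by decide) (by decide) (by decide) (by decide +kernel) T hT

lemma mem_orbit_triple_iff {m : ℕ} (hm : m ∈ [2054, 12289]) (T : Finset (Fin 22)) :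
    T ∈ R22.orbit (maskSet 22 m) ↔ T ∈ setsOfType 0 3 ∧ (Pos T ↔ m = 2054) := by
  have key : ∀ m ∈ [2054, 12289], ∀ T ∈ R22.orbit (maskSet 22 m), (Pos T ↔ m = 2054) := by
    rintro m hm _ ⟨g, rfl⟩
    have h1 : ∀ m ∈ [2054, 12289], m < 2 ^ 22 := by decide
    rw [pos_smul, pos_maskSet (h1 m hm)]
    revert m; decide +kernel
  constructor
  · intro h
    refine ⟨?_, key m hm T h⟩
    obtain ⟨g, rfl⟩ := h
    rw [smul_mem_setsOfType, maskSet_mem_setsOfType]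
    clear key
    revert m; decide +kernel
  · rintro ⟨h, hc⟩
    obtain ⟨m', hm', h'⟩ := exists_mem_orbit_triple T h
    have := key m' hm' T h'
    have h2 : ∀ m ∈ [2054, 12289], ∀ m' ∈ [2054, 12289], (m = 2054 ↔ m' = 2054) → m = m' := by
      decide
    rwa [h2 m hm m' hm' (hc.symm.trans this)]

/-- The numbers of 3-sets in the base blocks that are contained in lifted blocks of the Steiner
system. -/
def tripleCount : Fin 12 → ℕ := ![10, 14, 17, 13, 14, 13, 17, 15, 15, 15, 15, 15]

/-- The number of blocks through a 3-set in different fibres. Each base block contains 30 such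
sets. -/
lemma blockCount_triple (i : Fin 12) (T : Finset (Fin 22)) (hT : T ∈ setsOfType 0 3) :
    (Pos T → 660 * blockCount (blocks22 i) T = size22 i * tripleCount i) ∧
      (¬ Pos T → 660 * blockCount (blocks22 i) T = size22 i * (30 - tripleCount i)) := by
  have h := R22.orbits_of_cover (setsOfType 0 3) [(2054, tripleWords), (12289, tripleWords)]
    (fun S hS => by
      obtain ⟨m, hm, h⟩ := exists_mem_orbit_triple S hS
      refine ⟨(m, tripleWords), ?_, h⟩
      simpa using hm)
    (by decide +kernel) (by decide +kernel) (by decide +kernel)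
    (by rw [ncard_setsOfType]; decide +kernel)
  have hsize : ∀ m ∈ [2054, 12289], (R22.orbit (maskSet 22 m)).ncard = 660 := by
    intro m hm
    rw [h.1 (m, tripleWords) (by simpa using hm)]
    change 7920 / tripleWords.length = 660
    decide +kernel
  have key : ∀ m ∈ [2054, 12289], (Pos T ↔ m = 2054) → 660 * blockCount (blocks22 i) T =
      size22 i * (if m = 2054 then tripleCount i else 30 - tripleCount i) := by
    intro m hm hpos
    obtain ⟨g, rfl⟩ := (mem_orbit_triple_iff hm T).2 ⟨hT, hpos⟩
    rw [blocks22, R22.blockCount_smul, ← hsize m hm, R22.ncard_orbit_mul_blockCount,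
      ← ncard_blocks22 i]
    congr 1
    rw [ncard_subsets_eq_countSub (k := 3) _
      (fun t => typeMask 0 3 t && posMask t == decide (m = 2054)) fun U => by
        rw [mem_orbit_triple_iff hm, Bool.and_eq_true, beq_iff_eq, ← mem_setsOfType_iff,
          Bool.eq_iff_iff, ← pos_iff, decide_eq_true_eq]
        exact ⟨fun h => ⟨card_of_mem_setsOfType h.1, h⟩, fun h => h.2⟩]
    clear hpos hT h hsize g
    revert m i; decide +kernel
  constructor
  · intro hp
    simpa using key 2054 (by simp) (by simpa using hp)
  · intro hp
    simpa using key 12289 (by simp) (by simpa using hp)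

/-! ### Isomorphisms between the designs on 22 points -/

/-- `σ` is an isomorphism from the design of the family `𝓑` to that of the family `𝓑'`. -/
def MapsFamily {v : ℕ} (σ : Equiv.Perm (Fin v)) (𝓑 𝓑' : Set (Finset (Fin v))) : Prop :=
  ∀ S, σ • S ∈ 𝓑' ↔ S ∈ 𝓑

namespace MapsFamily

variable {v : ℕ} {σ τ : Equiv.Perm (Fin v)} {𝓑 𝓑' 𝓑'' : Set (Finset (Fin v))}

lemma ncard_eq (h : MapsFamily σ 𝓑 𝓑') : 𝓑.ncard = 𝓑'.ncard := by
  rw [← Nat.card_coe_set_eq, ← Nat.card_coe_set_eq]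
  exact Nat.card_congr
    ((MulAction.toPerm σ : Equiv.Perm (Finset (Fin v))).subtypeEquiv fun U => (h U).symm)

lemma blockCount_smul (h : MapsFamily σ 𝓑 𝓑') (T : Finset (Fin v)) :
    blockCount 𝓑' (σ • T) = blockCount 𝓑 T := by
  rw [blockCount, blockCount, ← Nat.card_coe_set_eq, ← Nat.card_coe_set_eq]
  refine (Nat.card_congr
    ((MulAction.toPerm σ : Equiv.Perm (Finset (Fin v))).subtypeEquiv fun U => ?_)).symm
  change U ∈ 𝓑 ∧ T ⊆ U ↔ σ • U ∈ 𝓑' ∧ σ • T ⊆ σ • U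
  rw [h, Finset.smul_finset_subset_smul_finset_iff]

lemma mul (h : MapsFamily σ 𝓑' 𝓑'') (h' : MapsFamily τ 𝓑 𝓑') : MapsFamily (σ * τ) 𝓑 𝓑'' :=
  fun S => by rw [mul_smul, h, h']

lemma inv (h : MapsFamily σ 𝓑 𝓑') : MapsFamily σ⁻¹ 𝓑' 𝓑 := fun S => by
  rw [← h, smul_inv_smul]

end MapsFamily

lemma mapsFamily_rho (g : MathieuM11) (i : Fin 12) :
    MapsFamily (R22.ρ g) (blocks22 i) (blocks22 i) := R22.smul_mem_orbit_iff g _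

lemma layer_two_mono {S T : Finset (Fin 22)} (h : T ⊆ S) : layer T 2 ⊆ layer S 2 := fun i hi => by
  rw [mem_layer_two] at hi ⊢
  exact ⟨h hi.1, h hi.2⟩

lemma mem_setsOfType_of_mem_blocks22 {i : Fin 12} {S : Finset (Fin 22)} (h : S ∈ blocks22 i) :
    S ∈ setsOfType 1 5 := by
  obtain ⟨g, rfl⟩ := h
  rw [smul_mem_setsOfType, maskSet_mem_setsOfType]
  revert i; decide +kernel

lemma size22_pos (i : Fin 12) : 0 < size22 i := by revert i; decide

/-- The pairs of points in the same fibre can be recognized from the numbers of blocks through the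
4-sets that contain them. -/
lemma proj_eq_iff (i : Fin 12) (p q : Fin 22) (hpq : p ≠ q) :
    (∀ T : Finset (Fin 22), T.card = 4 → p ∈ T → q ∈ T →
      198 * blockCount (blocks22 i) T = 0 ∨ 198 * blockCount (blocks22 i) T = size22 i) ↔
      proj p = proj q := by
  constructor
  · intro h
    by_contra hne
    have hpt : ({p, q} : Finset (Fin 22)) ∈ setsOfType 0 2 := by
      have h2 : layer {p, q} 2 = ∅ := by
        refine Finset.eq_empty_of_forall_notMem fun a ha => ?_
        rw [mem_layer_two, Finset.mem_insert, Finset.mem_singleton, Finset.mem_insert,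
          Finset.mem_singleton] at ha
        have h3 := lo_ne_hi a a
        rcases ha with ⟨rfl | rfl, h4 | h4⟩
        · exact h3 h4.symm
        · exact hne (by rw [← h4, proj_lo, proj_hi])
        · exact hne (by rw [← h4, proj_lo, proj_hi])
        · exact h3 h4.symm
      have h4 := card_eq_layers {p, q}
      rw [h2, Finset.card_pair hpq, Finset.card_empty] at h4
      exact ⟨by rw [h2, Finset.card_empty], by omega⟩
    obtain ⟨T₀, hT₀⟩ := exists_orbit_of_type 0 2 (by simp)
    have h3 : maskSet 22 3 ∈ setsOfType 0 2 := maskSet_mem_setsOfType.2 (by decide +kernel)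
    have h5 := hT₀ _ hpt
    rw [← R22.orbit_eq_of_mem (hT₀ _ h3)] at h5
    obtain ⟨g, hg⟩ := h5
    have h15 : maskSet 22 3 ⊆ maskSet 22 15 := (maskSet_subset_iff (by norm_num)).2 (by decide)
    have hsub : ({p, q} : Finset (Fin 22)) ⊆ R22.ρ g • maskSet 22 15 := by
      rw [← hg]
      exact Finset.smul_finset_subset_smul_finset h15
    have h04 : maskSet 22 15 ∈ setsOfType 0 4 := maskSet_mem_setsOfType.2 (by decide +kernel)
    have hbc := blockCount_quad i 1 (maskSet 22 15) h04 (plus_quadRep 1)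
    have hT := h (R22.ρ g • maskSet 22 15)
      (by rw [Finset.card_smul_finset, card_of_mem_setsOfType h04]) (hsub (by simp))
      (hsub (by simp))
    rw [(mapsFamily_rho g i).blockCount_smul] at hT
    have h6 : 0 < size22 i := size22_pos i
    have h7 : 0 < quadCount i 1 := by clear hbc h hT h6; revert i; decide
    have h8 : 0 < size22 i * quadCount i 1 := Nat.mul_pos h6 h7
    change 1320 * _ = _ at hbc
    generalize blockCount (blocks22 i) (maskSet 22 15) = x at hbc hT
    rcases hT with hT | hT
    · omega
    · rw [← hT] at hbc
      have : x * 1320 = x * (198 * quadCount i 1) := by rw [mul_comm, hbc]; ring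
      have := Nat.eq_of_mul_eq_mul_left (by omega) this
      omega
  · intro h T hT hp hq
    have h2 : 1 ≤ (layer T 2).card := by
      rw [Nat.one_le_iff_ne_zero, ← Nat.pos_iff_ne_zero, Finset.card_pos]
      refine ⟨proj p, ?_⟩
      rw [mem_layer_two]
      rcases eq_lo_or_hi p with h3 | h3 <;> rcases eq_lo_or_hi q with h4 | h4 <;>
        rw [← h] at h4
      · exact absurd (h3.trans h4.symm) hpq
      · exact ⟨h3 ▸ hp, h4 ▸ hq⟩
      · exact ⟨h4 ▸ hq, h3 ▸ hp⟩
      · exact absurd (h3.trans h4.symm) hpq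
    have h3 := card_eq_layers T
    by_cases h4 : (layer T 2).card = 1
    · right
      have h5 := blockCount_of_type (r := 1) (j := 2) (n := 10) (by simp) i T ⟨h4, by omega⟩
      rw [ncard_setsOfType] at h5
      have h6 : Nat.choose 11 1 * (Nat.choose (11 - 1) 2 * 2 ^ 2) = 1980 := by decide
      rw [h6] at h5
      omega
    · left
      have : {S | S ∈ blocks22 i ∧ T ⊆ S} = ∅ := by
        refine Set.eq_empty_of_forall_notMem fun S hS => ?_
        have h5 := Finset.card_le_card (layer_two_mono hS.2)
        rw [(mem_setsOfType_of_mem_blocks22 hS.1).1] at h5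
        omega
      rw [blockCount, this, Set.ncard_empty]

lemma exists_lifts {σ : Equiv.Perm (Fin 22)} {i j : Fin 12}
    (h : MapsFamily σ (blocks22 i) (blocks22 j)) : ∃ τ, Lifts σ τ := by
  have hsize : size22 i = size22 j := by
    rw [← ncard_blocks22, ← ncard_blocks22, h.ncard_eq]
  have key : ∀ p q, proj (σ p) = proj (σ q) ↔ proj p = proj q := by
    intro p q
    by_cases hpq : p = q
    · simp [hpq]
    rw [← proj_eq_iff i p q hpq, ← proj_eq_iff j (σ p) (σ q) (fun hc => hpq (σ.injective hc))]
    constructor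
    · intro h1 T hT hp hq
      have := h1 (σ • T) (by rw [Finset.card_smul_finset, hT])
        (Finset.smul_mem_smul_finset (a := σ) hp) (Finset.smul_mem_smul_finset (a := σ) hq)
      rwa [h.blockCount_smul, ← hsize] at this
    · intro h1 T hT hp hq
      have h2 : ∀ x, σ x ∈ T → x ∈ σ⁻¹ • T := fun x hx => by
        rw [Finset.mem_inv_smul_finset_iff]; exact hx
      have := h1 (σ⁻¹ • T) (by rw [Finset.card_smul_finset, hT]) (h2 p hp) (h2 q hq)
      rwa [h.inv.blockCount_smul, hsize] at this
  have hinj : Function.Injective fun a : Fin 11 => proj (σ (lo a)) := fun a b hab => by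
    have := (key _ _).1 hab
    rwa [proj_lo, proj_lo] at this
  refine ⟨Equiv.ofBijective _ (Finite.injective_iff_bijective.1 hinj), fun p => ?_⟩
  rw [Equiv.ofBijective_apply, key, proj_lo]

/-- The sets of base points over which the blocks contain one point form a family of 5-sets, which
consists either of the 66 blocks of the Steiner system or of all other 5-sets. -/
noncomputable def baseFamily (b : Bool) : Set (Finset (Fin 11)) :=
  bif b then R11.orbit (maskSet 11 61)
    else {Q : Finset (Fin 11) | Q.card = 5} \ R11.orbit (maskSet 11 61)

lemma card_of_mem_orbit11 {Q : Finset (Fin 11)} (h : Q ∈ R11.orbit (maskSet 11 61)) :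
    Q.card = 5 := by
  rw [R11.card_of_mem_orbit h, card_maskSet]
  decide

lemma stabilizer_baseFamily (b : Bool) :
    MulAction.stabilizer (Equiv.Perm (Fin 11)) (baseFamily b) = R11.range := by
  cases b
  · rw [baseFamily, cond_false, stabilizer_card_diff _ fun _ h => card_of_mem_orbit11 h,
      stabilizer_orbit11]
  · exact stabilizer_orbit11

lemma ncard_baseFamily (b : Bool) : (baseFamily b).ncard = bif b then 66 else 396 := by
  cases b
  · have h : R11.orbit (maskSet 11 61) ⊆ {Q : Finset (Fin 11) | Q.card = 5} :=
      fun Q h => card_of_mem_orbit11 h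
    rw [baseFamily, cond_false, Set.ncard_sdiff h (Set.toFinite _), ncard_setOf_card, ncard_orbit11]
    decide
  · exact ncard_orbit11

/-- The 5-sets outside of the Steiner system form one orbit. -/
lemma orbit11_31 : R11.orbit (maskSet 11 31) =
    {Q : Finset (Fin 11) | Q.card = 5} \ R11.orbit (maskSet 11 61) :=
  R11.orbit_eq_sdiff _ (by rw [card_maskSet]; decide) _ (R11.range_le_stabilizer _)
    (disjoint_orbit_of_testBit R11 (by norm_num) (by norm_num) (by decide +kernel))
    (fun S hS => by simpa using orbits11 5 [61, 31] (by simp) S hS)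

/-- Whether the blocks lie over blocks of the Steiner system. -/
def overSteiner (i : Fin 12) : Bool := pairIndex i == 0

lemma orbit11_527 : R11.orbit (maskSet 11 527) = R11.orbit (maskSet 11 61) := by
  refine R11.orbit_eq_of_mem ?_
  rw [R11.mem_orbit_iff_testBit (by norm_num) isClosed11, toMask_maskSet (by norm_num)]
  decide +kernel

lemma mem_baseFamily_iff (i : Fin 12) (Q : Finset (Fin 11)) :
    Q ∈ baseFamily (overSteiner i) ↔ ∃ S ∈ blocks22 i, layer S 1 = Q := by
  have h1 : layer (maskSet 22 (mask22 i)) 1 = maskSet 11 (bif overSteiner i then 527 else 31) := by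
    rw [layer_one_maskSet]
    revert i; decide +kernel
  have h2 : baseFamily (overSteiner i) = R11.orbit (layer (maskSet 22 (mask22 i)) 1) := by
    rw [h1]
    cases overSteiner i
    · exact orbit11_31.symm
    · exact orbit11_527.symm
  rw [h2]
  constructor
  · rintro ⟨g, rfl⟩
    exact ⟨_, ⟨g, rfl⟩, (lifts_rho g).layer_smul _ _⟩
  · rintro ⟨_, ⟨g, rfl⟩, rfl⟩
    exact ⟨g, ((lifts_rho g).layer_smul _ _).symm⟩

/-- An isomorphism induces an automorphism of the Steiner system on the base. -/
lemma mem_range_of_lifts {σ : Equiv.Perm (Fin 22)} {τ : Equiv.Perm (Fin 11)} {i j : Fin 12}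
    (h : MapsFamily σ (blocks22 i) (blocks22 j)) (hl : Lifts σ τ) : τ ∈ R11.range := by
  have h1 : MapsFamily τ (baseFamily (overSteiner i)) (baseFamily (overSteiner j)) := by
    intro Q
    rw [mem_baseFamily_iff, mem_baseFamily_iff]
    constructor
    · rintro ⟨S, hS, hQ⟩
      refine ⟨σ⁻¹ • S, by rwa [← h, smul_inv_smul], ?_⟩
      rw [hl.inv.layer_smul, hQ, inv_smul_smul]
    · rintro ⟨S, hS, rfl⟩
      exact ⟨σ • S, (h S).2 hS, hl.layer_smul S 1⟩
  have h2 : overSteiner i = overSteiner j := by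
    have := h1.ncard_eq
    rw [ncard_baseFamily, ncard_baseFamily] at this
    revert this
    cases overSteiner i <;> cases overSteiner j <;> simp
  rw [← stabilizer_baseFamily (overSteiner i), MulAction.mem_stabilizer_set]
  rw [← h2] at h1
  exact h1

lemma flip_mul_self (F : Finset (Fin 11)) : flip F * flip F = 1 := (flip F).self_trans_symm

lemma flip_apply (F : Finset (Fin 11)) (p : Fin 22) :
    (flip F p : ℕ) = bif (toMask F).testBit ((p : ℕ) % 11) then ((p : ℕ) + 11) % 22 else p := by
  have h := testBit_toMask F (proj p)
  change (toMask F).testBit ((p : ℕ) % 11) = _ at h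
  rw [h]
  rcases eq_lo_or_hi p with hp | hp
  · generalize proj p = i at hp
    subst hp
    rw [flip_lo]
    by_cases hi : i ∈ F
    · simp only [hi, if_true, decide_true, cond_true, lo, M11Designs.hi]
      omega
    · simp [hi]
  · generalize proj p = i at hp
    subst hp
    rw [flip_hi]
    by_cases hi : i ∈ F
    · simp only [hi, if_true, decide_true, cond_true, lo, M11Designs.hi]
      omega
    · simp [hi]

/-- The mask of the image under `flip` of the set with mask `t`. -/
def flipMask (F t : ℕ) : ℕ :=
  imgMask (fun p => bif F.testBit (p % 11) then (p + 11) % 22 else p) t 22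

/-- The mask of the set of the four consecutive base points that start with `k`. -/
def windowMask (k : ℕ) : ℕ := imgMask (fA11 k) 15 11

/-- If `F` is neither empty nor the whole base, then it meets some four consecutive base points in
an odd number of points, since 4 is prime to 11. -/
lemma exists_window (F : Finset (Fin 11)) (h0 : F ≠ ∅) (h1 : F ≠ Finset.univ) :
    ∃ k < 11, popcount (toMask F &&& windowMask k) 11 % 2 = 1 := by
  have key : (List.range 2048).all (fun F => F == 0 || F == 2047 ||
      (List.range 11).any fun k => popcount (F &&& windowMask k) 11 % 2 == 1) = true := by
    decide +kernel
  have h2 := List.all_eq_true.1 key (toMask F) (List.mem_range.2 (toMask_lt F))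
  rw [Bool.or_eq_true, Bool.or_eq_true, beq_iff_eq, beq_iff_eq] at h2
  have h3 : toMask F ≠ 0 := fun h => h0 (toMask_injective (h.trans toMask_empty.symm))
  have h4 : toMask F ≠ 2047 := fun h => h1 (by
    rw [← maskSet_toMask F, h]; decide +kernel)
  obtain ⟨k, hk, h5⟩ := List.any_eq_true.1 (h2.resolve_left (not_or.2 ⟨h3, h4⟩))
  exact ⟨k, List.mem_range.1 hk, beq_iff_eq.1 h5⟩

lemma flip_smul_congr {F H : Finset (Fin 11)} {T : Finset (Fin 22)}
    (h : ∀ p ∈ T, proj p ∈ F ↔ proj p ∈ H) : flip F • T = flip H • T := by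
  rw [Finset.smul_finset_def, Finset.smul_finset_def]
  refine Finset.image_congr fun p hp => ?_
  simp only [Equiv.Perm.smul_def, flip, Equiv.coe_fn_mk, h p hp]

/-- For the sets over four points of which an odd number lies in `F`, the permutation `flip F`
changes the parity of `plus`. The value 2 is taken six times, and the values 1 and 3 four times
each. -/
lemma exists_flip (F : Finset (Fin 11)) (h0 : F ≠ ∅) (h1 : F ≠ Finset.univ) (c : ℕ)
    (hc : c ∈ [1, 3]) : ∃ T, T ∈ setsOfType 0 4 ∧ plus T = 2 ∧ flip F • T ∈ setsOfType 0 4 ∧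
      plus (flip F • T) = c := by
  have key : (List.range 11).all (fun k => force (windowMask k) fun w =>
      decide (w < 2 ^ 11) && (List.range 2048).all fun H =>
        H &&& w != H || popcount H 11 % 2 == 0 || [1, 3].all fun c => (List.range 16).any fun h =>
          force (liftMask 0 w (imgMask (fA11 k) h 11)) fun t =>
            decide (t < 2 ^ 22) && typeMask 0 4 t && plusMask t == 2 &&
              force (flipMask H t) fun t' => plusMask t' == c) = true := by
    decide +kernel
  obtain ⟨k, hk, hodd⟩ := exists_window F h0 h1
  have h2 := List.all_eq_true.1 key k (List.mem_range.2 hk)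
  simp only [force_eq] at h2
  rw [Bool.and_eq_true, decide_eq_true_eq] at h2
  set H := maskSet 11 (toMask F &&& windowMask k) with hH
  have h3 : toMask H = toMask F &&& windowMask k :=
    toMask_maskSet (Nat.and_le_left.trans_lt (toMask_lt F))
  have h4 := List.all_eq_true.1 h2.2 (toMask H) (List.mem_range.2 (toMask_lt H))
  rw [Bool.or_eq_true, Bool.or_eq_true, bne_iff_ne, beq_iff_eq, h3, Nat.and_assoc, Nat.and_self,
    hodd] at h4
  have h5 := List.all_eq_true.1 (h4.resolve_left (by simp)) c hc
  obtain ⟨h, -, h6⟩ := List.any_eq_true.1 h5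
  rw [← h3] at h6
  have hlift := maskSet_liftMask (x := 0) (by norm_num) h2.1 (imgMask (fA11 k) h 11)
  generalize liftMask 0 (windowMask k) (imgMask (fA11 k) h 11) = t at h6 hlift
  simp only [Bool.and_eq_true, decide_eq_true_eq, beq_iff_eq] at h6
  obtain ⟨⟨⟨h7, h8⟩, h9⟩, h10⟩ := h6
  rw [← maskSet_mem_setsOfType] at h8
  have hT : flip F • maskSet 22 t = flip H • maskSet 22 t := by
    refine flip_smul_congr fun p hp => ?_
    have h11 : proj p ∈ maskSet 11 (windowMask k) := by
      rw [hlift, liftSet, Finset.mem_filter] at hp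
      rcases hp.2 with h | h
      · simp at h
      · exact h.1
    have h12 := testBit_toMask F (proj p)
    rw [mem_maskSet] at h11
    rw [hH, mem_maskSet, Nat.testBit_and, h11, Bool.and_true, h12, decide_eq_true_eq]
  refine ⟨maskSet 22 t, h8, ?_, (lifts_flip F).smul_mem_setsOfType.2 h8, ?_⟩
  · rw [plus_eq, toMask_maskSet h7, h9]
  · rw [hT, ← maskSet_imgMask (fun p => bif (toMask H).testBit (p % 11) then (p + 11) % 22 else p)
      (flip H) (flip_apply H) t, plus_eq, toMask_maskSet]
    · exact h10
    · refine imgMask_lt (fun p hp => ?_) t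
      cases (toMask H).testBit (p % 11) <;> simp only [cond_true, cond_false] <;> omega

/-- No isomorphism exchanges the points of some but not all fibres: this would force relations
between the numbers of 4-sets with given `plus` in the blocks. -/
lemma eq_empty_or_univ_of_flip {F : Finset (Fin 11)} {i j : Fin 12}
    (h : MapsFamily (flip F) (blocks22 i) (blocks22 j)) : F = ∅ ∨ F = Finset.univ := by
  by_contra hF
  rw [not_or] at hF
  have key : ∀ i j : Fin 12, MapsFamily (flip F) (blocks22 i) (blocks22 j) →
      2 * quadCount i 2 = 3 * quadCount j 1 ∧ 2 * quadCount i 2 = 3 * quadCount j 3 := by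
    intro i j h
    have hsize : size22 i = size22 j := by
      rw [← ncard_blocks22, ← ncard_blocks22, h.ncard_eq]
    have h0 := size22_pos j
    constructor
    · obtain ⟨T, hT, hp, hT', hp'⟩ := exists_flip F hF.1 hF.2 1 (by simp)
      have e1 := blockCount_quad i 2 T hT hp
      have e2 := blockCount_quad j 1 _ hT' hp'
      rw [h.blockCount_smul] at e2
      change 1980 * _ = _ at e1
      change 1320 * _ = _ at e2
      rw [hsize] at e1
      refine Nat.eq_of_mul_eq_mul_left h0 ?_
      rw [mul_left_comm, ← e1, mul_left_comm (size22 j) 3, ← e2]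
      ring
    · obtain ⟨T, hT, hp, hT', hp'⟩ := exists_flip F hF.1 hF.2 3 (by simp)
      have e1 := blockCount_quad i 2 T hT hp
      have e2 := blockCount_quad j 3 _ hT' hp'
      rw [h.blockCount_smul] at e2
      change 1980 * _ = _ at e1
      change 1320 * _ = _ at e2
      rw [hsize] at e1
      refine Nat.eq_of_mul_eq_mul_left h0 ?_
      rw [mul_left_comm, ← e1, mul_left_comm (size22 j) 3, ← e2]
      ring
  have h1 := key i j h
  have h2 := key j i (by
    have := h.inv
    rwa [inv_eq_of_mul_eq_one_left (flip_mul_self F)] at this)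
  clear h key
  revert i j; decide

/-- The isomorphisms between the twelve designs on 22 points. -/
lemma eq_of_mapsFamily {σ : Equiv.Perm (Fin 22)} {i j : Fin 12}
    (h : MapsFamily σ (blocks22 i) (blocks22 j)) :
    i = j ∧ ∃ g, σ = R22.ρ g ∨ (σ = R22.ρ g * swap ∧ 7 ≤ (i : ℕ) ∧ (i : ℕ) ≤ 10) := by
  obtain ⟨τ, hτ⟩ := exists_lifts h
  obtain ⟨g, rfl⟩ := mem_range_of_lifts h hτ
  have h1 : Lifts ((R22.ρ g)⁻¹ * σ) 1 := by
    have := (lifts_rho g).inv.mul hτ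
    rwa [inv_mul_cancel] at this
  have h2 : MapsFamily ((R22.ρ g)⁻¹ * σ) (blocks22 i) (blocks22 j) :=
    (mapsFamily_rho g j).inv.mul h
  have h3 : σ = R22.ρ g * ((R22.ρ g)⁻¹ * σ) := (mul_inv_cancel_left _ _).symm
  generalize (R22.ρ g)⁻¹ * σ = φ at h1 h2 h3
  have hB := (h2 (maskSet 22 (mask22 i))).2 (R22.self_mem_orbit _)
  obtain ⟨F, rfl⟩ : ∃ F, φ = flip F := ⟨_, h1.eq_flip⟩
  rcases eq_empty_or_univ_of_flip h2 with rfl | rfl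
  · have : flip ∅ = 1 := by
      ext p
      simp [flip]
    rw [this, one_smul] at hB
    rw [this, mul_one] at h3
    exact ⟨eq_of_mem_blocks22 hB, g, Or.inl h3⟩
  · have := eq_of_swap_mem_blocks22 hB
    exact ⟨this.1, g, Or.inr ⟨h3, this.2⟩⟩

lemma mapsFamily_swap (i : Fin 12) (h : 7 ≤ (i : ℕ) ∧ (i : ℕ) ≤ 10) :
    MapsFamily swap (blocks22 i) (blocks22 i) := by
  have h1 : ∀ S ∈ blocks22 i, swap • S ∈ blocks22 i := by
    rintro _ ⟨g, rfl⟩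
    rw [smul_smul, ← (swap_comm g).eq, mul_smul, blocks22, R22.smul_mem_orbit_iff]
    exact swap_mem_blocks22 i h
  refine fun S => ⟨fun hS => ?_, h1 S⟩
  have := h1 _ hS
  rwa [smul_smul, swap_mul_self, one_smul] at this

lemma stabilizer_blocks22 (i : Fin 12) (h : ¬ (7 ≤ (i : ℕ) ∧ (i : ℕ) ≤ 10)) :
    MulAction.stabilizer (Equiv.Perm (Fin 22)) (blocks22 i) = R22.range := by
  refine le_antisymm (fun σ hσ => ?_) (R22.range_le_stabilizer _)
  rw [MulAction.mem_stabilizer_set] at hσ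
  obtain ⟨-, g, rfl | ⟨-, hi⟩⟩ := eq_of_mapsFamily (i := i) (j := i) hσ
  · exact R22.mem_range g
  · exact absurd hi h

/-- The homomorphism that maps the nontrivial element of the second factor to `swap`. -/
noncomputable def swapHom : MathieuM11 × Multiplicative (ZMod 2) →* Equiv.Perm (Fin 22) where
  toFun x := R22.ρ x.1 * (if x.2 = 1 then 1 else swap)
  map_one' := by simp
  map_mul' x y := by
    have h : ∀ a b : Multiplicative (ZMod 2), (if a * b = 1 then 1 else swap) =
        (if a = 1 then 1 else swap) * (if b = 1 then 1 else swap) := by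
      intro a b
      have h1 : ∀ a b : Multiplicative (ZMod 2), a ≠ 1 → b ≠ 1 → a * b = 1 := by decide
      by_cases ha : a = 1 <;> by_cases hb : b = 1 <;> simp [ha, hb, h1, swap_mul_self]
    rw [Prod.fst_mul, Prod.snd_mul, map_mul, h, mul_assoc, mul_assoc]
    congr 1
    rw [← mul_assoc, ← mul_assoc]
    congr 1
    split_ifs
    · simp
    · exact (swap_comm y.1).eq

lemma swapHom_injective : Function.Injective swapHom := by
  rw [injective_iff_map_eq_one]
  rintro ⟨g, a⟩ h
  have h1 : R22.ρ g * (if a = 1 then 1 else swap) = 1 := h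
  have h2 : R11.ρ g = 1 := by
    have h3 : Lifts (if a = 1 then 1 else swap) 1 := by
      split_ifs
      · exact fun p => rfl
      · exact lifts_flip _
    have h4 := (lifts_rho g).mul h3
    rw [h1, mul_one] at h4
    ext i
    have := h4 (lo i)
    rw [Equiv.Perm.one_apply, proj_lo] at this
    rw [← this]
    rfl
  have h3 : g = 1 := R11_injective (by rw [h2, map_one])
  subst h3
  by_cases ha : a = 1
  · rw [ha]; rfl
  · rw [map_one, one_mul, if_neg ha] at h1
    have := congrArg (fun σ : Equiv.Perm (Fin 22) => (σ 0 : ℕ)) h1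
    simp [swap_apply] at this

lemma stabilizer_blocks22_swap (i : Fin 12) (h : 7 ≤ (i : ℕ) ∧ (i : ℕ) ≤ 10) :
    MulAction.stabilizer (Equiv.Perm (Fin 22)) (blocks22 i) = swapHom.range := by
  refine le_antisymm (fun σ hσ => ?_) ?_
  · rw [MulAction.mem_stabilizer_set] at hσ
    obtain ⟨-, g, rfl | ⟨rfl, -⟩⟩ := eq_of_mapsFamily (i := i) (j := i) hσ
    · exact ⟨(g, 1), by simp [swapHom]⟩
    · exact ⟨(g, Multiplicative.ofAdd 1), by
        have : Multiplicative.ofAdd (1 : ZMod 2) ≠ 1 := by decide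
        simp [swapHom, this]⟩
  · rintro _ ⟨⟨g, a⟩, rfl⟩
    rw [MulAction.mem_stabilizer_set]
    have h1 : MapsFamily (if a = 1 then 1 else swap) (blocks22 i) (blocks22 i) := by
      split_ifs
      · intro S; rw [one_smul]
      · exact mapsFamily_swap i h
    exact (mapsFamily_rho g i).mul h1

/-! ### The designs on 22 points -/

lemma mem_setsOfType_of_card_two {T : Finset (Fin 22)} (h : T.card = 2) :
    T ∈ setsOfType 1 0 ∨ T ∈ setsOfType 0 2 := by
  have := card_eq_layers T
  simp only [setsOfType, Set.mem_ofPred_eq]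
  omega

lemma mem_setsOfType_of_card_three {T : Finset (Fin 22)} (h : T.card = 3) :
    T ∈ setsOfType 1 1 ∨ T ∈ setsOfType 0 3 := by
  have := card_eq_layers T
  simp only [setsOfType, Set.mem_ofPred_eq]
  omega

/-- All pairs of points lie in the same number of blocks. -/
lemma blockCount_pair (i : Fin 12) (T : Finset (Fin 22)) (hT : T.card = 2) :
    11 * blockCount (blocks22 i) T = size22 i := by
  rcases mem_setsOfType_of_card_two hT with h | h
  · have := blockCount_of_type (n := 1) (by simp) i T h
    rw [ncard_setsOfType] at this
    simpa using this
  · have := blockCount_of_type (n := 20) (by simp) i T h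
    rw [ncard_setsOfType] at this
    have h6 : Nat.choose 11 0 * (Nat.choose (11 - 0) 2 * 2 ^ 2) = 220 := by decide
    rw [h6] at this
    omega

/-- The design is a 3-design if and only if half of the 30 sets of three points of a block in
different fibres lie in lifted blocks of the Steiner system. -/
lemma blockCount_three (i : Fin 12) (hi : 7 ≤ (i : ℕ)) (T : Finset (Fin 22)) (hT : T.card = 3) :
    44 * blockCount (blocks22 i) T = size22 i := by
  rcases mem_setsOfType_of_card_three hT with h | h
  · have := blockCount_of_type (n := 5) (by simp) i T h
    rw [ncard_setsOfType] at this
    have h6 : Nat.choose 11 1 * (Nat.choose (11 - 1) 1 * 2 ^ 1) = 220 := by decide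
    rw [h6] at this
    omega
  · have h1 : tripleCount i = 15 := by revert i; decide
    obtain ⟨h2, h3⟩ := blockCount_triple i T h
    rw [h1] at h2 h3
    by_cases hp : Pos T
    · have := h2 hp
      omega
    · have := h3 hp
      omega

lemma seven_le_of_blockCount_three (i : Fin 12) (l : ℕ)
    (h : ∀ T : Finset (Fin 22), T.card = 3 → blockCount (blocks22 i) T = l) : 7 ≤ (i : ℕ) := by
  have hT : maskSet 22 2054 ∈ setsOfType 0 3 := maskSet_mem_setsOfType.2 (by decide +kernel)
  have hp : Pos (maskSet 22 2054) := (pos_maskSet (by norm_num)).2 (by decide +kernel)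
  have hT' : maskSet 22 2051 ∈ setsOfType 1 1 := maskSet_mem_setsOfType.2 (by decide +kernel)
  have h1 := (blockCount_triple i _ hT).1 hp
  have h2 := blockCount_of_type (n := 5) (by simp) i _ hT'
  rw [h _ (card_of_mem_setsOfType hT)] at h1
  rw [h _ (card_of_mem_setsOfType hT'), ncard_setsOfType] at h2
  have h6 : Nat.choose 11 1 * (Nat.choose (11 - 1) 1 * 2 ^ 1) = 220 := by decide
  rw [h6] at h2
  have h3 : tripleCount i = 15 :=
    Nat.eq_of_mul_eq_mul_left (size22_pos i) (by rw [← h1]; omega)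
  revert h3
  clear h h1 h2
  revert i; decide

/-- The blocks of a 2-design that is an orbit contain both points of one fibre and one point of five
others. -/
lemma mem_setsOfType_of_blockCount_two (S : Finset (Fin 22)) (l : ℕ) (h3 : 3 ≤ S.card)
    (h11 : S.card ≤ 11)
    (h : ∀ T : Finset (Fin 22), T.card = 2 → blockCount (R22.orbit S) T = l) :
    S ∈ setsOfType 1 5 := by
  have h1 := choose_mul_eq (R22.orbit S) (fun U hU => R22.card_of_mem_orbit hU) h
  have hT : maskSet 22 2049 ∈ setsOfType 1 0 := maskSet_mem_setsOfType.2 (by decide +kernel)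
  have h2 := ncard_type_mul_blockCount (by simp) S _ hT
  have hc : {U | U ∈ setsOfType 1 0 ∧ U ⊆ S}.ncard = (layer S 2).card := by
    rw [← Set.ncard_coe_finset]
    symm
    refine Set.ncard_congr (fun i _ => {lo i, hi i}) ?_ ?_ ?_
    · intro i hi'
      rw [Finset.mem_coe, mem_layer_two] at hi'
      have e2 : layer {lo i, hi i} 2 = {i} := by
        ext j
        rw [mem_layer_two]
        simp only [Finset.mem_insert, Finset.mem_singleton, lo_ne_hi, (lo_ne_hi _ _).symm, or_false,
          false_or]
        simp [lo, hi, Fin.ext_iff]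
      have e3 := card_eq_layers {lo i, hi i}
      rw [e2, Finset.card_pair (lo_ne_hi i i), Finset.card_singleton] at e3
      refine ⟨⟨by rw [e2, Finset.card_singleton], by omega⟩, ?_⟩
      rw [Finset.insert_subset_iff, Finset.singleton_subset_iff]
      exact hi'
    · intro i j _ _ hij
      have : lo i ∈ ({lo j, hi j} : Finset (Fin 22)) := by
        rw [← hij]; exact Finset.mem_insert_self _ _
      rw [Finset.mem_insert, Finset.mem_singleton] at this
      rcases this with h | h
      · rw [← proj_lo i, h, proj_lo]
      · exact absurd h (lo_ne_hi i j)
    · rintro U ⟨hU, hUS⟩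
      obtain ⟨i, hi'⟩ := Finset.card_eq_one.1 hU.1
      have h5 : i ∈ layer U 2 := by rw [hi']; exact Finset.mem_singleton_self i
      rw [mem_layer_two] at h5
      refine ⟨i, ?_, ?_⟩
      · rw [Finset.mem_coe, mem_layer_two]
        exact ⟨hUS h5.1, hUS h5.2⟩
      · refine Finset.eq_of_subset_of_card_le ?_ ?_
        · rw [Finset.insert_subset_iff, Finset.singleton_subset_iff]
          exact h5
        · rw [Finset.card_pair (lo_ne_hi i i), card_of_mem_setsOfType hU]
  rw [hc, h _ (card_of_mem_setsOfType hT), ncard_setsOfType] at h2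
  have hpos : 0 < (R22.orbit S).ncard :=
    (Set.ncard_pos (R22.orbit_finite S)).2 ⟨S, R22.self_mem_orbit S⟩
  have h4 : 21 * (layer S 2).card = S.card.choose 2 := by
    refine Nat.eq_of_mul_eq_mul_left hpos ?_
    rw [← h1, mul_left_comm, ← h2]
    have : Nat.choose 22 2 = 231 := by decide
    rw [this]
    simp
    ring
  have h5 := card_eq_layers S
  generalize S.card = k at h3 h11 h4 h5
  have key : ∀ k ≤ 11, 3 ≤ k → Nat.choose k 2 % 21 = 0 → k = 7 := by decide
  have hk := key k h11 h3 (by omega)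
  subst hk
  have : Nat.choose 7 2 = 21 := by decide
  exact ⟨by omega, by omega⟩

/-! ### Transitive actions of degree 11, 12 and 22 -/

/-- The part of the graph of a permutation `δ` that is known once the values `l` of `δ` at the points
in `base` are: as `δ` satisfies `δ γ = γ ^ 3 δ`, where `γ` acts by the function `fC` and has order
5, the values at the images of these points under powers of `γ` follow. The list `l` is reversed. -/
def partialGraph (fC : ℕ → ℕ) (base l : List ℕ) : List (ℕ × ℕ) :=
  (base.zip l.reverse).flatMap fun e => (List.range 5).map fun k => (fC^[k] e.1, fC^[3 * k] e.2)

/-- `k` applied to `L`, with the entries of `L` evaluated first. -/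
def forceList {α : Type*} : List (ℕ × ℕ) → (List (ℕ × ℕ) → α) → α
  | [], k => k []
  | e :: L, k => force e.1 fun x => force e.2 fun y => forceList L fun L' => k ((x, y) :: L')

lemma forceList_eq {α : Type*} (L : List (ℕ × ℕ)) :
    ∀ k : List (ℕ × ℕ) → α, forceList L k = k L := by
  induction L with
  | nil => exact fun k => rfl
  | cons e L ih => exact fun k => by rw [forceList, force_eq, force_eq, ih]

/-- Whether a partial graph can belong to an injective map `δ` with `δ ^ 4 = 1` and
`(α δ) ^ 3 = 1`, where `α` acts by `fA`. -/
def consistent (fA fC : ℕ → ℕ) (base l : List ℕ) : Bool :=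
  forceList (partialGraph fC base l) fun L => L.all fun e =>
    (L.all fun e' => bif Nat.beq e.1 e'.1 then Nat.beq e.2 e'.2 else !Nat.beq e.2 e'.2) &&
    force (fA e.2) fun y =>
      (L.all fun e₁ => bif Nat.beq e₁.1 y then
        force (fA e₁.2) fun z =>
          L.all fun e₂ => bif Nat.beq e₂.1 z then Nat.beq (fA e₂.2) e.1 else true
        else true) &&
      (L.all fun e₁ => bif Nat.beq e₁.1 e.2 then
        L.all fun e₂ => bif Nat.beq e₂.1 e₁.2 then
          L.all fun e₃ => bif Nat.beq e₃.1 e₂.2 then Nat.beq e₃.2 e.1 else true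
          else true
        else true)

lemma reverse_valuesRev (s : ℕ → ℕ) (n : ℕ) : (valuesRev s n).reverse = (List.range n).map s := by
  induction n with
  | zero => rfl
  | succ n ih => rw [valuesRev, List.reverse_cons, ih, List.range_succ, List.map_append]; rfl

/-- The outcome of the search for the image of `gD` in a representation in which `gA` and `gC` act by
given functions. -/
lemma exists_partialGraph {v : ℕ} (Ψ : MathieuM11 →* Equiv.Perm (Fin v)) (fA fC : ℕ → ℕ)
    (hA : ∀ x, (Ψ gA x : ℕ) = fA x) (hC : ∀ x, (Ψ gC x : ℕ) = fC x) (base : List ℕ)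
    (hb : ∀ x ∈ base, x < v) :
    ∃ l ∈ extend (consistent fA fC base) v base.length [],
      ∀ e ∈ partialGraph fC base l, ∃ x : Fin v, e = ((x : ℕ), (Ψ gD x : ℕ)) := by
  set s := fun j => permNat (Ψ gD) (base.getD j 0) with hs
  have hCk : ∀ (k : ℕ) (x : Fin v), fC^[k] x = Ψ (gC ^ k) x := by
    intro k
    induction k with
    | zero => intro x; simp
    | succ k ih => intro x; rw [Function.iterate_succ_apply', ih, ← hC, pow_succ', map_mul]; rfl
  have hDC : ∀ k : ℕ, gD * gC ^ k = gC ^ (3 * k) * gD := by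
    intro k
    induction k with
    | zero => simp
    | succ k ih =>
      rw [pow_succ, ← mul_assoc, ih, mul_assoc, gD_mul_gC, ← mul_assoc, ← pow_add]
      congr 2
  have hgraph : ∀ n, ∀ e ∈ partialGraph fC base (valuesRev s n), ∃ x : Fin v, e = ((x : ℕ),
    (Ψ gD x : ℕ)) := by
    intro n e he
    rw [partialGraph, List.mem_flatMap] at he
    obtain ⟨f, hf, he⟩ := he
    obtain ⟨k, -, rfl⟩ := List.mem_map.1 he
    rw [reverse_valuesRev] at hf
    obtain ⟨i, hi, rfl⟩ := List.getElem_of_mem hf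
    rw [List.length_zip] at hi
    have hi' : i < base.length := by omega
    rw [List.getElem_zip]
    simp only [List.getElem_map, List.getElem_range]
    have hx := hb _ (List.getElem_mem hi')
    have e1 : s i = Ψ gD ⟨base[i], hx⟩ := by
      rw [hs]
      simp only [List.getD_eq_getElem _ _ hi']
      exact permNat_val (Ψ gD) ⟨base[i], hx⟩
    refine ⟨Ψ (gC ^ k) ⟨base[i], hx⟩, ?_⟩
    rw [e1, hCk (3 * k), ← Equiv.Perm.mul_apply, ← Equiv.Perm.mul_apply, ← map_mul, ← map_mul, hDC,
      ← hCk k]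
  refine ⟨valuesRev s base.length, ?_, hgraph _⟩
  have := valuesRev_mem_extend (consistent fA fC base) v s base.length 0 ?_ ?_
  · rwa [Nat.zero_add] at this
  · intro i _ hi
    rw [Nat.zero_add] at hi
    have hx := hb _ (List.getElem_mem hi)
    rw [hs]
    simp only [List.getD_eq_getElem _ _ hi]
    have := permNat_val (Ψ gD) ⟨base[i], hx⟩
    simp only at this
    rw [this]
    exact Fin.is_lt _
  · intro i _ _
    have hcond : ∀ (a b : ℕ) (c : Bool), (bif Nat.beq a b then c else true) = true ↔
        (a = b → c = true) := by
      intro a b c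
      cases h : Nat.beq a b
      · simp [Nat.ne_of_beq_eq_false h]
      · simp [Nat.eq_of_beq_eq_true h]
    simp only [consistent, forceList_eq, List.all_eq_true, Bool.and_eq_true, force_eq, hcond]
    intro e he
    obtain ⟨x, rfl⟩ := hgraph _ e he
    refine ⟨fun e' he' => ?_, fun e₁ h1 => ?_, fun e₁ h1 => ?_⟩
    · obtain ⟨y, rfl⟩ := hgraph _ e' he'
      by_cases h : x = y
      · subst h
        simp
      · have h' : (Ψ gD x : ℕ) ≠ Ψ gD y := fun h'' => h ((Ψ gD).injective (Fin.ext h''))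
        have h : (x : ℕ) ≠ y := fun h'' => h (Fin.ext h'')
        have hf : ∀ {a b : ℕ}, a ≠ b → Nat.beq a b = false := fun hn =>
          Bool.eq_false_iff.2 fun hb => hn (Nat.eq_of_beq_eq_true hb)
        rw [hf h, hf h']
        rfl
    · obtain ⟨y, rfl⟩ := hgraph _ e₁ h1
      simp only [← hA, ← Fin.ext_iff]
      rintro rfl e₂ h2
      obtain ⟨z, rfl⟩ := hgraph _ e₂ h2
      simp only [← hA, ← Fin.ext_iff]
      rintro rfl
      rw [Nat.beq_eq, ← Fin.ext_iff]
      have := congrArg (fun g => Ψ g x) gA_mul_gD_pow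
      simpa [pow_succ] using this
    · obtain ⟨y, rfl⟩ := hgraph _ e₁ h1
      simp only [← Fin.ext_iff]
      rintro rfl e₂ h2
      obtain ⟨z, rfl⟩ := hgraph _ e₂ h2
      simp only [← Fin.ext_iff]
      rintro rfl e₃ h3
      obtain ⟨w, rfl⟩ := hgraph _ e₃ h3
      simp only [← Fin.ext_iff]
      rintro rfl
      rw [Nat.beq_eq, ← Fin.ext_iff]
      have := congrArg (fun g => Ψ g x) gD_pow
      simpa [pow_succ] using this

/-- Whether a partial graph contains the graph of `f` on the numbers below `n`. -/
def containsGraph (f : ℕ → ℕ) (n : ℕ) (L : List (ℕ × ℕ)) : Bool :=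
  (List.range n).all fun x => L.elem (x, f x)

/-- Whether a partial graph maps all the numbers from `a` up to `b - 1` to such numbers. -/
def mapsInterval (a b : ℕ) (L : List (ℕ × ℕ)) : Bool :=
  (List.range b).all fun x => Nat.blt x a || L.any fun e => e.1 == x &&
    (Nat.ble a e.2 && Nat.blt e.2 b)

/-- A transitive representation is determined by the action of `gA` and `gC` if the search for the
image of `gD` finds nothing else than the given one and permutations that preserve an interval. -/
lemma eq_of_search {v : ℕ} (R : Rep v) (Ψ : MathieuM11 →* Equiv.Perm (Fin v)) (fC : ℕ → ℕ)
    (htr : ∀ x y, ∃ g, Ψ g x = y) (hA : ∀ x, (Ψ gA x : ℕ) = R.fA 1 x)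
    (hC : ∀ x, (Ψ gC x : ℕ) = fC x) (base : List ℕ) (hb : ∀ x ∈ base, x < v) (a b c : ℕ)
    (hab : a < b) (hbv : b ≤ v) (hc : c < v) (hc' : ¬ (a ≤ c ∧ c < b) ∨ (a = 0 ∧ b = v))
    (hAab : (List.range v).all (fun x => Nat.blt x a || Nat.ble b x ||
      (Nat.ble a (R.fA 1 x) && Nat.blt (R.fA 1 x) b)) = true)
    (h : (extend (consistent (R.fA 1) fC base) v base.length []).all (fun l =>
      containsGraph R.fD v (partialGraph fC base l) ||
        (!(a == 0 && b == v) && mapsInterval a b (partialGraph fC base l))) = true) :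
    Ψ = R.ρ := by
  obtain ⟨l, hl, hgraph⟩ := exists_partialGraph Ψ (R.fA 1) fC hA hC base hb
  have h1 := List.all_eq_true.1 h l hl
  rw [Bool.or_eq_true, Bool.and_eq_true] at h1
  rcases h1 with h1 | ⟨h0, h1⟩
  · have hK : MonoidHom.eqLocus Ψ R.ρ = ⊤ := by
      refine eq_top_of_mem _ (Equiv.ext fun x => Fin.ext ?_) (Equiv.ext fun x => Fin.ext ?_)
      · rw [hA, R.fA_one]
      · have h2 := List.all_eq_true.1 h1 x (List.mem_range.2 x.2)
        rw [List.elem_eq_contains, List.contains_iff_mem] at h2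
        obtain ⟨y, hy⟩ := hgraph _ h2
        rw [Prod.mk.injEq] at hy
        obtain rfl : x = y := Fin.ext hy.1
        rw [R.ρ_gD, hy.2]
    ext g : 1
    have : g ∈ MonoidHom.eqLocus Ψ R.ρ := hK ▸ Subgroup.mem_top g
    exact this
  · exfalso
    let S : Set (Fin v) := {x | a ≤ (x : ℕ) ∧ (x : ℕ) < b}
    have hK : (MulAction.stabilizer (Equiv.Perm (Fin v)) S).comap Ψ = ⊤ := by
      refine eq_top_of_mem _ ?_ ?_
      · rw [Subgroup.mem_comap, MulAction.mem_stabilizer_set' (Set.toFinite _)]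
        rintro x ⟨hx1, hx2⟩
        have h2 := List.all_eq_true.1 hAab x (List.mem_range.2 x.2)
        simp only [Bool.or_eq_true, Bool.and_eq_true, Nat.blt_eq, Nat.ble_eq] at h2
        change a ≤ (Ψ gA x : ℕ) ∧ (Ψ gA x : ℕ) < b
        rw [hA]
        omega
      · rw [Subgroup.mem_comap, MulAction.mem_stabilizer_set' (Set.toFinite _)]
        rintro x ⟨hx1, hx2⟩
        have h2 := List.all_eq_true.1 h1 x (List.mem_range.2 hx2)
        rw [Bool.or_eq_true, List.any_eq_true, Nat.blt_eq] at h2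
        obtain ⟨e, he, h3⟩ := h2.resolve_left (by omega)
        obtain ⟨y, rfl⟩ := hgraph e he
        simp only [Bool.and_eq_true, beq_iff_eq, Nat.ble_eq, Nat.blt_eq] at h3
        obtain rfl : y = x := Fin.ext h3.1
        exact h3.2
    obtain ⟨g, hg⟩ := htr ⟨a, by omega⟩ ⟨c, hc⟩
    have h2 : g ∈ (MulAction.stabilizer (Equiv.Perm (Fin v)) S).comap Ψ := hK ▸ Subgroup.mem_top g
    rw [Subgroup.mem_comap, MulAction.mem_stabilizer_set] at h2
    have h3 : Ψ g • (⟨a, by omega⟩ : Fin v) ∈ S := (h2 _).2 ⟨le_rfl, hab⟩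
    rw [Equiv.Perm.smul_def, hg] at h3
    rcases hc' with hc' | ⟨rfl, rfl⟩
    · exact hc' h3
    · simp at h0

/-- The action of `gC` on 11 points. -/
def fC11 (p : ℕ) : ℕ := 3 * p % 11

/-- The action of `gC` on 12 points. -/
def fC12 (p : ℕ) : ℕ := bif p == 11 then 11 else 3 * p % 11

/-- The action of `gC` on 22 points. -/
def fC22 (p : ℕ) : ℕ := bif Nat.blt p 11 then 3 * p % 11 else 11 + 3 * (p - 11) % 11

lemma eq_rho11 (Ψ : MathieuM11 →* Equiv.Perm (Fin 11)) (htr : ∀ x y, ∃ g, Ψ g x = y)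
    (hA : ∀ x, (Ψ gA x : ℕ) = fA11 1 x) (hC : ∀ x, (Ψ gC x : ℕ) = fC11 x) : Ψ = R11.ρ :=
  eq_of_search R11 Ψ fC11 htr hA hC [0, 1, 10] (by decide) 0 11 0 (by decide) (by decide)
    (by decide)
    (by decide) (by decide +kernel) (by decide +kernel)

lemma eq_rho12 (Ψ : MathieuM11 →* Equiv.Perm (Fin 12)) (htr : ∀ x y, ∃ g, Ψ g x = y)
    (hA : ∀ x, (Ψ gA x : ℕ) = fA12 1 x) (hC : ∀ x, (Ψ gC x : ℕ) = fC12 x) : Ψ = R12.ρ :=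
  eq_of_search R12 Ψ fC12 htr hA hC [0, 11, 1, 10] (by decide) 11 12 0 (by decide) (by decide)
    (by decide) (by decide) (by decide +kernel) (by decide +kernel)

lemma eq_rho22 (Ψ : MathieuM11 →* Equiv.Perm (Fin 22)) (htr : ∀ x y, ∃ g, Ψ g x = y)
    (hA : ∀ x, (Ψ gA x : ℕ) = fA22 1 x) (hC : ∀ x, (Ψ gC x : ℕ) = fC22 x) : Ψ = R22.ρ :=
  eq_of_search R22 Ψ fC22 htr hA hC [0, 11, 1, 12, 10, 21] (by decide) 0 11 11 (by decide)
    (by decide) (by decide) (by decide) (by decide +kernel) (by decide +kernel)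

/-! ### Labelling the points of a transitive action -/

section Labelling

variable {P : Type*} (Φ : MathieuM11 →* Equiv.Perm P)

/-- If `gA` fixes a point, then 11 divides the order of its stabilizer. -/
lemma card_dvd_of_fixed (htr : ∀ x y, ∃ g, Φ g x = y) {p : P} (h : Φ gA p = p) :
    Nat.card P ∣ 720 := by
  let _ : MulAction MathieuM11 P := MulAction.compHom P Φ
  have : MulAction.IsPretransitive MathieuM11 P := ⟨htr⟩
  have h1 := MulAction.index_stabilizer_of_transitive MathieuM11 p
  have h2 := (MulAction.stabilizer MathieuM11 p).card_mul_index
  have h3 : gA ∈ MulAction.stabilizer MathieuM11 p := h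
  have h4 := Subgroup.orderOf_dvd_natCard _ h3
  have : Fact (Nat.Prime 11) := ⟨by norm_num⟩
  rw [orderOf_eq_prime gA_pow gA_ne_one] at h4
  obtain ⟨c, hc⟩ := h4
  rw [h1, card_M11, hc] at h2
  exact ⟨c, by nlinarith⟩

lemma card_fixed_modEq [Finite P] {q : ℕ} [Fact q.Prime] (σ : Equiv.Perm P) (h : σ ^ q = 1) :
    Nat.card P ≡ Nat.card {x // σ x = x} [MOD q] := by
  classical
  have : Fintype P := Fintype.ofFinite P
  let f : Function.End P := (σ : P → P)
  have h1 : ∀ n : ℕ, f ^ n = ⇑(σ ^ n) := by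
    intro n
    induction n with
    | zero => rfl
    | succ n ih => rw [pow_succ, pow_succ, ih]; rfl
  have h2 := Equiv.Perm.card_fixedPoints_modEq (f := f) (p := q) (n := 1)
    (by rw [pow_one, h1, h]; rfl)
  rw [← Nat.card_eq_fintype_card, ← Nat.card_eq_fintype_card] at h2
  exact h2

lemma gC_mul_gA_pow (m : ℕ) : gC * gA ^ m = gA ^ (3 * m) * gC := by
  induction m with
  | zero => simp
  | succ m ih =>
    rw [pow_succ, ← mul_assoc, ih, mul_assoc, gC_mul_gA, ← mul_assoc, ← pow_add]
    congr 2

lemma map_gC_gA_pow {p : P} (hp : Φ gC p = p) (m : ℕ) :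
    Φ gC (Φ (gA ^ m) p) = Φ (gA ^ (3 * m)) p := by
  rw [← Equiv.Perm.mul_apply, ← map_mul, gC_mul_gA_pow, map_mul, Equiv.Perm.mul_apply, hp]

lemma map_gA_gA_pow (p : P) (k m : ℕ) : Φ (gA ^ k) (Φ (gA ^ m) p) = Φ (gA ^ (k + m)) p := by
  rw [← Equiv.Perm.mul_apply, ← map_mul, pow_add]

lemma gA_pow_mod (m : ℕ) : gA ^ m = gA ^ (m % 11) := pow_eq_pow_mod m gA_pow

lemma fixed_of_pow {p : P} {k : ℕ} (hk : k % 11 ≠ 0) (h : Φ (gA ^ k) p = p) : Φ gA p = p := by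
  let K := (MulAction.stabilizer (Equiv.Perm P) p).comap Φ
  have hco : Nat.Coprime k 11 :=
    ((Nat.Prime.coprime_iff_not_dvd (by norm_num)).2 fun h => hk (Nat.mod_eq_zero_of_dvd h)).symm
  obtain ⟨j, -, hj⟩ := Nat.exists_mul_mod_eq_one_of_coprime hco (by norm_num)
  have h1 : gA ^ k ∈ K := h
  have h2 := K.pow_mem h1 j
  rw [← pow_mul, gA_pow_mod, hj, pow_one] at h2
  exact h2

lemma eq_of_gA_pow {p : P} (hp : Φ gA p ≠ p) {i j : ℕ} (h : Φ (gA ^ i) p = Φ (gA ^ j) p) :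
    i % 11 = j % 11 := by
  by_contra hij
  refine hp (fixed_of_pow Φ (k := i + 10 * j) (by omega) ?_)
  rw [add_comm, ← map_gA_gA_pow, h, map_gA_gA_pow, gA_pow_mod,
    show (10 * j + j) % 11 = 0 by omega]
  simp

/-- Two fixed points of `gC` in one cycle of `gA` agree. -/
lemma eq_of_fixed_gC {p q : P} (hp : Φ gA p ≠ p) (hpC : Φ gC p = p) (hqC : Φ gC q = q) {i : ℕ}
    (h : Φ (gA ^ i) p = q) : p = q := by
  have h1 := map_gC_gA_pow Φ hpC i
  rw [h, hqC, ← h] at h1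
  have h2 := eq_of_gA_pow Φ hp h1
  rw [gA_pow_mod, show i % 11 = 0 by omega] at h
  simpa using h

/-- A labelling of the points on which `gA` and `gC` act as prescribed is an equivalence of the
action with the given one. -/
lemma exists_equiv_of_labelling [Finite P] {v : ℕ} (R : Rep v) (fC : ℕ → ℕ)
    (hR : ∀ Ψ : MathieuM11 →* Equiv.Perm (Fin v), (∀ x y, ∃ g, Ψ g x = y) →
      (∀ x, (Ψ gA x : ℕ) = R.fA 1 x) → (∀ x, (Ψ gC x : ℕ) = fC x) → Ψ = R.ρ)
    (htr : ∀ x y, ∃ g, Φ g x = y) (hv : Nat.card P = v) (l : ℕ → P)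
    (hl : ∀ i < v, ∀ j < v, l i = l j → i = j)
    (hA : ∀ i < v, Φ gA (l i) = l (R.fA 1 i)) (hA' : ∀ i < v, R.fA 1 i < v)
    (hC : ∀ i < v, Φ gC (l i) = l (fC i)) (hC' : ∀ i < v, fC i < v) :
    ∃ e : P ≃ Fin v, ∀ g p, e (Φ g p) = R.ρ g (e p) := by
  have hinj : Function.Injective fun i : Fin v => l i := fun i j h =>
    Fin.ext (hl i i.2 j j.2 h)
  have hbij : Function.Bijective fun i : Fin v => l i :=
    (Nat.bijective_iff_injective_and_card _).2 ⟨hinj, by simp [hv]⟩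
  let e : P ≃ Fin v := (Equiv.ofBijective _ hbij).symm
  have he : ∀ i : ℕ, ∀ hi : i < v, e (l i) = ⟨i, hi⟩ := fun i hi =>
    (Equiv.symm_apply_eq _).2 rfl
  have he' : ∀ x : Fin v, e.symm x = l x := fun x => rfl
  let Ψ : MathieuM11 →* Equiv.Perm (Fin v) :=
    { toFun := fun g => e.permCongr (Φ g)
      map_one' := by ext; simp
      map_mul' := fun g h => by ext; simp }
  have hΨ : ∀ g x, Ψ g x = e (Φ g (e.symm x)) := fun g x => rfl
  refine ⟨e, fun g p => ?_⟩
  have h := hR Ψ (fun x y => ?_) (fun x => ?_) (fun x => ?_)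
  · rw [← h, hΨ, Equiv.symm_apply_apply]
  · obtain ⟨g, hg⟩ := htr (e.symm x) (e.symm y)
    exact ⟨g, by rw [hΨ, hg, Equiv.apply_symm_apply]⟩
  · rw [hΨ, he', hA x x.2, he _ (hA' x x.2)]
  · rw [hΨ, he', hC x x.2, he _ (hC' x x.2)]

/-- A fixed point of `gC` is labelled 0, and its images under the powers of `gA` follow. -/
lemma exists_equiv11 [Finite P] (htr : ∀ x y, ∃ g, Φ g x = y) (hv : Nat.card P = 11) :
    ∃ e : P ≃ Fin 11, ∀ g p, e (Φ g p) = R11.ρ g (e p) := by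
  have : Fact (Nat.Prime 5) := ⟨by norm_num⟩
  have hfix : ∀ p, Φ gA p ≠ p := fun p h => by
    have := card_dvd_of_fixed Φ htr h
    rw [hv] at this
    revert this
    decide
  -- The number of fixed points of `gC` is 1 modulo 5.
  have h5 := card_fixed_modEq (q := 5) (Φ gC) (by rw [← map_pow, gC_pow, map_one])
  rw [hv] at h5
  obtain ⟨⟨p, hp⟩⟩ : Nonempty {x // Φ gC x = x} := by
    by_contra h
    rw [not_nonempty_iff] at h
    rw [Nat.card_of_isEmpty] at h5
    exact absurd h5 (by decide)
  refine exists_equiv_of_labelling Φ R11 fC11 eq_rho11 htr hv (fun i => Φ (gA ^ i) p)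
    (fun i hi j hj h => ?_) (fun i hi => ?_) (fun i _ => ?_) (fun i hi => ?_) (fun i _ => ?_)
  · have := eq_of_gA_pow Φ (hfix p) h
    omega
  · have := map_gA_gA_pow Φ p 1 i
    rw [pow_one] at this
    rw [this, gA_pow_mod, add_comm]
    rfl
  · change (i + 1) % 11 < 11
    omega
  · rw [map_gC_gA_pow Φ hp, gA_pow_mod]
    rfl
  · change 3 * i % 11 < 11
    omega

/-- The fixed point of `gA` is labelled 11, another fixed point of `gC` is labelled 0, and its images
under the powers of `gA⁻¹` follow. -/
lemma exists_equiv12 [Finite P] (htr : ∀ x y, ∃ g, Φ g x = y) (hv : Nat.card P = 12) :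
    ∃ e : P ≃ Fin 12, ∀ g p, e (Φ g p) = R12.ρ g (e p) := by
  have : Fact (Nat.Prime 5) := ⟨by norm_num⟩
  have : Fact (Nat.Prime 11) := ⟨by norm_num⟩
  have h11 := card_fixed_modEq (q := 11) (Φ gA) (by rw [← map_pow, gA_pow, map_one])
  have h5 := card_fixed_modEq (q := 5) (Φ gC) (by rw [← map_pow, gC_pow, map_one])
  rw [hv] at h5 h11
  have hne : Φ gA ≠ 1 := by
    intro h
    have hD4 : Φ gD ^ 4 = 1 := by rw [← map_pow, gD_pow, map_one]
    have hD3 : Φ gD ^ 3 = 1 := by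
      have := congrArg Φ gA_mul_gD_pow
      rwa [map_pow, map_mul, h, one_mul, map_one] at this
    have hD : Φ gD = 1 := by rwa [pow_succ, hD3, one_mul] at hD4
    have hK := eq_top_of_mem Φ.ker h hD
    have hsub : Subsingleton P := ⟨fun x y => by
      obtain ⟨g, rfl⟩ := htr x y
      have : g ∈ Φ.ker := hK ▸ Subgroup.mem_top g
      rw [MonoidHom.mem_ker.1 this]
      rfl⟩
    have := Finite.card_le_one_iff_subsingleton.2 hsub
    omega
  -- `gA` has exactly one fixed point, as it does not fix all 12 points.
  have hle : Nat.card {x // Φ gA x = x} < 12 := by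
    rw [← hv]
    obtain ⟨x, hx⟩ := not_forall.1 fun h : ∀ x, Φ gA x = x => hne (Equiv.ext h)
    exact Finite.card_subtype_lt hx
  have h1 : Nat.card {x // Φ gA x = x} = 1 := by
    rw [Nat.ModEq] at h11
    omega
  obtain ⟨hsub, ⟨q, hq⟩⟩ := Nat.card_eq_one_iff_unique.1 h1
  have huniq : ∀ x, Φ gA x = x → x = q := fun x hx =>
    congrArg Subtype.val (Subsingleton.elim (⟨x, hx⟩ : {x // Φ gA x = x}) ⟨q, hq⟩)
  have hqA : ∀ m, Φ (gA ^ m) q = q := by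
    intro m
    have : gA ^ m ∈ (MulAction.stabilizer (Equiv.Perm P) q).comap Φ :=
      Subgroup.pow_mem _ (show gA ∈ (MulAction.stabilizer (Equiv.Perm P) q).comap Φ from hq) m
    exact this
  have hqC : Φ gC q = q := by
    refine huniq _ (fixed_of_pow Φ (k := 3) (by decide) ?_)
    rw [← Equiv.Perm.mul_apply, ← map_mul, ← gC_mul_gA, map_mul, Equiv.Perm.mul_apply, hq]
  have h2 : 1 < Nat.card {x // Φ gC x = x} := by
    have : 0 < Nat.card {x // Φ gC x = x} := Nat.card_pos_iff.2 ⟨⟨⟨q, hqC⟩⟩, inferInstance⟩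
    rw [Nat.ModEq] at h5
    omega
  obtain ⟨⟨p, hp⟩, hpq⟩ := 
    (@exists_ne _ (Finite.one_lt_card_iff_nontrivial.1 h2) ⟨q, hqC⟩)
  have hpq : p ≠ q := fun h => hpq (Subtype.ext h)
  have hpA : Φ gA p ≠ p := fun h => hpq (huniq p h)
  have hpq' : ∀ m, Φ (gA ^ m) p ≠ q := fun m h => hpq ((Φ (gA ^ m)).injective (h.trans
    (hqA m).symm))
  refine exists_equiv_of_labelling Φ R12 fC12 eq_rho12 htr hv
    (fun i => bif i == 11 then q else Φ (gA ^ (10 * i)) p)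
    (fun i hi j hj h => ?_) (fun i hi => ?_) (by decide) (fun i hi => ?_) (by decide)
  · by_cases h11 : i = 11 <;> by_cases h11' : j = 11
    · rw [h11, h11']
    · simp only [h11, beq_self_eq_true, cond_true, beq_eq_false_iff_ne.2 h11', cond_false] at h
      exact absurd h.symm (hpq' _)
    · simp only [h11', beq_self_eq_true, cond_true, beq_eq_false_iff_ne.2 h11, cond_false] at h
      exact absurd h (hpq' _)
    · simp only [beq_eq_false_iff_ne.2 h11, beq_eq_false_iff_ne.2 h11', cond_false] at h
      have := eq_of_gA_pow Φ hpA h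
      omega
  · by_cases h11 : i = 11
    · subst h11
      exact hq
    · have e1 : R12.fA 1 i = (i + 10) % 11 := by
        change fA12 1 i = _
        rw [fA12, beq_eq_false_iff_ne.2 h11]
        rfl
      have := map_gA_gA_pow Φ p 1 (10 * i)
      rw [pow_one] at this
      simp only [e1, beq_eq_false_iff_ne.2 h11, cond_false, this,
        beq_eq_false_iff_ne.2 (show (i + 10) % 11 ≠ 11 by omega)]
      rw [gA_pow_mod, gA_pow_mod (10 * _)]
      congr 3
      omega
  · by_cases h11 : i = 11
    · subst h11
      exact hqC
    · have e1 : fC12 i = 3 * i % 11 := by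
        rw [fC12, beq_eq_false_iff_ne.2 h11]
        rfl
      simp only [e1, beq_eq_false_iff_ne.2 h11, cond_false, map_gC_gA_pow Φ hp,
        beq_eq_false_iff_ne.2 (show 3 * i % 11 ≠ 11 by omega)]
      rw [gA_pow_mod, gA_pow_mod (10 * _)]
      congr 3
      omega

/-- Two fixed points of `gC` are labelled 0 and 11, each followed by its images under the powers of
`gA`. -/
lemma exists_equiv22 [Finite P] (htr : ∀ x y, ∃ g, Φ g x = y) (hv : Nat.card P = 22) :
    ∃ e : P ≃ Fin 22, ∀ g p, e (Φ g p) = R22.ρ g (e p) := by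
  have : Fact (Nat.Prime 5) := ⟨by norm_num⟩
  have hfix : ∀ p, Φ gA p ≠ p := fun p h => by
    have := card_dvd_of_fixed Φ htr h
    rw [hv] at this
    revert this
    decide
  have h5 := card_fixed_modEq (q := 5) (Φ gC) (by rw [← map_pow, gC_pow, map_one])
  rw [hv] at h5
  have h2 : 1 < Nat.card {x // Φ gC x = x} := by
    rw [Nat.ModEq] at h5
    omega
  obtain ⟨⟨p, hp⟩, ⟨q, hq⟩, hpq⟩ := (Finite.one_lt_card_iff_nontrivial.1 h2).exists_pair_ne
  have hpq : p ≠ q := fun h => hpq (Subtype.ext h)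
  have hpq' : ∀ i j, Φ (gA ^ i) p ≠ Φ (gA ^ j) q := by
    intro i j h
    refine hpq (eq_of_fixed_gC Φ (hfix p) hp hq (i := 10 * j + i) ?_)
    rw [← map_gA_gA_pow, h, map_gA_gA_pow, gA_pow_mod, show (10 * j + j) % 11 = 0 by omega]
    simp
  refine exists_equiv_of_labelling Φ R22 fC22 eq_rho22 htr hv
    (fun i => bif Nat.blt i 11 then Φ (gA ^ i) p else Φ (gA ^ i) q)
    (fun i hi j hj h => ?_) (fun i hi => ?_) (by decide) (fun i hi => ?_) (by decide)
  · cases hi' : Nat.blt i 11 <;> cases hj' : Nat.blt j 11 <;>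
      simp only [hi', hj', cond_true, cond_false] at h <;>
      simp only [← Bool.not_eq_true, Nat.blt_eq] at hi' hj'
    · have := eq_of_gA_pow Φ (hfix q) h
      omega
    · exact absurd h.symm (hpq' _ _)
    · exact absurd h (hpq' _ _)
    · have := eq_of_gA_pow Φ (hfix p) h
      omega
  · change Φ gA _ = bif Nat.blt (fA22 1 i) 11 then Φ (gA ^ fA22 1 i) p else Φ (gA ^ fA22 1 i) q
    have hm := fun p => map_gA_gA_pow Φ p 1 i
    simp only [pow_one] at hm
    cases hi' : Nat.blt i 11 <;> simp only [fA22, hi', cond_true, cond_false, hm]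
    · rw [show Nat.blt (11 + (i + 1) % 11) 11 = false by simp [← Bool.not_eq_true], cond_false,
        gA_pow_mod, gA_pow_mod (11 + _)]
      congr 3
      omega
    · rw [Nat.blt_eq.mpr (show (i + 1) % 11 < 11 by omega), cond_true, gA_pow_mod, add_comm]
  · cases hi' : Nat.blt i 11 <;>
      simp only [fC22, hi', cond_true, cond_false, map_gC_gA_pow Φ hp, map_gC_gA_pow Φ hq]
    · simp only [← Bool.not_eq_true, Nat.blt_eq] at hi'
      rw [show Nat.blt (11 + 3 * (i - 11) % 11) 11 = false by simp [← Bool.not_eq_true], cond_false,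
        gA_pow_mod, gA_pow_mod (11 + _)]
      congr 3
      omega
    · rw [Nat.blt_eq.mpr (show 3 * i % 11 < 11 by omega), cond_true, gA_pow_mod]

end Labelling

open IncidenceStructure

/-! ### Orbit designs and rows of the table -/

/-- An orbit design, given by a representation of the Mathieu group and the mask of a base block. -/
structure OrbitModel where
  v : ℕ
  R : Rep v
  m : ℕ

namespace OrbitModel

/-- The blocks of an orbit design. -/
def family (M : OrbitModel) : Set (Finset (Fin M.v)) := M.R.orbit (maskSet M.v M.m)

/-- An orbit design is as described in a row of the table. -/
structure Realizes (M : OrbitModel) (row : DesignRow) : Prop where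
  v_eq : row.v = M.v
  ncard_eq : M.family.ncard = row.blocks
  card_eq : (maskSet M.v M.m).card = row.k
  t_le : row.t ≤ row.k
  blockCount_eq : ∀ T : Finset (Fin M.v), T.card = row.t → blockCount M.family T = row.lam
  strength : row.t + 1 ≤ row.k →
    ∀ l, ¬ ∀ T : Finset (Fin M.v), T.card = row.t + 1 → blockCount M.family T = l
  transitive : ∀ x y, ∃ g, M.R.ρ g x = y
  v_pos : 0 < row.v
  blocks_pos : 0 < row.blocks
  aut : Nonempty (MulAction.stabilizer (Equiv.Perm (Fin M.v)) M.family ≃* row.autGroup)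

namespace Realizes

variable {M : OrbitModel} {row : DesignRow} (h : M.Realizes row)
include h

lemma card_of_mem {S : Finset (Fin M.v)} (hS : S ∈ M.family) : S.card = row.k := by
  rw [M.R.card_of_mem_orbit hS, h.card_eq]

lemma nonempty_points : Nonempty (Fin row.v) := ⟨⟨0, h.v_pos⟩⟩

lemma nonempty_blocks : Nonempty (Fin row.blocks) := ⟨⟨0, h.blocks_pos⟩⟩

lemma nonempty_blockEquiv : Nonempty (Fin row.blocks ≃ M.family) := by
  have h1 : Nat.card M.family = row.blocks := by rw [Nat.card_coe_set_eq, h.ncard_eq]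
  exact ⟨(Finite.equivFinOfCardEq h1).symm⟩

/-- An orbit design with points and blocks numbered as required by a row of the table. -/
noncomputable def design : IncidenceStructure (Fin row.v) (Fin row.blocks) :=
  @ofFamily _ _ _ h.nonempty_points h.nonempty_blocks M.family (finCongr h.v_eq)
    h.nonempty_blockEquiv.some

lemma isDesign_iff {t k lam : ℕ} (D : IncidenceStructure (Fin row.v) (Fin row.blocks)) :
    D.IsDesign t row.v k lam ↔ D.IsDesign t M.v k lam := by
  exact ⟨fun hd => ⟨hd.1, hd.2, hd.3, hd.4.trans h.v_eq, hd.5, hd.6⟩,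
    fun hd => ⟨hd.1, hd.2, hd.3, hd.4.trans h.v_eq.symm, hd.5, hd.6⟩⟩

lemma isDesignOfStrength : h.design.IsDesignOfStrength row.t row.v row.k row.lam := by
  have := h.nonempty_points
  have := h.nonempty_blocks
  constructor
  · exact (h.isDesign_iff _).2 (isDesign_ofFamily _ _ h.t_le (fun S hS => h.card_of_mem hS)
      h.blockCount_eq)
  · intro s mu hs hd
    have hle := hd.le_block_size
    obtain ⟨l, hl⟩ := isDesign_of_le hd (t := row.t + 1) hs
    refine h.strength (by omega) l fun T hT => ?_
    exact blockCount_of_isDesign _ _ ((h.isDesign_iff _).1 hl) T hT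

lemma isSimple : h.design.IsSimple := by
  have := h.nonempty_points
  have := h.nonempty_blocks
  exact isSimple_ofFamily _ _

lemma nonempty_aut : Nonempty (h.design.aut ≃* row.autGroup) := by
  have := h.nonempty_points
  have := h.nonempty_blocks
  exact h.aut.map fun a => (autOfFamily (finCongr h.v_eq) h.nonempty_blockEquiv.some).trans a

lemma isIsomorphic {P B : Type*} (D : IncidenceStructure P B) (hD : D.IsSimple)
    (e : P ≃ Fin M.v) (hS : ∀ S, S ∈ M.family ↔ ∃ b, ∀ p, e p ∈ S ↔ D.Inc p b) :
    D.IsIsomorphic h.design := by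
  have := h.nonempty_points
  have := h.nonempty_blocks
  have := D.nonempty_points
  have := D.nonempty_blocks
  obtain ⟨f, rfl⟩ := exists_eq_ofFamily e D hD hS
  exact isIsomorphic_ofFamily _ _ _ _

omit h in
lemma exists_perm {v : ℕ} {R : Rep v} {m m' : ℕ} {row row' : DesignRow}
    (h : Realizes ⟨v, R, m⟩ row) (h' : Realizes ⟨v, R, m'⟩ row')
    (hiso : h.design.IsIsomorphic h'.design) :
    ∃ σ : Equiv.Perm (Fin v), ∀ S, σ • S ∈ R.orbit (maskSet v m') ↔ S ∈ R.orbit (maskSet v m) := by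
  have := h.nonempty_points
  have := h.nonempty_blocks
  have := h'.nonempty_points
  have := h'.nonempty_blocks
  exact exists_perm_of_isIsomorphic _ _ _ _ hiso

lemma admitsTransitiveAction : h.design.AdmitsTransitiveAction MathieuM11 := by
  set e : Fin row.v ≃ Fin M.v := finCongr h.v_eq with he
  set f : Fin row.blocks ≃ M.family := h.nonempty_blockEquiv.some with hf
  let τ : MathieuM11 → Equiv.Perm M.family := fun g =>
    (MulAction.toPerm (M.R.ρ g) : Equiv.Perm (Finset (Fin M.v))).subtypeEquiv
      fun S => (M.R.smul_mem_orbit_iff g _ S).symm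
  have hτ : ∀ g S, (τ g S : Finset (Fin M.v)) = M.R.ρ g • (S : Finset (Fin M.v)) := fun _ _ => rfl
  let φ : MathieuM11 →* h.design.aut :=
    { toFun := fun g => ⟨(e.symm.permCongr (M.R.ρ g), f.symm.permCongr (τ g)), fun p b => by
        change e (e.symm (M.R.ρ g (e p))) ∈ (f (f.symm (τ g (f b))) : Finset (Fin M.v)) ↔
          e p ∈ (f b : Finset (Fin M.v))
        rw [Equiv.apply_symm_apply, Equiv.apply_symm_apply, hτ, ← Equiv.Perm.smul_def,
          Finset.smul_mem_smul_finset_iff]⟩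
      map_one' := by
        refine Subtype.ext (Prod.ext (Equiv.ext fun p => by simp) (Equiv.ext fun b => ?_))
        apply f.injective
        apply Subtype.ext
        simp [hτ]
      map_mul' := fun g g' => by
        refine Subtype.ext (Prod.ext (Equiv.ext fun p => by simp) (Equiv.ext fun b => ?_))
        apply f.injective
        apply Subtype.ext
        simp [hτ, mul_smul] }
  refine ⟨φ, fun p q => ?_, fun b c => ?_⟩
  · obtain ⟨g, hg⟩ := h.transitive (e p) (e q)
    refine ⟨g, e.injective ?_⟩
    change e (e.symm (M.R.ρ g (e p))) = e q
    rw [Equiv.apply_symm_apply, hg]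
  · have h1 : (f c : Finset (Fin M.v)) ∈ M.R.orbit (f b) := by
      rw [M.R.orbit_eq_of_mem (f b).2]
      exact (f c).2
    obtain ⟨g, hg⟩ := h1
    refine ⟨g, f.injective (Subtype.ext ?_)⟩
    change (f (f.symm (τ g (f b))) : Finset (Fin M.v)) = f c
    rw [Equiv.apply_symm_apply, hτ, hg]

end Realizes

end OrbitModel

/-- A simple incidence structure with a transitive action that is equivalent to a representation of
the Mathieu group is the design of an orbit. -/
lemma exists_orbit_of_action {P B : Type*} (D : IncidenceStructure P B) {v : ℕ} (R : Rep v)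
    (φ : MathieuM11 →* D.aut)
    (hφ : ∀ b c : B, ∃ g, (φ g : Equiv.Perm P × Equiv.Perm B).2 b = c) (e : P ≃ Fin v)
    (he : ∀ g p, e ((φ g : Equiv.Perm P × Equiv.Perm B).1 p) = R.ρ g (e p)) :
    ∃ S, ∀ T, T ∈ R.orbit S ↔ ∃ b, ∀ p, e p ∈ T ↔ D.Inc p b := by
  classical
  obtain ⟨b₀⟩ := D.nonempty_blocks
  refine ⟨Finset.univ.filter fun x => D.Inc (e.symm x) b₀, fun T => ?_⟩
  have key : ∀ g, ∀ p, e p ∈ R.ρ g • (Finset.univ.filter fun x => D.Inc (e.symm x) b₀) ↔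
      D.Inc p ((φ g : Equiv.Perm P × Equiv.Perm B).2 b₀) := by
    intro g p
    obtain ⟨q, rfl⟩ := ((φ g : Equiv.Perm P × Equiv.Perm B).1).surjective p
    rw [he, ← Equiv.Perm.smul_def, Finset.smul_mem_smul_finset_iff, (φ g).2 q b₀]
    simp
  constructor
  · rintro ⟨g, rfl⟩
    exact ⟨_, key g⟩
  · rintro ⟨b, hb⟩
    obtain ⟨g, rfl⟩ := hφ b₀ b
    refine ⟨g, Finset.ext fun x => ?_⟩
    obtain ⟨p, rfl⟩ := e.surjective x
    rw [key, hb]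

lemma params_of_orbit {P B : Type*} {D : IncidenceStructure P B} (hD : D.IsSimple) {t v k lam : ℕ}
    (h : D.IsDesign t v k lam) (𝓑 : Set (Finset (Fin v))) (e : P ≃ Fin v)
    (hS : ∀ T, T ∈ 𝓑 ↔ ∃ b, ∀ p, e p ∈ T ↔ D.Inc p b) :
    (∀ S ∈ 𝓑, S.card = k) ∧ ∀ T : Finset (Fin v), T.card = t → blockCount 𝓑 T = lam := by
  have := D.nonempty_points
  have := D.nonempty_blocks
  obtain ⟨f, rfl⟩ := exists_eq_ofFamily e D hD hS
  refine ⟨fun S hS' => ?_, blockCount_of_isDesign e f h⟩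
  have := h.card_block (f.symm ⟨S, hS'⟩)
  rwa [pointsOf_ofFamily_ncard, Equiv.apply_symm_apply] at this

open IncidenceStructure OrbitModel

/-! ### The designs of the list -/

section Realize

variable {v : ℕ} (R : Rep v)

lemma Rep.transitive (hv : 1 < v) (h : (List.range v).all (fun y => (List.range 11).any fun j =>
    (List.range 11).any fun k => R.act [k, j] 1 == y) = true) (x y : Fin v) :
    ∃ g, R.ρ g x = y := by
  have key : ∀ y : Fin v, ∃ g, R.ρ g ⟨1, hv⟩ = y := by
    intro y
    have h1 := List.all_eq_true.1 h y (List.mem_range.2 y.2)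
    obtain ⟨j, -, h2⟩ := List.any_eq_true.1 h1
    obtain ⟨k, -, h3⟩ := List.any_eq_true.1 h2
    refine ⟨ev [k, j], Fin.ext ?_⟩
    rw [R.ρ_ev]
    exact beq_iff_eq.1 h3
  obtain ⟨g, hg⟩ := key x
  obtain ⟨g', hg'⟩ := key y
  refine ⟨g' * g⁻¹, ?_⟩
  rw [← hg, ← hg', map_mul, map_inv]
  simp

lemma transitive11 : ∀ x y, ∃ g, R11.ρ g x = y := R11.transitive (by norm_num) (by decide +kernel)
lemma transitive12 : ∀ x y, ∃ g, R12.ρ g x = y := R12.transitive (by norm_num) (by decide +kernel)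
lemma transitive22 : ∀ x y, ∃ g, R22.ρ g x = y := R22.transitive (by norm_num) (by decide +kernel)

lemma nonempty_equiv_of_eq_range (hR : Function.Injective R.ρ) {𝓑 : Set (Finset (Fin v))}
    (h : MulAction.stabilizer (Equiv.Perm (Fin v)) 𝓑 = R.range) :
    Nonempty (MulAction.stabilizer (Equiv.Perm (Fin v)) 𝓑 ≃* MathieuM11) :=
  ⟨(MulEquiv.subgroupCongr h).trans (MonoidHom.ofInjective hR).symm⟩

lemma ncard_sdiff_of_card {k : ℕ} (𝓑 : Set (Finset (Fin v))) (hk : ∀ S ∈ 𝓑, S.card = k) :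
    ({S : Finset (Fin v) | S.card = k} \ 𝓑).ncard = v.choose k - 𝓑.ncard := by
  rw [Set.ncard_sdiff (show 𝓑 ⊆ {S | S.card = k} from hk) (Set.toFinite _), ncard_setOf_card]

lemma not_blockCount_of_not_dvd {s k n : ℕ} {𝓑 : Set (Finset (Fin v))} (hn : 𝓑.ncard = n)
    (hk : ∀ S ∈ 𝓑, S.card = k) (h : ¬ v.choose s ∣ n * k.choose s) (l : ℕ) :
    ¬ ∀ T : Finset (Fin v), T.card = s → blockCount 𝓑 T = l := by
  intro hl
  have := choose_mul_eq 𝓑 hk hl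
  rw [hn] at this
  exact h ⟨l, this.symm⟩

lemma realizes_of_blockCount {m t k lam n num : ℕ} {G : GrpCat.{0}}
    (hk : popcount m v = k) (hn : (R.orbit (maskSet v m)).ncard = n) (htk : t ≤ k)
    (hl : ∀ T : Finset (Fin v), T.card = t → blockCount (R.orbit (maskSet v m)) T = lam)
    (hs : t + 1 ≤ k → ¬ v.choose (t + 1) ∣ n * k.choose (t + 1))
    (htr : ∀ x y, ∃ g, R.ρ g x = y) (hv : 0 < v) (hn0 : 0 < n)
    (hG : Nonempty (MulAction.stabilizer (Equiv.Perm (Fin v)) (R.orbit (maskSet v m)) ≃* G)) :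
    Realizes ⟨v, R, m⟩ ⟨t, v, k, lam, n, num, G⟩ where
  v_eq := rfl
  ncard_eq := hn
  card_eq := (card_maskSet v m).trans hk
  t_le := htk
  blockCount_eq := hl
  strength h := not_blockCount_of_not_dvd hn
    (fun _ hS => (R.card_of_mem_orbit hS).trans ((card_maskSet v m).trans hk)) (hs h)
  transitive := htr
  v_pos := hv
  blocks_pos := hn0
  aut := hG

lemma realizes_of_transitive {m t k lam n num : ℕ} {G : GrpCat.{0}} (T₀ : Finset (Fin v))
    (hT₀ : ∀ T : Finset (Fin v), T.card = t → T ∈ R.orbit T₀)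
    (hk : popcount m v = k) (hn : (R.orbit (maskSet v m)).ncard = n) (htk : t ≤ k)
    (hl : v.choose t * lam = n * k.choose t)
    (hs : t + 1 ≤ k → ¬ v.choose (t + 1) ∣ n * k.choose (t + 1))
    (htr : ∀ x y, ∃ g, R.ρ g x = y) (hv : 0 < v) (htv : t ≤ v) (hn0 : 0 < n)
    (hG : Nonempty (MulAction.stabilizer (Equiv.Perm (Fin v)) (R.orbit (maskSet v m)) ≃* G)) :
    Realizes ⟨v, R, m⟩ ⟨t, v, k, lam, n, num, G⟩ :=
  realizes_of_blockCount R hk hn htk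
    (R.blockCount_eq_of_transitive _ T₀ ((card_maskSet v m).trans hk) hT₀ (by rw [hn, hl]) htv)
    hs htr hv hn0 hG

end Realize

lemma mem_orbit11_three (T : Finset (Fin 11)) (hT : T.card = 3) : T ∈ R11.orbit (maskSet 11 7) := by
  simpa using orbits11 3 [7] (by simp) T hT

lemma mem_orbit11_four (T : Finset (Fin 11)) (hT : T.card = 4) :
    T ∈ R11.orbit (maskSet 11 15) := by
  simpa using orbits11 4 [15] (by simp) T hT

lemma mem_orbit12_three (T : Finset (Fin 12)) (hT : T.card = 3) :
    T ∈ R12.orbit (maskSet 12 7) := by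
  simpa using orbits12 3 [7] (by simp) T hT

/-- A design of all `k`-sets. -/
lemma realizes_full {v : ℕ} (R : Rep v) {m k n num : ℕ} {G : GrpCat.{0}}
    (h : ∀ T : Finset (Fin v), T.card = k → T ∈ R.orbit (maskSet v m)) (hk : popcount m v = k)
    (hn : v.choose k = n) (htr : ∀ x y, ∃ g, R.ρ g x = y) (hv : 0 < v) (hkv : k ≤ v)
    (hG : Nonempty (Equiv.Perm (Fin v) ≃* G)) : Realizes ⟨v, R, m⟩ ⟨k, v, k, 1, n, num, G⟩ := by
  have heq : R.orbit (maskSet v m) = {S | S.card = k} :=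
    Set.ext fun S => ⟨fun hS => (R.card_of_mem_orbit hS).trans ((card_maskSet v m).trans hk), h S⟩
  have hn' : (R.orbit (maskSet v m)).ncard = n := by rw [heq, ncard_setOf_card, hn]
  refine realizes_of_transitive R (maskSet v m) h hk hn' le_rfl (by simp [hn])
    (fun h => absurd h (by omega)) htr hv hkv (hn ▸ Nat.choose_pos hkv) (hG.map fun a => ?_)
  refine ((MulEquiv.subgroupCongr ?_).trans Subgroup.topEquiv).trans a
  rw [heq, stabilizer_setOf_card]

lemma realizes11 {m n lam num : ℕ} (hk : popcount m 11 = 5)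
    (hn : (R11.orbit (maskSet 11 m)).ncard = n) (hl : 330 * lam = n * 5) (hs : ¬ 462 ∣ n)
    (hG : MulAction.stabilizer (Equiv.Perm (Fin 11)) (R11.orbit (maskSet 11 m)) = R11.range) :
    Realizes ⟨11, R11, m⟩ ⟨4, 11, 5, lam, n, num, GrpCat.of MathieuM11⟩ :=
  realizes_of_transitive R11 (maskSet 11 15) mem_orbit11_four hk hn (by norm_num) hl
    (fun _ h => hs (by simpa [Nat.choose] using h)) transitive11 (by norm_num) (by norm_num)
    (Nat.pos_of_ne_zero (by rintro rfl; simp at hs))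
    (nonempty_equiv_of_eq_range R11 R11_injective hG)

lemma realizes12 {m k n lam num : ℕ} (hk : popcount m 12 = k) (hk4 : 4 ≤ k)
    (hn : (R12.orbit (maskSet 12 m)).ncard = n) (hl : 220 * lam = n * k.choose 3)
    (hs : ¬ 495 ∣ n * k.choose 4)
    (hG : MulAction.stabilizer (Equiv.Perm (Fin 12)) (R12.orbit (maskSet 12 m)) = R12.range) :
    Realizes ⟨12, R12, m⟩ ⟨3, 12, k, lam, n, num, GrpCat.of MathieuM11⟩ :=
  realizes_of_transitive R12 (maskSet 12 7) mem_orbit12_three hk hn (by omega) hl (fun _ => hs)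
    transitive12 (by norm_num) (by norm_num) (Nat.pos_of_ne_zero (by rintro rfl; simp at hs))
    (nonempty_equiv_of_eq_range R12 R12_injective hG)

lemma orbit12_23 :
    R12.orbit (maskSet 12 23) = {S | S.card = 4} \ R12.orbit (maskSet 12 15) :=
  R12.orbit_eq_sdiff _ (by rw [card_maskSet]; decide) _ (R12.range_le_stabilizer _)
    (disjoint_orbit_of_testBit R12 (by norm_num) (by norm_num) (by decide +kernel))
    (fun S hS => by simpa using orbits12 4 [15, 23] (by simp) S hS)

lemma orbit12_63 : R12.orbit (maskSet 12 63) = {S | S.card = 6} \ hexads := by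
  refine R12.orbit_eq_sdiff _ (by rw [card_maskSet]; decide) _ ?_ ?_ ?_
  · rw [hexads]
    rintro σ hσ
    have h1 := MulAction.mem_stabilizer_set.1 (R12.range_le_stabilizer (maskSet 12 237) hσ)
    have h2 := MulAction.mem_stabilizer_set.1 (R12.range_le_stabilizer (maskSet 12 95) hσ)
    rw [MulAction.mem_stabilizer_set]
    exact fun S => or_congr (h1 S) (h2 S)
  · rw [hexads, Set.mem_union, not_or]
    exact ⟨disjoint_orbit_of_testBit R12 (by norm_num) (by norm_num) (by decide +kernel),
      disjoint_orbit_of_testBit R12 (by norm_num) (by norm_num) (by decide +kernel)⟩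
  · intro S hS
    simpa [hexads, or_assoc] using orbits12 6 [237, 95, 63] (by simp) S hS

lemma card_of_mem_orbit12 {m k : ℕ} (hk : popcount m 12 = k) :
    ∀ S ∈ R12.orbit (maskSet 12 m), S.card = k :=
  fun _ hS => (R12.card_of_mem_orbit hS).trans ((card_maskSet 12 m).trans hk)

lemma card_of_mem_hexads : ∀ S ∈ hexads, S.card = 6 := by
  rintro S (hS | hS) <;> exact card_of_mem_orbit12 (by decide) S hS

lemma ncard_hexads : hexads.ncard = 132 := by
  have h1 := ncard_orbit12 237 22 (by simp)
  have h2 := ncard_orbit12 95 110 (by simp)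
  rw [hexads, Set.ncard_union_eq, h1, h2]
  rw [Set.disjoint_left]
  intro S hS hS'
  rw [← R12.orbit_eq_of_mem hS] at h1
  rw [← R12.orbit_eq_of_mem hS', h1] at h2
  omega

/-- Of the six 5-sets in a 6-set that is not a hexad, one lies in the orbit with 132 members. -/
lemma blockCount_orbit12_63 (T : Finset (Fin 12)) (hT : T.card = 5) :
    blockCount (R12.orbit (maskSet 12 63)) T = 6 := by
  have hn : (R12.orbit (maskSet 12 63)).ncard = 792 := by
    rw [orbit12_63, ncard_sdiff_of_card _ card_of_mem_hexads, ncard_hexads]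
    decide
  have h59 := ncard_orbit12 59 132 (by simp)
  have h31 : (R12.orbit (maskSet 12 31)).ncard = 660 := by
    rw [orbit12_31, ncard_sdiff_of_card _ (card_of_mem_orbit12 (by decide)), h59]
    decide
  have hmem := R12.mem_orbit_iff_testBit (m := 59) (by norm_num) (isClosed12 59 (by simp))
  have h := orbits12 5 [59, 31] (by simp) T hT
  simp only [List.mem_cons, List.not_mem_nil, or_false, exists_eq_or_imp, exists_eq_left] at h
  rcases h with h | h
  · have h1 := R12.ncard_orbit_mul_blockCount (maskSet 12 63) T
    rw [R12.orbit_eq_of_mem h, ncard_subsets_eq_countSub (k := 5) _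
      (fun x => (R12.orbitMap 59).testBit x) (fun U => by
        rw [← hmem]
        exact ⟨fun hU => ⟨card_of_mem_orbit12 (by decide) U hU, hU⟩, fun hU => hU.2⟩),
      h59, hn] at h1
    have h2 : (force (R12.orbitMap 59) fun bm =>
        countSub (fun x => bm.testBit x)
          ((List.finRange 12).filter fun p => (63 : ℕ).testBit p) 5 0) = 1 := by
      decide +kernel
    rw [force_eq] at h2
    rw [h2] at h1
    omega
  · have h1 := R12.ncard_orbit_mul_blockCount (maskSet 12 63) T
    rw [R12.orbit_eq_of_mem h, ncard_subsets_eq_countSub (k := 5) _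
      (fun x => !(R12.orbitMap 59).testBit x) (fun U => by
        rw [orbit12_31, Set.mem_sdiff, hmem, Bool.not_eq_true', Bool.not_eq_true]
        rfl),
      h31, hn] at h1
    have h2 : (force (R12.orbitMap 59) fun bm =>
        countSub (fun x => !bm.testBit x)
          ((List.finRange 12).filter fun p => (63 : ℕ).testBit p) 5 0) = 5 := by
      decide +kernel
    rw [force_eq] at h2
    rw [h2] at h1
    omega

lemma realizes12_63 {num : ℕ} :
    Realizes ⟨12, R12, 63⟩ ⟨5, 12, 6, 6, 792, num, GrpCat.of MathieuM12⟩ := by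
  refine realizes_of_blockCount R12 (by decide) ?_ (by norm_num) blockCount_orbit12_63
    (by decide) transitive12 (by norm_num) (by norm_num) ⟨MulEquiv.subgroupCongr ?_⟩
  · rw [orbit12_63, ncard_sdiff_of_card _ card_of_mem_hexads, ncard_hexads]
    decide
  · rw [orbit12_63, stabilizer_card_diff _ card_of_mem_hexads, stabilizer_hexads]

lemma popcount_mask22 (i : Fin 12) : popcount (mask22 i) 22 = 7 := by
  revert i; decide +kernel

lemma realizes22_two (i : Fin 12) (hi : (i : ℕ) < 7) {lam n num : ℕ} (hn : size22 i = n)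
    (hl : 11 * lam = n) (hn0 : 0 < n) :
    Realizes ⟨22, R22, mask22 i⟩ ⟨2, 22, 7, lam, n, num, GrpCat.of MathieuM11⟩ where
  v_eq := rfl
  ncard_eq := (ncard_blocks22 i).trans hn
  card_eq := (card_maskSet _ _).trans (popcount_mask22 i)
  t_le := by norm_num
  blockCount_eq T hT := by
    have := blockCount_pair i T hT
    change blockCount (blocks22 i) T = lam
    omega
  strength _ l h := by
    have := seven_le_of_blockCount_three i l h
    omega
  transitive := transitive22
  v_pos := by norm_num
  blocks_pos := hn0
  aut := nonempty_equiv_of_eq_range R22 R22_injective (stabilizer_blocks22 i (by omega))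

lemma realizes22_three (i : Fin 12) (hi : 7 ≤ (i : ℕ)) {lam n num : ℕ} {G : GrpCat.{0}}
    (hn : size22 i = n) (hl : 44 * lam = n) (hs : ¬ 7315 ∣ n * 35) (hn0 : 0 < n)
    (hG : Nonempty (MulAction.stabilizer (Equiv.Perm (Fin 22)) (blocks22 i) ≃* G)) :
    Realizes ⟨22, R22, mask22 i⟩ ⟨3, 22, 7, lam, n, num, G⟩ := by
  refine realizes_of_blockCount R22 (popcount_mask22 i) ((ncard_blocks22 i).trans hn) (by norm_num)
    (fun T hT => ?_) (fun _ => hs) transitive22 (by norm_num) hn0 hG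
  have := blockCount_three i hi T hT
  change blockCount (blocks22 i) T = lam
  omega

lemma nonempty_equiv_swap (i : Fin 12) (h : 7 ≤ (i : ℕ) ∧ (i : ℕ) ≤ 10) :
    Nonempty (MulAction.stabilizer (Equiv.Perm (Fin 22)) (blocks22 i) ≃*
      GrpCat.of (MathieuM11 × Multiplicative (ZMod 2))) :=
  ⟨(MulEquiv.subgroupCongr (stabilizer_blocks22_swap i h)).trans
    (MonoidHom.ofInjective swapHom_injective).symm⟩

/-- The `j`-th design of each row of the table. -/
noncomputable def models : Fin 19 → ℕ → OrbitModel :=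
  ![fun _ => ⟨11, R11, 7⟩, fun _ => ⟨11, R11, 15⟩, fun _ => ⟨11, R11, 61⟩, fun _ => ⟨11, R11, 31⟩,
    fun _ => ⟨12, R12, 7⟩, fun _ => ⟨12, R12, 23⟩, fun _ => ⟨12, R12, 15⟩, fun _ => ⟨12, R12, 59⟩,
    fun _ => ⟨12, R12, 31⟩, fun _ => ⟨12, R12, 237⟩, fun _ => ⟨12, R12, 95⟩,
    fun _ => ⟨12, R12, 63⟩,
    fun _ => ⟨22, R22, mask22 0⟩, fun _ => ⟨22, R22, mask22 1⟩,
    fun j => ⟨22, R22, mask22 (Fin.ofNat 12 (2 + j))⟩,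
    fun j => ⟨22, R22, mask22 (Fin.ofNat 12 (5 + j))⟩, fun _ => ⟨22, R22, mask22 7⟩,
    fun j => ⟨22, R22, mask22 (Fin.ofNat 12 (8 + j))⟩, fun _ => ⟨22, R22, mask22 11⟩]

lemma realizes_models (x : DesignIndex) : (models x.1 x.2).Realizes (designTable x.1) := by
  obtain ⟨r, j, hj⟩ := x
  have h15 := ncard_orbit12 15 165 (by simp)
  have h59 := ncard_orbit12 59 132 (by simp)
  fin_cases r
  · exact realizes_full R11 mem_orbit11_three (by decide) (by decide) transitive11 (by norm_num)
      (by norm_num) ⟨MulEquiv.refl _⟩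
  · exact realizes_full R11 mem_orbit11_four (by decide) (by decide) transitive11 (by norm_num)
      (by norm_num) ⟨MulEquiv.refl _⟩
  · exact realizes11 (by decide) ncard_orbit11 (by norm_num) (by norm_num) stabilizer_orbit11
  · refine realizes11 (by decide) ?_ (by norm_num) (by norm_num) ?_
    · rw [orbit11_31, ncard_sdiff_of_card _ (fun S hS => card_of_mem_orbit11 hS), ncard_orbit11]
      decide
    · rw [orbit11_31, stabilizer_card_diff _ (fun S hS => card_of_mem_orbit11 hS),
        stabilizer_orbit11]
  · exact realizes_full R12 mem_orbit12_three (by decide) (by decide) transitive12 (by norm_num)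
      (by norm_num) ⟨MulEquiv.refl _⟩
  · refine realizes12 (by decide) (by norm_num) ?_ (by decide) (by decide) ?_
    · rw [orbit12_23, ncard_sdiff_of_card _ (card_of_mem_orbit12 (by decide)), h15]
      decide
    · rw [orbit12_23, stabilizer_card_diff _ (card_of_mem_orbit12 (by decide)),
        stabilizer_orbit12_15]
  · exact realizes12 (by decide) (by norm_num) h15 (by decide) (by decide) stabilizer_orbit12_15
  · exact realizes12 (by decide) (by norm_num) h59 (by decide) (by decide) stabilizer_orbit12_59
  · refine realizes12 (by decide) (by norm_num) ?_ (by decide) (by decide) ?_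
    · rw [orbit12_31, ncard_sdiff_of_card _ (card_of_mem_orbit12 (by decide)), h59]
      decide
    · rw [orbit12_31, stabilizer_card_diff _ (card_of_mem_orbit12 (by decide)),
        stabilizer_orbit12_59]
  · exact realizes12 (by decide) (by norm_num) (ncard_orbit12 237 22 (by simp)) (by decide)
      (by decide) stabilizer_orbit12_237
  · exact realizes12 (by decide) (by norm_num) (ncard_orbit12 95 110 (by simp)) (by decide)
      (by decide) stabilizer_orbit12_95
  · exact realizes12_63
  · exact realizes22_two 0 (by decide) rfl (by norm_num) (by norm_num)
  · exact realizes22_two 1 (by decide) rfl (by norm_num) (by norm_num)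
  · change j < 3 at hj
    have : ∀ j < 3, ((Fin.ofNat 12 (2 + j) : Fin 12) : ℕ) < 7 ∧
      size22 (Fin.ofNat 12 (2 + j)) = 3960 := by decide
    exact realizes22_two (Fin.ofNat 12 (2 + j)) (this j hj).1 (this j hj).2 (by norm_num)
      (by norm_num)
  · change j < 2 at hj
    have : ∀ j < 2, ((Fin.ofNat 12 (5 + j) : Fin 12) : ℕ) < 7 ∧
      size22 (Fin.ofNat 12 (5 + j)) = 7920 := by decide
    exact realizes22_two (Fin.ofNat 12 (5 + j)) (this j hj).1 (this j hj).2 (by norm_num)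
      (by norm_num)
  · exact realizes22_three 7 (by decide) rfl (by norm_num) (by norm_num) (by norm_num)
      (nonempty_equiv_swap 7 (by decide))
  · change j < 3 at hj
    have : ∀ j < 3, (7 ≤ ((Fin.ofNat 12 (8 + j) : Fin 12) : ℕ) ∧
      ((Fin.ofNat 12 (8 + j) : Fin 12) : ℕ) ≤ 10) ∧
      size22 (Fin.ofNat 12 (8 + j)) = 3960 := by decide
    exact realizes22_three (Fin.ofNat 12 (8 + j)) (this j hj).1.1 (this j hj).2 (by norm_num)
      (by norm_num) (by norm_num) (nonempty_equiv_swap _ (this j hj).1)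
  · exact realizes22_three 11 (by decide) rfl (by norm_num) (by norm_num) (by norm_num)
      (nonempty_equiv_of_eq_range R22 R22_injective (stabilizer_blocks22 11 (by decide)))

open IncidenceStructure OrbitModel

/-! ### Non-isomorphic designs -/

/-- The indices of the designs with 22 points. -/
def index22 : Fin 12 → DesignIndex :=
  ![⟨12, ⟨0, by decide⟩⟩, ⟨13, ⟨0, by decide⟩⟩, ⟨14, ⟨0, by decide⟩⟩, ⟨14, ⟨1, by decide⟩⟩,
    ⟨14, ⟨2, by decide⟩⟩, ⟨15, ⟨0, by decide⟩⟩, ⟨15, ⟨1, by decide⟩⟩, ⟨16, ⟨0, by decide⟩⟩,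
    ⟨17, ⟨0, by decide⟩⟩, ⟨17, ⟨1, by decide⟩⟩, ⟨17, ⟨2, by decide⟩⟩, ⟨18, ⟨0, by decide⟩⟩]

lemma models_index22 (i : Fin 12) :
    models (index22 i).1 (index22 i).2 = ⟨22, R22, mask22 i⟩ := by
  fin_cases i <;> rfl

lemma exists_index22 (x : DesignIndex) (h : 12 ≤ (x.1 : ℕ)) : ∃ i, x = index22 i := by
  obtain ⟨r, j, hj⟩ := x
  fin_cases r
  iterate 12 exact absurd h (by norm_num)
  · change j < 1 at hj
    interval_cases j
    exact ⟨0, rfl⟩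
  · change j < 1 at hj
    interval_cases j
    exact ⟨1, rfl⟩
  · change j < 3 at hj
    interval_cases j
    exacts [⟨2, rfl⟩, ⟨3, rfl⟩, ⟨4, rfl⟩]
  · change j < 2 at hj
    interval_cases j
    exacts [⟨5, rfl⟩, ⟨6, rfl⟩]
  · change j < 1 at hj
    interval_cases j
    exact ⟨7, rfl⟩
  · change j < 3 at hj
    interval_cases j
    exacts [⟨8, rfl⟩, ⟨9, rfl⟩, ⟨10, rfl⟩]
  · change j < 1 at hj
    interval_cases j
    exact ⟨11, rfl⟩

/-- Numbers of points and blocks separate the rows with 11 or 12 points. -/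
lemma eq_or_of_v_eq_of_blocks_eq : ∀ r s : Fin 19, (designTable r).v = (designTable s).v →
    (designTable r).blocks = (designTable s).blocks →
      (r = s ∧ (designTable r).num = 1) ∨ (12 ≤ (r : ℕ) ∧ 12 ≤ (s : ℕ)) := by
  decide +kernel

lemma eq_of_isIsomorphic (x y : DesignIndex)
    (h : (realizes_models x).design.IsIsomorphic (realizes_models y).design) : x = y := by
  have hv : (designTable x.1).v = (designTable y.1).v := by
    obtain ⟨f, -⟩ := h
    simpa using Fintype.card_congr f
  have hb : (designTable x.1).blocks = (designTable y.1).blocks := by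
    obtain ⟨-, g, -⟩ := h
    simpa using Fintype.card_congr g
  rcases eq_or_of_v_eq_of_blocks_eq x.1 y.1 hv hb with ⟨h1, h2⟩ | ⟨h1, h2⟩
  · obtain ⟨r, j, hj⟩ := x
    obtain ⟨s, j', hj'⟩ := y
    obtain rfl : r = s := h1
    change (designTable r).num = 1 at h2
    obtain rfl : j = j' := by omega
    rfl
  · obtain ⟨i, rfl⟩ := exists_index22 x h1
    obtain ⟨j, rfl⟩ := exists_index22 y h2
    have key : ∀ M M' : OrbitModel, M = ⟨22, R22, mask22 i⟩ → M' = ⟨22, R22, mask22 j⟩ →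
        ∀ (row row' : DesignRow) (h : M.Realizes row) (h' : M'.Realizes row'),
          h.design.IsIsomorphic h'.design → i = j := by
      rintro _ _ rfl rfl row row' h h' hiso
      obtain ⟨σ, hσ⟩ := Realizes.exists_perm h h' hiso
      have hσ' : MapsFamily σ (blocks22 i) (blocks22 j) := hσ
      exact (eq_of_mapsFamily hσ').1
    rw [key _ _ (models_index22 i) (models_index22 j) _ _ _ _ h]

/-! ### Completeness of the list -/

section Complete

variable {P B : Type*} (D : IncidenceStructure P B)

lemma isIsomorphic_of_mem (hD : D.IsSimple) {v m : ℕ} {R : Rep v} (x : DesignIndex)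
    (hx : models x.1 x.2 = ⟨v, R, m⟩) {S : Finset (Fin v)} (hS : S ∈ R.orbit (maskSet v m))
    (e : P ≃ Fin v) (h : ∀ T, T ∈ R.orbit S ↔ ∃ b, ∀ p, e p ∈ T ↔ D.Inc p b) :
    D.IsIsomorphic (realizes_models x).design := by
  have key : ∀ M : OrbitModel, M = ⟨v, R, m⟩ → ∀ (row : DesignRow) (h : M.Realizes row),
      D.IsIsomorphic h.design := by
    rintro _ rfl row hr
    rw [R.orbit_eq_of_mem hS] at h
    exact hr.isIsomorphic D hD e h
  exact key _ hx _ _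

theorem exists_isIsomorphic {v k lam : ℕ} (hv : v = 11 ∨ v = 12 ∨ v = 22) (h3 : 3 ≤ k)
    (hk : 2 * k ≤ v) (hd : D.IsDesign 2 v k lam) (hD : D.IsSimple)
    (ha : D.AdmitsTransitiveAction MathieuM11) :
    ∃ x, D.IsIsomorphic (realizes_models x).design := by
  obtain ⟨φ, hP, hB⟩ := ha
  let Φ : MathieuM11 →* Equiv.Perm P := (MonoidHom.fst _ _).comp (D.aut.subtype.comp φ)
  have := hd.finite_points
  have hcard := hd.card_points
  rcases hv with rfl | rfl | rfl
  · obtain ⟨e, he⟩ := exists_equiv11 Φ hP hcard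
    obtain ⟨S, hS⟩ := exists_orbit_of_action D R11 φ hB e he
    have hk' := (params_of_orbit hD hd _ e hS).1 S (R11.self_mem_orbit S)
    have key : ∀ l, (k, l) ∈ [(3, [7]), (4, [15]), (5, [61, 31])] →
        ∃ m ∈ l, S ∈ R11.orbit (maskSet 11 m) := fun l hl => orbits11 k l hl S hk'
    have hk5 : k ≤ 5 := by omega
    interval_cases k
    · have := key [7] (by simp)
      simp only [List.mem_cons, List.not_mem_nil, or_false, exists_eq_left] at this
      exact ⟨⟨0, ⟨0, by decide⟩⟩, isIsomorphic_of_mem D hD _ rfl this e hS⟩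
    · have := key [15] (by simp)
      simp only [List.mem_cons, List.not_mem_nil, or_false, exists_eq_left] at this
      exact ⟨⟨1, ⟨0, by decide⟩⟩, isIsomorphic_of_mem D hD _ rfl this e hS⟩
    · have := key [61, 31] (by simp)
      simp only [List.mem_cons, List.not_mem_nil, or_false, exists_eq_or_imp,
        exists_eq_left] at this
      rcases this with h | h
      · exact ⟨⟨2, ⟨0, by decide⟩⟩, isIsomorphic_of_mem D hD _ rfl h e hS⟩
      · exact ⟨⟨3, ⟨0, by decide⟩⟩, isIsomorphic_of_mem D hD _ rfl h e hS⟩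
  · obtain ⟨e, he⟩ := exists_equiv12 Φ hP hcard
    obtain ⟨S, hS⟩ := exists_orbit_of_action D R12 φ hB e he
    have hk' := (params_of_orbit hD hd _ e hS).1 S (R12.self_mem_orbit S)
    have key : ∀ l, (k, l) ∈ [(3, [7]), (4, [15, 23]), (5, [59, 31]), (6, [237, 95, 63])] →
        ∃ m ∈ l, S ∈ R12.orbit (maskSet 12 m) := fun l hl => orbits12 k l hl S hk'
    have hk6 : k ≤ 6 := by omega
    interval_cases k
    · have := key [7] (by simp)
      simp only [List.mem_cons, List.not_mem_nil, or_false, exists_eq_left] at this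
      exact ⟨⟨4, ⟨0, by decide⟩⟩, isIsomorphic_of_mem D hD _ rfl this e hS⟩
    · have := key [15, 23] (by simp)
      simp only [List.mem_cons, List.not_mem_nil, or_false, exists_eq_or_imp,
        exists_eq_left] at this
      rcases this with h | h
      · exact ⟨⟨6, ⟨0, by decide⟩⟩, isIsomorphic_of_mem D hD _ rfl h e hS⟩
      · exact ⟨⟨5, ⟨0, by decide⟩⟩, isIsomorphic_of_mem D hD _ rfl h e hS⟩
    · have := key [59, 31] (by simp)
      simp only [List.mem_cons, List.not_mem_nil, or_false, exists_eq_or_imp,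
        exists_eq_left] at this
      rcases this with h | h
      · exact ⟨⟨7, ⟨0, by decide⟩⟩, isIsomorphic_of_mem D hD _ rfl h e hS⟩
      · exact ⟨⟨8, ⟨0, by decide⟩⟩, isIsomorphic_of_mem D hD _ rfl h e hS⟩
    · have := key [237, 95, 63] (by simp)
      simp only [List.mem_cons, List.not_mem_nil, or_false, exists_eq_or_imp,
        exists_eq_left] at this
      rcases this with h | h | h
      · exact ⟨⟨9, ⟨0, by decide⟩⟩, isIsomorphic_of_mem D hD _ rfl h e hS⟩
      · exact ⟨⟨10, ⟨0, by decide⟩⟩, isIsomorphic_of_mem D hD _ rfl h e hS⟩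
      · exact ⟨⟨11, ⟨0, by decide⟩⟩, isIsomorphic_of_mem D hD _ rfl h e hS⟩
  · obtain ⟨e, he⟩ := exists_equiv22 Φ hP hcard
    obtain ⟨S, hS⟩ := exists_orbit_of_action D R22 φ hB e he
    obtain ⟨hk', hl⟩ := params_of_orbit hD hd _ e hS
    have hk' := hk' S (R22.self_mem_orbit S)
    obtain ⟨i, hi | hi⟩ := exists_mem_blocks22 S
      (mem_setsOfType_of_blockCount_two S lam (by omega) (by omega) hl)
    · exact ⟨index22 i, isIsomorphic_of_mem D hD _ (models_index22 i) hi e hS⟩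
    · refine ⟨index22 i, isIsomorphic_of_mem D hD _ (models_index22 i) hi (e.trans swap) ?_⟩
      intro T
      have h1 : T ∈ R22.orbit (swap • S) ↔ swap • T ∈ R22.orbit S := by
        constructor
        · rintro ⟨g, rfl⟩
          refine ⟨g, ?_⟩
          rw [smul_smul, smul_smul, ← (swap_comm g).eq, mul_assoc, swap_mul_self, mul_one]
        · rintro ⟨g, hg⟩
          refine ⟨g, ?_⟩
          rw [smul_smul, (swap_comm g).eq, mul_smul, hg, smul_smul, swap_mul_self, one_smul]
      rw [h1, hS]
      refine exists_congr fun b => forall_congr' fun p => iff_congr ?_ Iff.rfl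
      have h2 : (swap • (e.trans swap p)) = e p := by
        change (swap * swap) (e p) = e p
        rw [swap_mul_self]
        rfl
      rw [← h2, Finset.smul_mem_smul_finset_iff]

end Complete

end M11Designs

theorem mainTheorem2 :
    ∃ E : (x : DesignIndex) →
        IncidenceStructure (Fin (designTable x.1).v) (Fin (designTable x.1).blocks),
      -- Each design of the list is as described in its row of the table.
      (∀ x : DesignIndex,
        (E x).IsDesignOfStrength (designTable x.1).t (designTable x.1).v
            (designTable x.1).k (designTable x.1).lam ∧
          (E x).IsSimple ∧
          (E x).AdmitsTransitiveAction MathieuM11 ∧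
          Nonempty ((E x).aut ≃* (designTable x.1).autGroup)) ∧
      -- The designs of the list are pairwise non-isomorphic.
      (∀ x y : DesignIndex, (E x).IsIsomorphic (E y) → x = y) ∧
      -- The list is complete for block sizes `3 ≤ k ≤ v / 2`.
      (∀ (P : Type*) (B : Type*) (D : IncidenceStructure P B) (t v k lam : ℕ),
        2 ≤ t → (v = 11 ∨ v = 12 ∨ v = 22) → 3 ≤ k → 2 * k ≤ v →
        D.IsDesign t v k lam → D.IsSimple → D.AdmitsTransitiveAction MathieuM11 →
          ∃ x : DesignIndex, D.IsIsomorphic (E x)) ∧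
      -- The designs with `v / 2 ≤ k ≤ v - 3` are the complements of designs of the list.
      (∀ (P : Type*) (B : Type*) (D : IncidenceStructure P B) (t v k lam : ℕ),
        2 ≤ t → (v = 11 ∨ v = 12 ∨ v = 22) → v ≤ 2 * k → k + 3 ≤ v →
        D.IsDesign t v k lam → D.IsSimple → D.AdmitsTransitiveAction MathieuM11 →
          ∃ x : DesignIndex, D.compl.IsIsomorphic (E x)) := by
  refine ⟨fun x => (M11Designs.realizes_models x).design, fun x => ?_,
    M11Designs.eq_of_isIsomorphic, ?_, ?_⟩
  · have h := M11Designs.realizes_models x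
    exact ⟨h.isDesignOfStrength, h.isSimple, h.admitsTransitiveAction, h.nonempty_aut⟩
  · intro P B D t v k lam ht hv h3 hk hd hD ha
    obtain ⟨lam', hd'⟩ := M11Designs.isDesign_of_le hd ht
    exact M11Designs.exists_isIsomorphic D hv h3 hk hd' hD ha
  · intro P B D t v k lam ht hv hk h3 hd hD ha
    obtain ⟨lam', hd'⟩ := M11Designs.isDesign_of_le hd ht
    obtain ⟨mu, hd''⟩ := M11Designs.isDesign_compl hd' (by omega)
    exact M11Designs.exists_isIsomorphic D.compl hv (by omega) (by omega) hd''
      (M11Designs.isSimple_compl hD) (M11Designs.admitsTransitiveAction_compl ha)
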